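/- **Setting.** Fix $d\ge 2$, $\gamma_2\in(-d+1,1]$, $\gamma_3\in(-2d+1,1]$. Let $b_2:[-1,1]\to[0,\infty)$ be measurable and even, and let $b_3:[-1,1]\times[-\frac12,\frac12]\to[0,\infty)$ be measurable and even in its first argument, with $$\|b_2\|:=\int_{\mathbb S^{d-1}}b_2(\nu\cdot\omega)\,d\omega<\infty\quad(\text{for any unit vector }\nu),\qquad \|b_3\|:=\sup_{\nu\in\mathbb E}\int_{\mathbb S^{2d-1}}b_3(\nu\cdot\omega,\omega_1\cdot\omega_2)\,d\omega<\infty ,$$ where $\omega=(\omega_1,\omega_2)$ and $\mathbb E=\{(\nu_1,\nu_2)\in\mathbb R^{2d}:|\nu_1|^2+|\nu_2|^2+|\nu_1-\nu_2|^2=1\}$. At least one of $\|b_2\|,\|b_3\|$ is positive; the other may be zero, so the purely binary ($b_3=0$) and purely ternary ($b_2=0$) equations are included. For velocities $v,v_1,v_2\in\mathbb R^d$ put $u=v_1-v$, $v'=v+(\omega\cdot u)\omega$, $v_1'=v_1-(\omega\cdot u)\omega$ for $\omega\in\mathbb S^{d-1}$, and $B_2=|u|^{\gamma_2}b_2(\frac{u}{|u|}\cdot\omega)$;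 put $\mathbf u=(v_1-v,v_2-v)$, $|\tilde{\mathbf u}|=(|v-v_1|^2+|v-v_2|^2+|v_1-v_2|^2)^{1/2}$, and for $\omega=(\omega_1,\omega_2)\in\mathbb S^{2d-1}$ $$B_3=|\tilde{\mathbf u}|^{\gamma_3}\,b_3\Big(\tfrac{\mathbf u}{|\tilde{\mathbf u}|}\cdot\omega,\ \omega_1\cdot\omega_2\Big),\quad c=\tfrac{\omega\cdot\mathbf u}{1+\omega_1\cdot\omega_2},\quad v^*=v+c(\omega_1+\omega_2),\ v_1^*=v_1-c\,\omega_1,\ v_2^*=v_2-c\,\omega_2 .$$ For a function $f$ on $\mathbb R^d\times\mathbb R^d$ define the gain and loss terms $$G(f)(x,v)=\int_{\mathbb S^{d-1}\times\mathbb R^d}B_2 f(x,v')f(x,v_1')\,d\omega\,dv_1+\int_{\mathbb S^{2d-1}\times\mathbb R^{2d}}B_3f(x,v^*)f(x,v_1^*)f(x,v_2^*)\,d\omega\,dv_1dv_2,$$ $$L(f)(x,v)=\int_{\mathbb S^{d-1}\times\mathbb R^d}B_2 f(x,v)f(x,v_1)\,d\omega\,dv_1+\int_{\mathbb S^{2d-1}\times\mathbb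 R^{2d}}B_3f(x,v)f(x,v_1)f(x,v_2)\,d\omega\,dv_1dv_2 .$$ For $\alpha,\beta>0$ let $M_{\alpha,\beta}(x,v)=e^{-\alpha|x|^2-\beta|v|^2}$ and $\|f\|_{\mathcal M_{\alpha,\beta}}=\|fM_{\alpha,\beta}^{-1}\|_{L^\infty_{x,v}}$; let $\mathcal M_{\alpha,\beta}^+$ be the set of measurable, a.e. non-negative $f$ with $\|f\|_{\mathcal M_{\alpha,\beta}}<\infty$. For time-dependent $f$ on $[0,T)$, $0<T\le\infty$, write $f^\#(t,x,v)=f(t,x+tv,v)$ and $|||f|||_\infty=\sup_{t\in[0,T)}\|f(t)\|_{\mathcal M_{\alpha,\beta}}$. A *mild solution* on $[0,T)$ of the binary-ternary Boltzmann equation $\partial_tf+v\cdot\nabla_xf=G(f)-L(f)$, $f(0)=f_0\in\mathcal M_{\alpha,\beta}^+$, is a function $f$ assigning to each $t\in[0,T)$ a measurable, a.e. non-negative function $f(t)$ of $(x,v)$, such that (i) $f^\#\in C^0([0,T),L^1_{x,v})$ and $|||f^\#|||_\infty<\infty$; (ii) $(L(f))^\#,(G(f))^\#\in L^\infty([0,T),L^1_{x,v})$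 (the integrals defining them converging absolutely for every $t\in[0,T)$ and a.e. $(x,v)$); (iii) $f^\#$ is weakly differentiable in $t$ as an $L^1_{x,v}$-valued function, with $\frac{d}{dt}f^\#+(L(f))^\#=(G(f))^\#$, and $f^\#(0)=f_0$ a.e. **Theorem.** For every $d\ge2$ there is a constant $C_d>0$ depending only on $d$ such that the following holds for all $\gamma_2,\gamma_3,b_2,b_3$ as above, all $0<T\le\infty$ and all $\alpha,\beta>0$. Put $$K_\beta=C_d\Big[\|b_2\|\Big(\beta^{-d/2}+\frac1{d+\gamma_2-1}\Big)+\|b_3\|\Big(\beta^{-d}+\frac1{2d+\gamma_3-1}\Big)\Big].$$ Then $K_\beta>0$, and for every $f_0\in\mathcal M_{\alpha,\beta}^+$ with $$\|f_0\|_{\mathcal M_{\alpha,\beta}}<\frac{\alpha^{1/2}}{48K_\beta\Big(1+\frac{\alpha^{1/4}}{2\sqrt{6K_\beta}}\Big)}$$ there is a mild solution $f$ on $[0,T)$ with initial data $f_0$ satisfying $$|||f^\#|||_\infty\le C_{out}:=\frac{1-\sqrt{1-48K_\beta\alpha^{-1/2}\Big(1+\frac{\alpha^{1/4}}{2\sqrt{6K_\beta}}\Big)\|f_0\|_{\mathcal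 M_{\alpha,\beta}}}}{24K_\beta\alpha^{-1/2}\Big(1+\frac{\alpha^{1/4}}{2\sqrt{6K_\beta}}\Big)},$$ and it is unique among the mild solutions on $[0,T)$ with initial data $f_0$ satisfying this bound: if $g$ is another one, then $g(t)=f(t)$ a.e. in $(x,v)$ for every $t\in[0,T)$. -/

import Mathlib

open MeasureTheory Metric Set
open scoped ENNReal

noncomputable section

namespace BinaryTernaryBoltzmann

/-! ### Velocity space, phase space, spheres -/

/-- Positions and velocities: `ℝᵈ` with its Euclidean structure. -/
abbrev Vel (d : ℕ) : Type := EuclideanSpace ℝ (Fin d)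

/-- `ℝ²ᵈ = ℝᵈ × ℝᵈ` with its Euclidean structure, written in blocks `(w₁, w₂)`. -/
abbrev Vel2 (d : ℕ) : Type := WithLp 2 (Vel d × Vel d)

/-- Phase space: pairs `(x, v)` of a position and a velocity, with Lebesgue measure. -/
abbrev Phase (d : ℕ) : Type := Vel d × Vel d

/-- The unit sphere `𝕊ᵈ⁻¹` of `ℝᵈ`. -/
abbrev Sph (d : ℕ) : Type := sphere (0 : Vel d) 1

/-- The unit sphere `𝕊²ᵈ⁻¹` of `ℝ²ᵈ`. -/
abbrev Sph2 (d : ℕ) : Type := sphere (0 : Vel2 d) 1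

/-- Surface measure on `𝕊ᵈ⁻¹`. -/
def sphMeasure (d : ℕ) : Measure (Sph d) := (volume : Measure (Vel d)).toSphere

/-- Surface measure on `𝕊²ᵈ⁻¹`. -/
def sph2Measure (d : ℕ) : Measure (Sph2 d) := (volume : Measure (Vel2 d)).toSphere

/-- The measure `dω dv₁` on `𝕊ᵈ⁻¹ × ℝᵈ`. -/
def collMeasure2 (d : ℕ) : Measure (Sph d × Vel d) := (sphMeasure d).prod volume

/-- The measure `dω₁ dω₂ dv₁ dv₂` on `𝕊²ᵈ⁻¹ × ℝ²ᵈ`. -/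
def collMeasure3 (d : ℕ) : Measure (Sph2 d × (Vel d × Vel d)) := (sph2Measure d).prod volume

/-! ### Binary interactions -/

/-- `‖b₂‖_{L¹(𝕊ᵈ⁻¹)}`: the integral over `𝕊ᵈ⁻¹` of `ω ↦ b₂(ν · ω)`. By rotation invariance it does
not depend on the unit vector `ν`; it is written as a supremum over `ν`. -/
def angularNorm2 (d : ℕ) (b₂ : ℝ → ℝ) : ℝ≥0∞ :=
  ⨆ ν : Sph d, ∫⁻ ω : Sph d, ENNReal.ofReal (b₂ (inner ℝ (ν : Vel d) (ω : Vel d))) ∂(sphMeasure d)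

/-- The assumptions on the binary angular density `b₂ : [-1,1] → [0,∞)`. Only the values of `b₂`
on `[-1,1]` enter, here and in everything below. -/
structure IsBinaryAngular (d : ℕ) (b₂ : ℝ → ℝ) : Prop where
  measurable : Measurable (fun z : Icc (-1 : ℝ) 1 => b₂ (z : ℝ))
  nonneg : ∀ z ∈ Icc (-1 : ℝ) 1, 0 ≤ b₂ z
  even : ∀ z ∈ Icc (-1 : ℝ) 1, b₂ (-z) = b₂ z
  integrable : angularNorm2 d b₂ < ∞

/-- The binary cross-section `B₂(u, ω) = |u|^γ₂ b₂(u/|u| · ω)`. -/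
def crossSection2 {d : ℕ} (γ₂ : ℝ) (b₂ : ℝ → ℝ) (u : Vel d) (ω : Sph d) : ℝ :=
  ‖u‖ ^ γ₂ * b₂ (inner ℝ (‖u‖⁻¹ • u) (ω : Vel d))

/-- `v' = v + (ω · u) ω`, where `u = v₁ - v`. -/
def post2 {d : ℕ} (ω : Sph d) (v v₁ : Vel d) : Vel d :=
  v + (inner ℝ (ω : Vel d) (v₁ - v)) • (ω : Vel d)

/-- `v₁' = v₁ - (ω · u) ω`, where `u = v₁ - v`. -/
def post2₁ {d : ℕ} (ω : Sph d) (v v₁ : Vel d) : Vel d :=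
  v₁ - (inner ℝ (ω : Vel d) (v₁ - v)) • (ω : Vel d)

/-- The integrand of `G₂(f, g)` at `(x, v)`, as a function of `(ω, v₁)`. -/
def gainIntegrand2 {d : ℕ} (γ₂ : ℝ) (b₂ : ℝ → ℝ) (f g : Phase d → ℝ) (p : Phase d)
    (q : Sph d × Vel d) : ℝ :=
  crossSection2 γ₂ b₂ (q.2 - p.2) q.1 * f (p.1, post2 q.1 p.2 q.2) * g (p.1, post2₁ q.1 p.2 q.2)

/-- The integrand of `L₂(f, g)` at `(x, v)`, as a function of `(ω, v₁)`. -/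
def lossIntegrand2 {d : ℕ} (γ₂ : ℝ) (b₂ : ℝ → ℝ) (f g : Phase d → ℝ) (p : Phase d)
    (q : Sph d × Vel d) : ℝ :=
  crossSection2 γ₂ b₂ (q.2 - p.2) q.1 * f (p.1, p.2) * g (p.1, q.2)

/-! ### Ternary interactions -/

/-- The ellipsoid `𝔼²ᵈ⁻¹ = {(ν₁, ν₂) : |ν₁|² + |ν₂|² + |ν₁ - ν₂|² = 1}`. -/
def ellipsoid (d : ℕ) : Set (Vel2 d) :=
  {ν | ‖ν.fst‖ ^ 2 + ‖ν.snd‖ ^ 2 + ‖ν.fst - ν.snd‖ ^ 2 = 1}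

/-- `ω₁ · ω₂` for `ω = (ω₁, ω₂) ∈ 𝕊²ᵈ⁻¹`. -/
def blockInner {d : ℕ} (ω : Sph2 d) : ℝ := inner ℝ (ω : Vel2 d).fst (ω : Vel2 d).snd

/-- `‖b₃‖_{L¹(𝕊²ᵈ⁻¹)} = sup_{ν ∈ 𝔼²ᵈ⁻¹} ∫ b₃(ν · ω, ω₁ · ω₂) dω`. -/
def angularNorm3 (d : ℕ) (b₃ : ℝ → ℝ → ℝ) : ℝ≥0∞ :=
  ⨆ ν ∈ ellipsoid d,
    ∫⁻ ω : Sph2 d, ENNReal.ofReal (b₃ (inner ℝ ν (ω : Vel2 d)) (blockInner ω)) ∂(sph2Measure d)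

/-- The assumptions on the ternary angular density `b₃ : [-1,1] × [-1/2,1/2] → [0,∞)`. Only the
values of `b₃` on this rectangle enter, here and in everything below. -/
structure IsTernaryAngular (d : ℕ) (b₃ : ℝ → ℝ → ℝ) : Prop where
  measurable :
    Measurable (fun p : Icc (-1 : ℝ) 1 × Icc (-(1 / 2) : ℝ) (1 / 2) => b₃ (p.1 : ℝ) (p.2 : ℝ))
  nonneg : ∀ z ∈ Icc (-1 : ℝ) 1, ∀ w ∈ Icc (-(1 / 2) : ℝ) (1 / 2), 0 ≤ b₃ z w
  even : ∀ z ∈ Icc (-1 : ℝ) 1, ∀ w ∈ Icc (-(1 / 2) : ℝ) (1 / 2), b₃ (-z) w = b₃ z w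
  integrable : angularNorm3 d b₃ < ∞

/-- The relative velocity `𝐮 = (v₁ - v, v₂ - v) ∈ ℝ²ᵈ`. -/
def relVel3 {d : ℕ} (v v₁ v₂ : Vel d) : Vel2 d := WithLp.toLp 2 (v₁ - v, v₂ - v)

/-- `|𝐮̃| = (|v - v₁|² + |v - v₂|² + |v₁ - v₂|²)^{1/2}`. -/
def relSize3 {d : ℕ} (v v₁ v₂ : Vel d) : ℝ :=
  Real.sqrt (‖v - v₁‖ ^ 2 + ‖v - v₂‖ ^ 2 + ‖v₁ - v₂‖ ^ 2)

/-- The ternary cross-section `B₃(𝐮, ω) = |𝐮̃|^γ₃ b₃(𝐮/|𝐮̃| · ω, ω₁ · ω₂)`. -/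
def crossSection3 {d : ℕ} (γ₃ : ℝ) (b₃ : ℝ → ℝ → ℝ) (v v₁ v₂ : Vel d) (ω : Sph2 d) : ℝ :=
  relSize3 v v₁ v₂ ^ γ₃ *
    b₃ (inner ℝ ((relSize3 v v₁ v₂)⁻¹ • relVel3 v v₁ v₂) (ω : Vel2 d)) (blockInner ω)

/-- The impulse `(ω₁ · (v₁ - v) + ω₂ · (v₂ - v)) / (1 + ω₁ · ω₂)`. -/
def impulse3 {d : ℕ} (ω : Sph2 d) (v v₁ v₂ : Vel d) : ℝ :=
  (inner ℝ (ω : Vel2 d).fst (v₁ - v) + inner ℝ (ω : Vel2 d).snd (v₂ - v)) / (1 + blockInner ω)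

/-- `v*`. -/
def post3 {d : ℕ} (ω : Sph2 d) (v v₁ v₂ : Vel d) : Vel d :=
  v + impulse3 ω v v₁ v₂ • ((ω : Vel2 d).fst + (ω : Vel2 d).snd)

/-- `v₁*`. -/
def post3₁ {d : ℕ} (ω : Sph2 d) (v v₁ v₂ : Vel d) : Vel d :=
  v₁ - impulse3 ω v v₁ v₂ • (ω : Vel2 d).fst

/-- `v₂*`. -/
def post3₂ {d : ℕ} (ω : Sph2 d) (v v₁ v₂ : Vel d) : Vel d :=
  v₂ - impulse3 ω v v₁ v₂ • (ω : Vel2 d).snd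

/-- The integrand of `G₃(f, g, h)` at `(x, v)`, as a function of `(ω, v₁, v₂)`. -/
def gainIntegrand3 {d : ℕ} (γ₃ : ℝ) (b₃ : ℝ → ℝ → ℝ) (f g h : Phase d → ℝ) (p : Phase d)
    (q : Sph2 d × (Vel d × Vel d)) : ℝ :=
  crossSection3 γ₃ b₃ p.2 q.2.1 q.2.2 q.1 * f (p.1, post3 q.1 p.2 q.2.1 q.2.2) *
    g (p.1, post3₁ q.1 p.2 q.2.1 q.2.2) * h (p.1, post3₂ q.1 p.2 q.2.1 q.2.2)

/-- The integrand of `L₃(f, g, h)` at `(x, v)`, as a function of `(ω, v₁, v₂)`. -/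
def lossIntegrand3 {d : ℕ} (γ₃ : ℝ) (b₃ : ℝ → ℝ → ℝ) (f g h : Phase d → ℝ) (p : Phase d)
    (q : Sph2 d × (Vel d × Vel d)) : ℝ :=
  crossSection3 γ₃ b₃ p.2 q.2.1 q.2.2 q.1 * f (p.1, p.2) * g (p.1, q.2.1) * h (p.1, q.2.2)

/-! ### Gain and loss operators -/

/-- `G(f, g, h) = G₂(f, g) + G₃(f, g, h)`. -/
def gain {d : ℕ} (γ₂ γ₃ : ℝ) (b₂ : ℝ → ℝ) (b₃ : ℝ → ℝ → ℝ) (f g h : Phase d → ℝ)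
    (p : Phase d) : ℝ :=
  (∫ q, gainIntegrand2 γ₂ b₂ f g p q ∂(collMeasure2 d)) +
    ∫ q, gainIntegrand3 γ₃ b₃ f g h p q ∂(collMeasure3 d)

/-- `L(f, g, h) = L₂(f, g) + L₃(f, g, h)`. -/
def loss {d : ℕ} (γ₂ γ₃ : ℝ) (b₂ : ℝ → ℝ) (b₃ : ℝ → ℝ → ℝ) (f g h : Phase d → ℝ)
    (p : Phase d) : ℝ :=
  (∫ q, lossIntegrand2 γ₂ b₂ f g p q ∂(collMeasure2 d)) +
    ∫ q, lossIntegrand3 γ₃ b₃ f g h p q ∂(collMeasure3 d)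

/-- For almost every `(x, v)` the four integrals that define the gain and loss terms of `f` converge
absolutely, so that `gain` and `loss` above are genuine integrals. -/
def CollisionsConverge {d : ℕ} (γ₂ γ₃ : ℝ) (b₂ : ℝ → ℝ) (b₃ : ℝ → ℝ → ℝ) (f : Phase d → ℝ) :
    Prop :=
  ∀ᵐ p : Phase d,
    Integrable (gainIntegrand2 γ₂ b₂ f f p) (collMeasure2 d) ∧
    Integrable (lossIntegrand2 γ₂ b₂ f f p) (collMeasure2 d) ∧
    Integrable (gainIntegrand3 γ₃ b₃ f f f p) (collMeasure3 d) ∧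
    Integrable (lossIntegrand3 γ₃ b₃ f f f p) (collMeasure3 d)

/-! ### Function spaces -/

/-- The interval `[0, T)`, where `T` may be `∞`. -/
def timeInterval (T : EReal) : Set ℝ := {t | 0 ≤ t ∧ (t : EReal) < T}

/-- The Maxwellian `M_{α,β}(x, v) = exp(-α|x|² - β|v|²)`. -/
def maxwellian {d : ℕ} (α β : ℝ) (p : Phase d) : ℝ :=
  Real.exp (-α * ‖p.1‖ ^ 2 - β * ‖p.2‖ ^ 2)

/-- `‖f‖_{M_{α,β}} = ‖f M_{α,β}⁻¹‖_{L^∞}`, with values in `[0, ∞]`. -/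
def maxwellNorm {d : ℕ} (α β : ℝ) (f : Phase d → ℝ) : ℝ≥0∞ :=
  eLpNorm (fun p => f p * (maxwellian α β p)⁻¹) ∞ volume

/-- The set `M_{α,β}^+` of a.e. non-negative measurable functions bounded by a multiple of
`M_{α,β}`. -/
def MemMaxwellPos {d : ℕ} (α β : ℝ) (f : Phase d → ℝ) : Prop :=
  AEMeasurable f volume ∧ 0 ≤ᵐ[volume] f ∧ maxwellNorm α β f < ∞

/-- `|||f|||_∞ = sup_{t ∈ [0,T)} ‖f(t)‖_{M_{α,β}}`, with values in `[0, ∞]`. -/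
def tripleNorm {d : ℕ} (α β : ℝ) (T : EReal) (f : ℝ → Phase d → ℝ) : ℝ≥0∞ :=
  ⨆ t ∈ timeInterval T, maxwellNorm α β (f t)

/-- The set `F_T^+`: at every time of `[0, T)` a measurable, a.e. non-negative function of
`(x, v)`. -/
def MemFPos {d : ℕ} (T : EReal) (f : ℝ → Phase d → ℝ) : Prop :=
  ∀ t ∈ timeInterval T, AEMeasurable (f t) volume ∧ 0 ≤ᵐ[volume] f t

open Classical in
/-- The class in `L¹_{x,v}` of an integrable function (`0` if the function is not integrable). -/
def toL1 {d : ℕ} (f : Phase d → ℝ) : Phase d →₁[volume] ℝ :=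
  if h : Integrable f volume then h.toL1 f else 0

/-- `f ∈ C⁰([0,T), L^{1,+}_{x,v})`. -/
def MemC0L1Pos {d : ℕ} (T : EReal) (f : ℝ → Phase d → ℝ) : Prop :=
  MemFPos T f ∧ (∀ t ∈ timeInterval T, Integrable (f t) volume) ∧
    ContinuousOn (fun t => toL1 (f t)) (timeInterval T)

/-- `f ∈ L^∞([0,T), M_{α,β}^+)`. -/
def MemLinfMaxwellPos {d : ℕ} (α β : ℝ) (T : EReal) (f : ℝ → Phase d → ℝ) : Prop :=
  MemFPos T f ∧ tripleNorm α β T f < ∞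

/-- `f ∈ L^∞([0,T), L^{1,+}_{x,v})`, in the sense of Bochner. -/
def MemLinfL1Pos {d : ℕ} (T : EReal) (f : ℝ → Phase d → ℝ) : Prop :=
  MemFPos T f ∧ (∀ᵐ t ∂(volume.restrict (timeInterval T)), Integrable (f t) volume) ∧
    MemLp (fun t => toL1 (f t)) ∞ (volume.restrict (timeInterval T))

/-- `u : [0,T) → X` is weakly differentiable in time with weak derivative `w`: both are locally
integrable and `∫ φ' u dt = - ∫ φ w dt` for all `φ ∈ C_c^∞((0,T))`. -/
def HasWeakTimeDeriv {X : Type*} [NormedAddCommGroup X] [NormedSpace ℝ X] (T : EReal)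
    (u w : ℝ → X) : Prop :=
  LocallyIntegrableOn u (timeInterval T) volume ∧ LocallyIntegrableOn w (timeInterval T) volume ∧
    ∀ φ : ℝ → ℝ, ContDiff ℝ (⊤ : ℕ∞) φ → HasCompactSupport φ →
      tsupport φ ⊆ {t : ℝ | 0 < t ∧ (t : EReal) < T} →
      ∫ t, deriv φ t • u t = -∫ t, φ t • w t

/-! ### Transport and mild solutions -/

/-- `f^#(t, x, v) = f(t, x + t v, v)`. -/
def sharp {d : ℕ} (f : ℝ → Phase d → ℝ) (t : ℝ) (p : Phase d) : ℝ := f t (p.1 + t • p.2, p.2)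

/-- `G^#(f, f, f)`. -/
def gainSharp {d : ℕ} (γ₂ γ₃ : ℝ) (b₂ : ℝ → ℝ) (b₃ : ℝ → ℝ → ℝ) (f : ℝ → Phase d → ℝ) :
    ℝ → Phase d → ℝ :=
  sharp (fun t => gain γ₂ γ₃ b₂ b₃ (f t) (f t) (f t))

/-- `L^#(f, f, f)`. -/
def lossSharp {d : ℕ} (γ₂ γ₃ : ℝ) (b₂ : ℝ → ℝ) (b₃ : ℝ → ℝ → ℝ) (f : ℝ → Phase d → ℝ) :
    ℝ → Phase d → ℝ :=
  sharp (fun t => loss γ₂ γ₃ b₂ b₃ (f t) (f t) (f t))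

/-- `f` is a mild solution in `[0,T)`, with respect to the Maxwellian `M_{α,β}`, of
`∂ₜf + v · ∇ₓf = Q₂(f,f) + Q₃(f,f,f)`, `f(0) = f₀`. -/
structure IsMildSolution {d : ℕ} (γ₂ γ₃ : ℝ) (b₂ : ℝ → ℝ) (b₃ : ℝ → ℝ → ℝ) (α β : ℝ) (T : EReal)
    (f₀ : Phase d → ℝ) (f : ℝ → Phase d → ℝ) : Prop where
  memFPos : MemFPos T f
  continuous : MemC0L1Pos T (sharp f)
  bounded : MemLinfMaxwellPos α β T (sharp f)
  converge : ∀ t ∈ timeInterval T, CollisionsConverge γ₂ γ₃ b₂ b₃ (f t)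
  loss_mem : MemLinfL1Pos T (lossSharp γ₂ γ₃ b₂ b₃ f)
  gain_mem : MemLinfL1Pos T (gainSharp γ₂ γ₃ b₂ b₃ f)
  equation : HasWeakTimeDeriv T (fun t => toL1 (sharp f t))
    (fun t => toL1 (gainSharp γ₂ γ₃ b₂ b₃ f t) - toL1 (lossSharp γ₂ γ₃ b₂ b₃ f t))
  initial : sharp f 0 =ᵐ[volume] f₀

/-! ### Constants -/

/-- `K_β = C [‖b₂‖ (β^{-d/2} + 1/(d+γ₂-1)) + ‖b₃‖ (β^{-d} + 1/(2d+γ₃-1))]`. -/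
def constK (d : ℕ) (C γ₂ γ₃ : ℝ) (b₂ : ℝ → ℝ) (b₃ : ℝ → ℝ → ℝ) (β : ℝ) : ℝ :=
  C * ((angularNorm2 d b₂).toReal * (β ^ (-(d : ℝ) / 2) + 1 / ((d : ℝ) + γ₂ - 1)) +
    (angularNorm3 d b₃).toReal * (β ^ (-(d : ℝ)) + 1 / (2 * (d : ℝ) + γ₃ - 1)))

/-- `1 + α^{1/4} / (2 √(6K))`. -/
def constFactor (K α : ℝ) : ℝ := 1 + α ^ (1 / 4 : ℝ) / (2 * Real.sqrt (6 * K))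

/-- The smallness threshold `α^{1/2} / (48 K (1 + α^{1/4} / (2 √(6K))))`. -/
def threshold (K α : ℝ) : ℝ := α ^ (1 / 2 : ℝ) / (48 * K * constFactor K α)

/-- The bound `C_out`, as a function of `K`, `α` and `m = ‖f₀‖_{M_{α,β}}`. -/
def constOut (K α m : ℝ) : ℝ :=
  (1 - Real.sqrt (1 - 48 * K * α ^ (-(1 / 2) : ℝ) * constFactor K α * m)) /
    (24 * K * α ^ (-(1 / 2) : ℝ) * constFactor K α)

end BinaryTernaryBoltzmann

end

open BinaryTernaryBoltzmann

/-! Along characteristics the equation becomes the integral equation `F(t) = f₀ + ∫₀ᵗ (G - L)^#`,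
solved by a contraction among paths bounded pointwise by a multiple of the Maxwellian. Everything
rests on one dispersive estimate. Collisions conserve momentum and energy, so a product of freely
transported Maxwellians takes the same value at the outgoing velocities as at the incoming ones
(`movingMaxwellian_mul_eq`, `movingMaxwellian_mul_mul_eq`). Gain and loss therefore share one
majorant, the loss term of the transported Maxwellian. Seen from the characteristic of `v`, this
majorant is `M_{α,β}(x,v)` times an integral of `B exp(-α|x - s u|² - β|v₁|²)`, with an analogous
integral over `ℝ²ᵈ` for triples. The moving point `s u` spends a time of at most `√(π/α)/|u|` near
`x`. Integrating over all times thus turns `|u|^γ` into `|u|^(γ-1)`, whose singularity is integrable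
exactly in the allowed range of exponents. The result, `lintegral_majorant_le`, is a bound `K
α^(-1/2) (1+a) M_{α,β}` over the whole time axis; hence no smallness of `T` is needed. On paths
bounded by `a` Maxwellians the Picard map then has Lipschitz constant `6a K α^(-1/2) (1+a)` in the
weighted sup norm. The number `C_out` is chosen so that the map preserves this set and contracts it
(`constOut_bounds`, `exists_picard_eq`). Positivity is built into the iteration: the operator used
is `G(|f|,|f|,|f|) - L(f,|f|,|f|)`, which is non-negative wherever `f ≤ 0`. A fixed point therefore
cannot become negative (`nonneg_of_picard_eq`), the absolute values disappear, and it solves the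
original equation. For uniqueness, a mild solution is only weakly differentiable in `L¹` and bounded
almost everywhere. A du Bois-Reymond argument (`eq_add_integral_of_hasWeakTimeDeriv`) recovers the
integral equation in `L¹`. The collision operators do not see null sets (`ae_collision_congr`), so
each time slice can be replaced by a representative bounded everywhere. The contraction estimate,
applied repeatedly in the order of `L¹`, makes the difference of two solutions vanish. -/

noncomputable section

namespace BinaryTernaryBoltzmann

/-! ### Gaussian and singular integrals -/

section Gaussian

variable {E : Type*} [NormedAddCommGroup E] [InnerProductSpace ℝ E]

/-- The time a line spends near a point, measured with a Gaussian. -/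
theorem lintegral_exp_neg_mul_norm_sub_smul_sq_le {α : ℝ} (hα : 0 < α) (x : E) {u : E}
    (hu : u ≠ 0) :
    ∫⁻ s : ℝ, ENNReal.ofReal (Real.exp (-α * ‖x - s • u‖ ^ 2)) ≤
      ENNReal.ofReal (Real.sqrt (Real.pi / α) * ‖u‖⁻¹) := by
  have hu' : 0 < ‖u‖ := norm_pos_iff.2 hu
  -- `s₀` is the time of closest approach to `x`. By Cauchy-Schwarz the squared distance is at least
  -- `‖u‖² (s - s₀)²`, which leaves a one-dimensional Gaussian.
  set s₀ : ℝ := inner ℝ x u / ‖u‖ ^ 2 with hs₀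
  have hpt : ∀ s : ℝ, ENNReal.ofReal (Real.exp (-α * ‖x - s • u‖ ^ 2)) ≤
      ENNReal.ofReal (Real.exp (-(α * ‖u‖ ^ 2) * (s - s₀) ^ 2)) := by
    intro s
    apply ENNReal.ofReal_le_ofReal
    apply Real.exp_le_exp.2
    have h1 : ‖x - s • u‖ ^ 2 = ‖x‖ ^ 2 - 2 * (s * inner ℝ x u) + s ^ 2 * ‖u‖ ^ 2 := by
      rw [norm_sub_sq_real, real_inner_smul_right, norm_smul, mul_pow, Real.norm_eq_abs, sq_abs]
    have h2 : inner ℝ x u = s₀ * ‖u‖ ^ 2 := by rw [hs₀]; field_simp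
    have h3 : s₀ ^ 2 * ‖u‖ ^ 2 ≤ ‖x‖ ^ 2 := by
      have := real_inner_mul_inner_self_le x u
      rw [real_inner_self_eq_norm_sq, real_inner_self_eq_norm_sq, h2] at this
      have hp : 0 < ‖u‖ ^ 2 := by positivity
      nlinarith
    have : ‖u‖ ^ 2 * (s - s₀) ^ 2 ≤ ‖x - s • u‖ ^ 2 := by rw [h1, h2]; nlinarith
    nlinarith
  refine (lintegral_mono hpt).trans ?_
  have hb : 0 < α * ‖u‖ ^ 2 := by positivity
  rw [lintegral_sub_right_eq_self
    (fun s : ℝ => ENNReal.ofReal (Real.exp (-(α * ‖u‖ ^ 2) * s ^ 2))) s₀,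
    ← ofReal_integral_eq_lintegral_ofReal (integrable_exp_neg_mul_sq hb)
      (ae_of_all _ fun w => (Real.exp_pos _).le), integral_gaussian]
  apply ENNReal.ofReal_le_ofReal
  rw [← div_div, Real.sqrt_div (by positivity), Real.sqrt_sq hu'.le, div_eq_mul_inv]

/-- The bound `(π/β)^{n/2} + n |B₁| / (n + r)` of `∫ |w - v|^r e^{-β|w|²} dw` on an `n`-dimensional
Euclidean space. -/
def gaussSingularBound (E : Type*) [NormedAddCommGroup E] [InnerProductSpace ℝ E]
    [MeasureSpace E] (β r : ℝ) : ℝ :=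
  (Real.pi / β) ^ ((Module.finrank ℝ E : ℝ) / 2) +
    Module.finrank ℝ E * volume.real (ball (0 : E) 1) / (Module.finrank ℝ E + r)

variable [FiniteDimensional ℝ E] [MeasurableSpace E] [BorelSpace E]

/-- The known value of the integral is positive, whereas the integral of a non-integrable function
is `0` by convention. -/
theorem integrable_exp_neg_mul_norm_sq {β : ℝ} (hβ : 0 < β) :
    Integrable (fun w : E => Real.exp (-β * ‖w‖ ^ 2)) volume := by
  have h := GaussianFourier.integral_rexp_neg_mul_sq_norm (V := E) hβ
  by_contra hn
  rw [integral_undef hn] at h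
  have : (0 : ℝ) < (Real.pi / β) ^ ((Module.finrank ℝ E : ℝ) / 2) := by positivity
  linarith

/-- In polar coordinates this is the integrability of `y^(n-1+r)` on `(0,1)`, that is `n + r > 0`.
-/
theorem integrable_indicator_norm_rpow [Nontrivial E] {r : ℝ}
    (hr : 0 < (Module.finrank ℝ E : ℝ) + r) :
    Integrable (fun w : E => (Iio (1 : ℝ)).indicator (fun y => y ^ r) ‖w‖) volume := by
  rw [integrable_fun_norm_addHaar (μ := (volume : Measure E))
    (f := (Iio (1 : ℝ)).indicator (fun y => y ^ r))]
  have hn : 1 ≤ Module.finrank ℝ E := Module.finrank_pos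
  have : IntegrableOn (fun y : ℝ => y ^ ((Module.finrank ℝ E : ℝ) - 1 + r)) (Ioo 0 1) volume := by
    rw [intervalIntegral.integrableOn_Ioo_rpow_iff one_pos]; linarith
  have h2 : IntegrableOn ((Iio (1 : ℝ)).indicator
      (fun y : ℝ => y ^ ((Module.finrank ℝ E : ℝ) - 1 + r))) (Ioi 0) volume := by
    rw [IntegrableOn, integrable_indicator_iff measurableSet_Iio, IntegrableOn,
      Measure.restrict_restrict measurableSet_Iio, inter_comm, Ioi_inter_Iio]
    exact this
  refine h2.congr_fun (fun y hy => ?_) measurableSet_Ioi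
  have hy' : (0 : ℝ) < y := hy
  by_cases h : y ∈ Iio (1 : ℝ)
  · simp only [indicator_of_mem h, smul_eq_mul]
    rw [← Real.rpow_natCast, ← Real.rpow_add hy', Nat.cast_sub hn, Nat.cast_one]
  · simp [indicator_of_notMem h]

theorem integral_indicator_norm_rpow [Nontrivial E] {r : ℝ}
    (hr : 0 < (Module.finrank ℝ E : ℝ) + r) :
    ∫ w : E, (Iio (1 : ℝ)).indicator (fun y => y ^ r) ‖w‖ =
      Module.finrank ℝ E * volume.real (ball (0 : E) 1) / (Module.finrank ℝ E + r) := by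
  rw [integral_fun_norm_addHaar (μ := (volume : Measure E))
    (f := (Iio (1 : ℝ)).indicator (fun y => y ^ r))]
  have hn : 1 ≤ Module.finrank ℝ E := Module.finrank_pos
  have : ∫ y in Ioi (0 : ℝ), y ^ (Module.finrank ℝ E - 1) •
      (Iio (1 : ℝ)).indicator (fun y => y ^ r) y =
      ∫ y in Ioi (0 : ℝ), (Iio (1 : ℝ)).indicator
        (fun y : ℝ => y ^ ((Module.finrank ℝ E : ℝ) - 1 + r)) y := by
    refine setIntegral_congr_fun measurableSet_Ioi (fun y hy => ?_)
    have hy' : (0 : ℝ) < y := hy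
    by_cases h : y ∈ Iio (1 : ℝ)
    · simp only [indicator_of_mem h, smul_eq_mul]
      rw [← Real.rpow_natCast, ← Real.rpow_add hy', Nat.cast_sub hn, Nat.cast_one]
    · simp [indicator_of_notMem h]
  rw [this, setIntegral_indicator measurableSet_Iio, Ioi_inter_Iio, ← integral_Ioc_eq_integral_Ioo,
    ← intervalIntegral.integral_of_le zero_le_one, integral_rpow (Or.inl (by linarith))]
  have : (Module.finrank ℝ E : ℝ) - 1 + r + 1 = Module.finrank ℝ E + r := by ring
  rw [this, Real.one_rpow, Real.zero_rpow hr.ne']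
  simp only [sub_zero, smul_eq_mul, nsmul_eq_mul]
  ring

/-- `∫ |w - v|^r e^{-β|w|²} dw ≤ (π/β)^{n/2} + n |B₁| / (n + r)` for `-n < r ≤ 0`. -/
theorem lintegral_norm_rpow_mul_gaussian_le [Nontrivial E] {β r : ℝ} (hβ : 0 < β) (hr0 : r ≤ 0)
    (hr : 0 < (Module.finrank ℝ E : ℝ) + r) (v : E) :
    ∫⁻ w : E, ENNReal.ofReal (‖w - v‖ ^ r * Real.exp (-β * ‖w‖ ^ 2)) ≤
      ENNReal.ofReal (gaussSingularBound E β r) := by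
  -- Outside the unit ball around `v` the power is at most `1` because `r ≤ 0`; inside it the
  -- Gaussian is at most `1`. The bound is thus uniform in `v`.
  have hpt : ∀ w : E, ENNReal.ofReal (‖w - v‖ ^ r * Real.exp (-β * ‖w‖ ^ 2)) ≤
      ENNReal.ofReal (Real.exp (-β * ‖w‖ ^ 2)) +
        ENNReal.ofReal ((Iio (1 : ℝ)).indicator (fun y => y ^ r) ‖w - v‖) := by
    intro w
    have he1 : Real.exp (-β * ‖w‖ ^ 2) ≤ 1 := by
      rw [Real.exp_le_one_iff]; nlinarith [sq_nonneg ‖w‖]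
    have he0 := (Real.exp_pos (-β * ‖w‖ ^ 2)).le
    have hn : 0 ≤ ‖w - v‖ ^ r := by positivity
    by_cases h : ‖w - v‖ ∈ Iio (1 : ℝ)
    · rw [indicator_of_mem h, ← ENNReal.ofReal_add he0 hn]
      apply ENNReal.ofReal_le_ofReal
      nlinarith
    · rw [indicator_of_notMem h, ENNReal.ofReal_zero, add_zero]
      apply ENNReal.ofReal_le_ofReal
      have : ‖w - v‖ ^ r ≤ 1 :=
        Real.rpow_le_one_of_one_le_of_nonpos (by simpa using h) hr0
      nlinarith
  refine (lintegral_mono hpt).trans ?_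
  rw [lintegral_add_left (by fun_prop)]
  rw [lintegral_sub_right_eq_self
    (fun w : E => ENNReal.ofReal ((Iio (1 : ℝ)).indicator (fun y => y ^ r) ‖w‖)) v]
  rw [← ofReal_integral_eq_lintegral_ofReal (integrable_exp_neg_mul_norm_sq hβ)
      (ae_of_all _ fun w => (Real.exp_pos _).le),
    ← ofReal_integral_eq_lintegral_ofReal (integrable_indicator_norm_rpow hr)
      (ae_of_all _ fun w => indicator_apply_nonneg fun _ => by positivity),
    GaussianFourier.integral_rexp_neg_mul_sq_norm hβ, integral_indicator_norm_rpow hr,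
    ← ENNReal.ofReal_add (by positivity) (by positivity)]
  exact le_rfl

end Gaussian

/-! ### Collision integrals for an abstract kernel, serving both the binary and the ternary case -/

section Collision

variable {E : Type*} [NormedAddCommGroup E] [InnerProductSpace ℝ E]
  [FiniteDimensional ℝ E] [MeasurableSpace E] [BorelSpace E] [Nontrivial E]
  {Ω : Type*} [MeasurableSpace Ω] {σ : Measure Ω} [SFinite σ]

/-- The angle is integrated first. Zero relative velocity may be ignored, since a point is a null
set in a non-trivial space. -/
theorem lintegral_collision_le {B : E → Ω → ℝ≥0∞} (hB : Measurable (Function.uncurry B))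
    {N : ℝ≥0∞} {φ : E → ℝ} (hN : ∀ u : E, u ≠ 0 → ∫⁻ ω, B u ω ∂σ ≤ N * ENNReal.ofReal (φ u))
    {k : E → ℝ≥0∞} (hk : Measurable k) (v : E) :
    ∫⁻ q : Ω × E, B (q.2 - v) q.1 * k q.2 ∂(σ.prod volume) ≤
      ∫⁻ w : E, N * ENNReal.ofReal (φ (w - v)) * k w := by
  have hB' : Measurable (fun q : Ω × E => B (q.2 - v) q.1) :=
    hB.comp (f := fun q : Ω × E => (q.2 - v, q.1)) (by fun_prop)
  have hBk : Measurable (fun q : Ω × E => B (q.2 - v) q.1 * k q.2) :=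
    hB'.mul (hk.comp measurable_snd)
  rw [lintegral_prod_symm _ hBk.aemeasurable]
  refine lintegral_mono_ae ?_
  have hne : ∀ᵐ w : E, w ≠ v := by
    simp [ae_iff]
  filter_upwards [hne] with w hw
  have hm : Measurable (fun ω => B (w - v) ω) := hB.of_uncurry_left
  rw [lintegral_mul_const _ hm]
  gcongr
  exact hN _ (sub_ne_zero.2 hw)

/-- Time-integrated bound of a collision integral between two Maxwellians. -/
theorem lintegral_lintegral_collision_le {B : E → Ω → ℝ≥0∞}
    (hB : Measurable (Function.uncurry B)) {N : ℝ≥0∞} (hNtop : N ≠ ∞) {c r : ℝ} (hc : 0 ≤ c)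
    (hN : ∀ u : E, u ≠ 0 → ∫⁻ ω, B u ω ∂σ ≤ N * ENNReal.ofReal (c * (‖u‖ ^ r * ‖u‖)))
    {α β : ℝ} (hα : 0 < α) (hβ : 0 < β) (hr0 : r ≤ 0)
    (hr : 0 < (Module.finrank ℝ E : ℝ) + r) (x v : E) :
    ∫⁻ s : ℝ, ∫⁻ q : Ω × E, B (q.2 - v) q.1 *
        ENNReal.ofReal (Real.exp (-α * ‖x - s • (q.2 - v)‖ ^ 2 - β * ‖q.2‖ ^ 2))
          ∂(σ.prod volume) ≤
      N * ENNReal.ofReal (c * Real.sqrt (Real.pi / α) * gaussSingularBound E β r) := by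
  have hB' : Measurable (fun z : ℝ × (Ω × E) => B (z.2.2 - v) z.2.1) :=
    hB.comp (f := fun z : ℝ × (Ω × E) => (z.2.2 - v, z.2.1)) (by fun_prop)
  -- Time is integrated before the velocity, so that the dwell time along each line appears.
  rw [lintegral_lintegral_swap (hB'.mul (by fun_prop)).aemeasurable]
  have hBq : ∀ q : Ω × E, ∫⁻ s : ℝ, B (q.2 - v) q.1 *
      ENNReal.ofReal (Real.exp (-α * ‖x - s • (q.2 - v)‖ ^ 2 - β * ‖q.2‖ ^ 2)) =
      B (q.2 - v) q.1 * ∫⁻ s : ℝ,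
      ENNReal.ofReal (Real.exp (-α * ‖x - s • (q.2 - v)‖ ^ 2 - β * ‖q.2‖ ^ 2)) :=
    fun q => lintegral_const_mul _ (by fun_prop)
  simp_rw [hBq]
  refine (lintegral_collision_le hB hN (k := fun w => ∫⁻ s : ℝ,
      ENNReal.ofReal (Real.exp (-α * ‖x - s • (w - v)‖ ^ 2 - β * ‖w‖ ^ 2)))
      (Measurable.lintegral_prod_right' (f := fun z : E × ℝ =>
        ENNReal.ofReal (Real.exp (-α * ‖x - z.2 • (z.1 - v)‖ ^ 2 - β * ‖z.1‖ ^ 2)))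
        (by fun_prop)) v).trans ?_
  have hne : ∀ᵐ w : E, w ≠ v := by
    simp [ae_iff]
  have hpt : ∀ᵐ w : E, N * ENNReal.ofReal (c * (‖w - v‖ ^ r * ‖w - v‖)) * ∫⁻ s : ℝ,
      ENNReal.ofReal (Real.exp (-α * ‖x - s • (w - v)‖ ^ 2 - β * ‖w‖ ^ 2)) ≤
      N * ENNReal.ofReal (c * Real.sqrt (Real.pi / α)) *
        ENNReal.ofReal (‖w - v‖ ^ r * Real.exp (-β * ‖w‖ ^ 2)) := by
    filter_upwards [hne] with w hw
    have hu : w - v ≠ 0 := sub_ne_zero.2 hw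
    have hu' : 0 < ‖w - v‖ := norm_pos_iff.2 hu
    have h1 : ∀ s : ℝ,
        ENNReal.ofReal (Real.exp (-α * ‖x - s • (w - v)‖ ^ 2 - β * ‖w‖ ^ 2)) =
        ENNReal.ofReal (Real.exp (-α * ‖x - s • (w - v)‖ ^ 2)) *
          ENNReal.ofReal (Real.exp (-β * ‖w‖ ^ 2)) := fun s => by
      rw [← ENNReal.ofReal_mul (Real.exp_pos _).le, ← Real.exp_add]; congr 2; ring
    simp_rw [h1]
    rw [lintegral_mul_const _ (by fun_prop), mul_assoc, mul_assoc]
    gcongr N * ?_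
    -- The separate factor `‖w - v‖` in `hN` is there to cancel the dwell time `‖w - v‖⁻¹`.
    calc _ ≤ ENNReal.ofReal (c * (‖w - v‖ ^ r * ‖w - v‖)) *
          (ENNReal.ofReal (Real.sqrt (Real.pi / α) * ‖w - v‖⁻¹) *
            ENNReal.ofReal (Real.exp (-β * ‖w‖ ^ 2))) := by
          gcongr
          exact lintegral_exp_neg_mul_norm_sub_smul_sq_le hα x hu
      _ = _ := by
          rw [← ENNReal.ofReal_mul (by positivity), ← ENNReal.ofReal_mul (by positivity),
            ← ENNReal.ofReal_mul (by positivity)]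
          congr 1
          field_simp
  refine (lintegral_mono_ae hpt).trans ?_
  rw [lintegral_const_mul' _ _ (ENNReal.mul_ne_top hNtop ENNReal.ofReal_ne_top), mul_assoc]
  gcongr N * ?_
  rw [ENNReal.ofReal_mul (by positivity : 0 ≤ c * Real.sqrt (Real.pi / α))]
  gcongr
  exact lintegral_norm_rpow_mul_gaussian_le hβ hr0 hr v

/-- Bound of a collision integral between two Maxwellians at a fixed time. -/
theorem lintegral_collision_gaussian_le {B : E → Ω → ℝ≥0∞}
    (hB : Measurable (Function.uncurry B)) {N : ℝ≥0∞} (hNtop : N ≠ ∞) {c r : ℝ} (hc : 0 ≤ c)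
    (hN : ∀ u : E, u ≠ 0 → ∫⁻ ω, B u ω ∂σ ≤ N * ENNReal.ofReal (c * (‖u‖ ^ r * ‖u‖)))
    {α β : ℝ} (hα : 0 < α) (hβ : 0 < β) (hr0 : r ≤ 0)
    (hr : 0 < (Module.finrank ℝ E : ℝ) + r) (s : ℝ) (x v : E) :
    ∫⁻ q : Ω × E, B (q.2 - v) q.1 *
        ENNReal.ofReal (Real.exp (-α * ‖x - s • (q.2 - v)‖ ^ 2 - β * ‖q.2‖ ^ 2))
          ∂(σ.prod volume) ≤
      N * ENNReal.ofReal (c * (1 + 1 / β) * (1 + ‖v‖) * gaussSingularBound E (β / 2) r) := by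
  refine (lintegral_collision_le hB hN (k := fun w =>
      ENNReal.ofReal (Real.exp (-α * ‖x - s • (w - v)‖ ^ 2 - β * ‖w‖ ^ 2)))
        (by fun_prop) v).trans ?_
  have hpt : ∀ w : E, N * ENNReal.ofReal (c * (‖w - v‖ ^ r * ‖w - v‖)) *
      ENNReal.ofReal (Real.exp (-α * ‖x - s • (w - v)‖ ^ 2 - β * ‖w‖ ^ 2)) ≤
      N * ENNReal.ofReal (c * (1 + 1 / β) * (1 + ‖v‖)) *
        ENNReal.ofReal (‖w - v‖ ^ r * Real.exp (-(β / 2) * ‖w‖ ^ 2)) := by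
    intro w
    rw [mul_assoc, mul_assoc]
    gcongr N * ?_
    rw [← ENNReal.ofReal_mul (by positivity), ← ENNReal.ofReal_mul (by positivity)]
    apply ENNReal.ofReal_le_ofReal
    -- At a fixed time the spatial Gaussian is discarded. One half of the velocity Gaussian absorbs
    -- the factor `‖w - v‖`, the other half is left for the singular integral.
    have h1 : Real.exp (-α * ‖x - s • (w - v)‖ ^ 2 - β * ‖w‖ ^ 2) ≤
        Real.exp (-(β / 2) * ‖w‖ ^ 2) * Real.exp (-(β / 2) * ‖w‖ ^ 2) := by
      rw [← Real.exp_add]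
      apply Real.exp_le_exp.2
      nlinarith [mul_nonneg hα.le (sq_nonneg ‖x - s • (w - v)‖)]
    set e := Real.exp (-(β / 2) * ‖w‖ ^ 2) with he
    have he0 : 0 < e := Real.exp_pos _
    have he1 : e ≤ 1 := by rw [he, Real.exp_le_one_iff]; nlinarith [sq_nonneg ‖w‖]
    have he2 : ‖w‖ * e ≤ 1 + 1 / β := by
      have h3 : (1 + β / 2 * ‖w‖ ^ 2) * e ≤ 1 := by
        have h4 : 1 + β / 2 * ‖w‖ ^ 2 ≤ e⁻¹ := by
          rw [he, ← Real.exp_neg]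
          have := Real.add_one_le_exp (-(-(β / 2) * ‖w‖ ^ 2))
          linarith
        calc _ ≤ e⁻¹ * e := by gcongr
          _ = 1 := inv_mul_cancel₀ he0.ne'
      have h5 : ‖w‖ ≤ (1 + 1 / β) * (1 + β / 2 * ‖w‖ ^ 2) := by
        have : (1 + 1 / β) * (1 + β / 2 * ‖w‖ ^ 2) =
            1 + 1 / β + β / 2 * ‖w‖ ^ 2 + ‖w‖ ^ 2 / 2 := by field_simp; ring
        rw [this]
        have : 0 ≤ 1 / β + β / 2 * ‖w‖ ^ 2 := by positivity
        nlinarith [sq_nonneg (‖w‖ - 1)]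
      calc ‖w‖ * e ≤ (1 + 1 / β) * (1 + β / 2 * ‖w‖ ^ 2) * e := by gcongr
        _ = (1 + 1 / β) * ((1 + β / 2 * ‖w‖ ^ 2) * e) := by ring
        _ ≤ (1 + 1 / β) * 1 := by gcongr
        _ = _ := mul_one _
    have hb : 0 < 1 / β := by positivity
    have h6 : ‖w - v‖ * e ≤ (1 + 1 / β) * (1 + ‖v‖) := by
      calc ‖w - v‖ * e ≤ (‖w‖ + ‖v‖) * e := by gcongr; exact norm_sub_le _ _
        _ ≤ _ := by nlinarith [norm_nonneg v, norm_nonneg w]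
    calc _ ≤ c * (‖w - v‖ ^ r * ‖w - v‖) * (e * e) := by gcongr
      _ = c * ‖w - v‖ ^ r * e * (‖w - v‖ * e) := by ring
      _ ≤ c * ‖w - v‖ ^ r * e * ((1 + 1 / β) * (1 + ‖v‖)) := by gcongr
      _ = _ := by ring
  refine (lintegral_mono hpt).trans ?_
  rw [lintegral_const_mul' _ _ (ENNReal.mul_ne_top hNtop ENNReal.ofReal_ne_top), mul_assoc]
  gcongr N * ?_
  rw [ENNReal.ofReal_mul (by positivity : 0 ≤ c * (1 + 1 / β) * (1 + ‖v‖))]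
  gcongr
  exact lintegral_norm_rpow_mul_gaussian_le (by positivity) hr0 hr v

end Collision

/-! ### Cross-sections -/

section CrossSection

variable {d : ℕ} {γ₂ γ₃ : ℝ} {b₂ : ℝ → ℝ} {b₃ : ℝ → ℝ → ℝ}

instance : SFinite (sphMeasure d) := by unfold sphMeasure; infer_instance
instance : SFinite (sph2Measure d) := by unfold sph2Measure; infer_instance
instance : SFinite (collMeasure2 d) := by unfold collMeasure2; infer_instance
instance : SFinite (collMeasure3 d) := by unfold collMeasure3; infer_instance

/-- Nothing is assumed of `b₂` outside `[-1,1]`, so sign and measurability of the cross-section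
depend on this. It also covers `u = 0`, where the normalised vector is `0`. -/
theorem inner_normalized_mem_Icc (u : Vel d) (ω : Sph d) :
    inner ℝ (‖u‖⁻¹ • u) (ω : Vel d) ∈ Icc (-1 : ℝ) 1 := by
  have hω : ‖(ω : Vel d)‖ = 1 := by simp
  have hu : ‖(‖u‖⁻¹ • u)‖ ≤ 1 := by
    rw [norm_smul, norm_inv, norm_norm]
    exact inv_mul_le_one
  rw [mem_Icc, ← abs_le]
  refine (abs_real_inner_le_norm _ _).trans ?_
  rw [hω, mul_one]
  exact hu

theorem measurable_crossSection2 (hb : IsBinaryAngular d b₂) (γ : ℝ) :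
    Measurable (fun z : Vel d × Sph d => crossSection2 γ b₂ z.1 z.2) := by
  have h : Measurable (fun z : Vel d × Sph d =>
      (⟨inner ℝ (‖z.1‖⁻¹ • z.1) (z.2 : Vel d), inner_normalized_mem_Icc z.1 z.2⟩ :
        Icc (-1 : ℝ) 1)) := by
    apply Measurable.subtype_mk
    fun_prop
  unfold crossSection2
  exact (by fun_prop : Measurable fun z : Vel d × Sph d => ‖z.1‖ ^ γ).mul (hb.measurable.comp h)

theorem crossSection2_nonneg (hb : IsBinaryAngular d b₂) (γ : ℝ) (u : Vel d) (ω : Sph d) :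
    0 ≤ crossSection2 γ b₂ u ω :=
  mul_nonneg (by positivity) (hb.nonneg _ (inner_normalized_mem_Icc u ω))

/-- The power is written as `‖u‖^(γ-1) * ‖u‖`, and with the factor `1`, to fit the hypothesis `hN`
of the abstract estimates. -/
theorem lintegral_crossSection2_le (γ : ℝ) {u : Vel d} (hu : u ≠ 0) :
    ∫⁻ ω, ENNReal.ofReal (crossSection2 γ b₂ u ω) ∂(sphMeasure d) ≤
      angularNorm2 d b₂ * ENNReal.ofReal (1 * (‖u‖ ^ (γ - 1) * ‖u‖)) := by
  have hu' : 0 < ‖u‖ := norm_pos_iff.2 hu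
  have h1 : ‖u‖ ^ (γ - 1) * ‖u‖ = ‖u‖ ^ γ := by
    rw [← Real.rpow_add_one hu'.ne']; ring_nf
  have h2 : ∀ ω : Sph d, ENNReal.ofReal (crossSection2 γ b₂ u ω) =
      ENNReal.ofReal (‖u‖ ^ γ) *
        ENNReal.ofReal (b₂ (inner ℝ (‖u‖⁻¹ • u) (ω : Vel d))) := fun ω =>
    ENNReal.ofReal_mul (by positivity)
  simp_rw [h2]
  rw [lintegral_const_mul' _ _ ENNReal.ofReal_ne_top, one_mul, h1, mul_comm]
  gcongr
  have hν : ‖u‖⁻¹ • u ∈ sphere (0 : Vel d) 1 := by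
    simp [norm_smul, hu'.ne']
  exact le_iSup (fun ν : Sph d => ∫⁻ ω : Sph d,
    ENNReal.ofReal (b₂ (inner ℝ (ν : Vel d) (ω : Vel d))) ∂(sphMeasure d)) ⟨_, hν⟩

/-- From `2|ω₁||ω₂| ≤ |ω₁|² + |ω₂|² = 1`. Besides placing the argument in the domain of `b₃`, this
keeps the denominator `1 + ω₁·ω₂` of the impulse away from zero. -/
theorem blockInner_mem_Icc (ω : Sph2 d) : blockInner ω ∈ Icc (-(1 / 2) : ℝ) (1 / 2) := by
  have hω : ‖(ω : Vel2 d)‖ = 1 := by simp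
  have h1 : ‖(ω : Vel2 d).fst‖ ^ 2 + ‖(ω : Vel2 d).snd‖ ^ 2 = 1 := by
    rw [← WithLp.prod_norm_sq_eq_of_L2, hω, one_pow]
  have h2 := abs_real_inner_le_norm (ω : Vel2 d).fst (ω : Vel2 d).snd
  unfold blockInner
  rw [mem_Icc, ← abs_le]
  nlinarith [sq_nonneg (‖(ω : Vel2 d).fst‖ - ‖(ω : Vel2 d).snd‖)]

theorem relSize3_nonneg (v v₁ v₂ : Vel d) : 0 ≤ relSize3 v v₁ v₂ := Real.sqrt_nonneg _

theorem sq_relSize3 (v v₁ v₂ : Vel d) : relSize3 v v₁ v₂ ^ 2 =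
    ‖(relVel3 v v₁ v₂).fst‖ ^ 2 + ‖(relVel3 v v₁ v₂).snd‖ ^ 2 +
      ‖(relVel3 v v₁ v₂).fst - (relVel3 v v₁ v₂).snd‖ ^ 2 := by
  unfold relSize3 relVel3
  rw [Real.sq_sqrt (by positivity)]
  simp [norm_sub_rev]

theorem norm_relVel3_le (v v₁ v₂ : Vel d) : ‖relVel3 v v₁ v₂‖ ≤ relSize3 v v₁ v₂ := by
  apply le_of_sq_le_sq _ (relSize3_nonneg _ _ _)
  rw [sq_relSize3, WithLp.prod_norm_sq_eq_of_L2]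
  nlinarith [sq_nonneg ‖(relVel3 v v₁ v₂).fst - (relVel3 v v₁ v₂).snd‖]

/-- By the parallelogram law `|u₁ - u₂|² ≤ 2|u₁|² + 2|u₂|²`. -/
theorem relSize3_le (v v₁ v₂ : Vel d) :
    relSize3 v v₁ v₂ ≤ Real.sqrt 3 * ‖relVel3 v v₁ v₂‖ := by
  apply le_of_sq_le_sq _ (by positivity)
  rw [sq_relSize3, mul_pow, Real.sq_sqrt (by norm_num), WithLp.prod_norm_sq_eq_of_L2]
  have := parallelogram_law_with_norm ℝ (relVel3 v v₁ v₂).fst (relVel3 v v₁ v₂).snd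
  nlinarith [mul_self_nonneg ‖(relVel3 v v₁ v₂).fst + (relVel3 v v₁ v₂).snd‖]

theorem inner_normalized3_mem_Icc (v v₁ v₂ : Vel d) (ω : Sph2 d) :
    inner ℝ ((relSize3 v v₁ v₂)⁻¹ • relVel3 v v₁ v₂) (ω : Vel2 d) ∈ Icc (-1 : ℝ) 1 := by
  have hω : ‖(ω : Vel2 d)‖ = 1 := by simp
  have hu : ‖(relSize3 v v₁ v₂)⁻¹ • relVel3 v v₁ v₂‖ ≤ 1 := by
    rw [norm_smul, norm_inv, Real.norm_of_nonneg (relSize3_nonneg _ _ _), inv_mul_eq_div]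
    exact div_le_one_of_le₀ (norm_relVel3_le _ _ _) (relSize3_nonneg _ _ _)
  rw [mem_Icc, ← abs_le]
  refine (abs_real_inner_le_norm _ _).trans ?_
  rw [hω, mul_one]
  exact hu

@[fun_prop]
theorem measurable_withLp_fst : Measurable (fun z : Vel2 d => z.fst) :=
  (WithLp.continuous_fst 2 _ _).measurable

@[fun_prop]
theorem measurable_withLp_snd : Measurable (fun z : Vel2 d => z.snd) :=
  (WithLp.continuous_snd 2 _ _).measurable

@[fun_prop]
theorem measurable_toLp : Measurable (fun z : Vel d × Vel d => (WithLp.toLp 2 z : Vel2 d)) :=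
  (WithLp.prod_continuous_toLp 2 _ _).measurable

@[fun_prop]
theorem measurable_blockInner : Measurable (blockInner : Sph2 d → ℝ) := by
  unfold blockInner
  fun_prop

@[fun_prop]
theorem measurable_relSize3 :
    Measurable (fun z : Vel d × Vel d × Vel d => relSize3 z.1 z.2.1 z.2.2) := by
  unfold relSize3
  fun_prop

@[fun_prop]
theorem measurable_relVel3 :
    Measurable (fun z : Vel d × Vel d × Vel d => relVel3 z.1 z.2.1 z.2.2) := by
  unfold relVel3
  exact measurable_toLp.comp (by fun_prop)

theorem measurable_crossSection3 (hb : IsTernaryAngular d b₃) (γ : ℝ) :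
    Measurable (fun z : (Vel d × Vel d × Vel d) × Sph2 d =>
      crossSection3 γ b₃ z.1.1 z.1.2.1 z.1.2.2 z.2) := by
  have hS : Measurable (fun z : (Vel d × Vel d × Vel d) × Sph2 d =>
      relSize3 z.1.1 z.1.2.1 z.1.2.2) := measurable_relSize3.comp measurable_fst
  have hV : Measurable (fun z : (Vel d × Vel d × Vel d) × Sph2 d =>
      relVel3 z.1.1 z.1.2.1 z.1.2.2) := measurable_relVel3.comp measurable_fst
  have h : Measurable (fun z : (Vel d × Vel d × Vel d) × Sph2 d =>
      ((⟨_, inner_normalized3_mem_Icc z.1.1 z.1.2.1 z.1.2.2 z.2⟩, ⟨_, blockInner_mem_Icc z.2⟩) :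
        Icc (-1 : ℝ) 1 × Icc (-(1 / 2) : ℝ) (1 / 2))) := by
    apply Measurable.prodMk
    · apply Measurable.subtype_mk
      fun_prop
    · apply Measurable.subtype_mk
      fun_prop
  unfold crossSection3
  exact (hS.pow_const γ).mul (hb.measurable.comp h)

theorem crossSection3_nonneg (hb : IsTernaryAngular d b₃) (γ : ℝ) (v v₁ v₂ : Vel d)
    (ω : Sph2 d) : 0 ≤ crossSection3 γ b₃ v v₁ v₂ ω :=
  mul_nonneg (Real.rpow_nonneg (relSize3_nonneg _ _ _) _)
    (hb.nonneg _ (inner_normalized3_mem_Icc v v₁ v₂ ω) _ (blockInner_mem_Icc ω))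

/-- The vector `𝐮/|𝐮̃|` lies on the ellipsoid, so the supremum defining the angular norm applies. To
replace `|𝐮̃|` by `|𝐮|`, the power is split: `γ - 1 ≤ 0` makes `|𝐮̃|^(γ-1) ≤ |𝐮|^(γ-1)`, and the
remaining factor costs `√3`. -/
theorem lintegral_crossSection3_le {γ : ℝ} (hγ : γ ≤ 1) {v v₁ v₂ : Vel d}
    (hu : relVel3 v v₁ v₂ ≠ 0) :
    ∫⁻ ω, ENNReal.ofReal (crossSection3 γ b₃ v v₁ v₂ ω) ∂(sph2Measure d) ≤
      angularNorm3 d b₃ * ENNReal.ofReal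
        (Real.sqrt 3 * (‖relVel3 v v₁ v₂‖ ^ (γ - 1) * ‖relVel3 v v₁ v₂‖)) := by
  have hu' : 0 < ‖relVel3 v v₁ v₂‖ := norm_pos_iff.2 hu
  have hle := norm_relVel3_le v v₁ v₂
  have hR : 0 < relSize3 v v₁ v₂ := hu'.trans_le hle
  have h1 : relSize3 v v₁ v₂ ^ γ ≤
      Real.sqrt 3 * (‖relVel3 v v₁ v₂‖ ^ (γ - 1) * ‖relVel3 v v₁ v₂‖) := by
    calc relSize3 v v₁ v₂ ^ γ = relSize3 v v₁ v₂ ^ (γ - 1) * relSize3 v v₁ v₂ := by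
          rw [← Real.rpow_add_one hR.ne']; ring_nf
      _ ≤ ‖relVel3 v v₁ v₂‖ ^ (γ - 1) * (Real.sqrt 3 * ‖relVel3 v v₁ v₂‖) := by
          refine mul_le_mul (Real.rpow_le_rpow_of_nonpos hu' hle (by linarith))
            (relSize3_le v v₁ v₂) (relSize3_nonneg _ _ _) (by positivity)
      _ = _ := by ring
  have h2 : ∀ ω : Sph2 d, ENNReal.ofReal (crossSection3 γ b₃ v v₁ v₂ ω) =
      ENNReal.ofReal (relSize3 v v₁ v₂ ^ γ) * ENNReal.ofReal
        (b₃ (inner ℝ ((relSize3 v v₁ v₂)⁻¹ • relVel3 v v₁ v₂) (ω : Vel2 d)) (blockInner ω)) :=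
    fun ω => ENNReal.ofReal_mul (by positivity)
  simp_rw [h2]
  rw [lintegral_const_mul' _ _ ENNReal.ofReal_ne_top, mul_comm]
  gcongr
  have hν : (relSize3 v v₁ v₂)⁻¹ • relVel3 v v₁ v₂ ∈ ellipsoid d := by
    have hsq := sq_relSize3 v v₁ v₂
    simp only [ellipsoid, mem_ofPred_eq, WithLp.smul_fst, WithLp.smul_snd, ← smul_sub, norm_smul,
      norm_inv, Real.norm_of_nonneg hR.le, mul_pow, ← mul_add]
    rw [← hsq]
    field_simp
  exact le_iSup₂ (f := fun ν (_ : ν ∈ ellipsoid d) => ∫⁻ ω : Sph2 d,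
    ENNReal.ofReal (b₃ (inner ℝ ν (ω : Vel2 d)) (blockInner ω)) ∂(sph2Measure d)) _ hν

theorem relVel3_zero_sub (v v₁ v₂ : Vel d) : relVel3 0 (v₁ - v) (v₂ - v) = relVel3 v v₁ v₂ := by
  simp [relVel3]

theorem relSize3_zero_sub (v v₁ v₂ : Vel d) :
    relSize3 0 (v₁ - v) (v₂ - v) = relSize3 v v₁ v₂ := by
  simp [relSize3]

/-- Dependence on relative velocities alone makes the ternary cross-section a kernel on `Vel2 d`, as
the abstract estimates require. -/
theorem crossSection3_zero_sub (γ : ℝ) (v v₁ v₂ : Vel d) (ω : Sph2 d) :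
    crossSection3 γ b₃ 0 (v₁ - v) (v₂ - v) ω = crossSection3 γ b₃ v v₁ v₂ ω := by
  simp only [crossSection3, relVel3_zero_sub, relSize3_zero_sub]

end CrossSection

/-! ### Collision integrals of transported Maxwellians -/

section Majorant

variable {d : ℕ} {γ₂ γ₃ : ℝ} {b₂ : ℝ → ℝ} {b₃ : ℝ → ℝ → ℝ} {α β : ℝ}

/-- The Maxwellian `M_{α,β}` transported freely for a time `s`. -/
def movingMaxwellian {d : ℕ} (α β s : ℝ) (q : Phase d) : ℝ :=
  maxwellian α β (q.1 - s • q.2, q.2)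

theorem maxwellian_pos (α β : ℝ) (p : Phase d) : 0 < maxwellian α β p := Real.exp_pos _

theorem movingMaxwellian_pos (α β s : ℝ) (q : Phase d) : 0 < movingMaxwellian α β s q :=
  maxwellian_pos _ _ _

theorem movingMaxwellian_shift (α β s : ℝ) (p : Phase d) :
    movingMaxwellian α β s (p.1 + s • p.2, p.2) = maxwellian α β p := by
  simp [movingMaxwellian]

@[fun_prop]
theorem measurable_maxwellian : Measurable (maxwellian α β : Phase d → ℝ) := by
  unfold maxwellian
  fun_prop

theorem measurable_movingMaxwellian :
    Measurable (fun z : ℝ × Phase d => movingMaxwellian α β z.1 z.2) := by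
  unfold movingMaxwellian
  exact measurable_maxwellian.comp (by fun_prop)

theorem integrable_maxwellian (hα : 0 < α) (hβ : 0 < β) :
    Integrable (maxwellian α β : Phase d → ℝ) volume := by
  have h := (integrable_exp_neg_mul_norm_sq (E := Vel d) hα).mul_prod
    (integrable_exp_neg_mul_norm_sq (E := Vel d) hβ)
  refine h.congr (ae_of_all _ fun p => ?_)
  simp only [maxwellian]
  rw [← Real.exp_add]
  ring_nf

/-- The binary collision integral of the transported Maxwellian, along characteristics. -/
def majorant2 {d : ℕ} (γ₂ : ℝ) (b₂ : ℝ → ℝ) (α β s : ℝ) (p : Phase d) : ℝ :=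
  ∫ q, lossIntegrand2 γ₂ b₂ (movingMaxwellian α β s) (movingMaxwellian α β s)
    (p.1 + s • p.2, p.2) q ∂(collMeasure2 d)

/-- The ternary collision integral of the transported Maxwellian, along characteristics. -/
def majorant3 {d : ℕ} (γ₃ : ℝ) (b₃ : ℝ → ℝ → ℝ) (α β s : ℝ) (p : Phase d) : ℝ :=
  ∫ q, lossIntegrand3 γ₃ b₃ (movingMaxwellian α β s) (movingMaxwellian α β s)
    (movingMaxwellian α β s) (p.1 + s • p.2, p.2) q ∂(collMeasure3 d)

/-- On the characteristic of `v` its own Maxwellian stays constant and factors out, while the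
partner is seen at `x - s (v₁ - v)`. -/
theorem lossIntegrand2_movingMaxwellian (γ : ℝ) (b : ℝ → ℝ) (s : ℝ) (p : Phase d)
    (q : Sph d × Vel d) :
    lossIntegrand2 γ b (movingMaxwellian α β s) (movingMaxwellian α β s)
      (p.1 + s • p.2, p.2) q =
    maxwellian α β p * (crossSection2 γ b (q.2 - p.2) q.1 *
      Real.exp (-α * ‖p.1 - s • (q.2 - p.2)‖ ^ 2 - β * ‖q.2‖ ^ 2)) := by
  have : p.1 + s • p.2 - s • q.2 = p.1 - s • (q.2 - p.2) := by rw [smul_sub]; abel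
  simp only [lossIntegrand2, movingMaxwellian_shift]
  simp only [movingMaxwellian, maxwellian, this]
  ring

/-- The two partners form a single point of `ℝ²ᵈ` moving with velocity `𝐮` relative to `(x, x)`, so
the ternary case becomes a pair interaction in dimension `2d`. -/
theorem lossIntegrand3_movingMaxwellian (γ : ℝ) (b : ℝ → ℝ → ℝ) (s : ℝ) (p : Phase d)
    (q : Sph2 d × (Vel d × Vel d)) :
    lossIntegrand3 γ b (movingMaxwellian α β s) (movingMaxwellian α β s)
      (movingMaxwellian α β s) (p.1 + s • p.2, p.2) q =
    maxwellian α β p * (crossSection3 γ b p.2 q.2.1 q.2.2 q.1 *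
      Real.exp (-α * ‖(WithLp.toLp 2 (p.1, p.1) : Vel2 d) - s • relVel3 p.2 q.2.1 q.2.2‖ ^ 2 -
        β * ‖(WithLp.toLp 2 q.2 : Vel2 d)‖ ^ 2)) := by
  have (w : Vel d) : p.1 + s • p.2 - s • w = p.1 - s • (w - p.2) := by rw [smul_sub]; abel
  simp only [lossIntegrand3, movingMaxwellian_shift]
  simp only [movingMaxwellian, maxwellian, this, WithLp.prod_norm_sq_eq_of_L2, relVel3,
    WithLp.sub_fst, WithLp.sub_snd, WithLp.smul_fst, WithLp.smul_snd, WithLp.toLp_fst,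
    WithLp.toLp_snd]
  rw [mul_assoc, mul_assoc, ← Real.exp_add, mul_left_comm]
  congr 3
  ring

theorem finrank_vel2 : Module.finrank ℝ (Vel2 d) = 2 * d := by
  rw [(WithLp.linearEquiv 2 ℝ (Vel d × Vel d)).finrank_eq, Module.finrank_prod,
    finrank_euclideanSpace_fin, two_mul]

theorem nontrivial_vel (hd : 2 ≤ d) : Nontrivial (Vel d) := by
  apply Module.nontrivial_of_finrank_pos (R := ℝ)
  rw [finrank_euclideanSpace_fin]; omega

theorem nontrivial_vel2 (hd : 2 ≤ d) : Nontrivial (Vel2 d) := by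
  apply Module.nontrivial_of_finrank_pos (R := ℝ)
  rw [finrank_vel2]; omega

theorem lintegral_lossIntegrand2 (hb : IsBinaryAngular d b₂) (γ s : ℝ) (p : Phase d) :
    ∫⁻ q, ENNReal.ofReal (lossIntegrand2 γ b₂ (movingMaxwellian α β s) (movingMaxwellian α β s)
      (p.1 + s • p.2, p.2) q) ∂(collMeasure2 d) =
    ENNReal.ofReal (maxwellian α β p) * ∫⁻ q,
      ENNReal.ofReal (crossSection2 γ b₂ (q.2 - p.2) q.1) * ENNReal.ofReal
        (Real.exp (-α * ‖p.1 - s • (q.2 - p.2)‖ ^ 2 - β * ‖q.2‖ ^ 2))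
          ∂((sphMeasure d).prod volume) := by
  rw [← lintegral_const_mul' _ _ ENNReal.ofReal_ne_top]
  refine lintegral_congr fun q => ?_
  rw [lossIntegrand2_movingMaxwellian, ENNReal.ofReal_mul (maxwellian_pos _ _ _).le,
    ENNReal.ofReal_mul (crossSection2_nonneg hb _ _ _)]

theorem measurable_ofReal_crossSection2 (hb : IsBinaryAngular d b₂) (γ : ℝ) :
    Measurable (Function.uncurry fun (u : Vel d) (ω : Sph d) =>
      ENNReal.ofReal (crossSection2 γ b₂ u ω)) :=
  (measurable_crossSection2 hb γ).ennreal_ofReal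

theorem measurable_ofReal_crossSection3 (hb : IsTernaryAngular d b₃) (γ : ℝ) :
    Measurable (Function.uncurry fun (u : Vel2 d) (ω : Sph2 d) =>
      ENNReal.ofReal (crossSection3 γ b₃ 0 u.fst u.snd ω)) :=
  (((measurable_crossSection3 hb γ).comp (g := fun z : (Vel d × Vel d × Vel d) × Sph2 d =>
      crossSection3 γ b₃ z.1.1 z.1.2.1 z.1.2.2 z.2)
    (f := fun z : Vel2 d × Sph2 d => ((0, z.1.fst, z.1.snd), z.2)) (by fun_prop))).ennreal_ofReal

theorem lintegral_lossIntegrand3 (hb : IsTernaryAngular d b₃) (γ s : ℝ) (p : Phase d) :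
    ∫⁻ q, ENNReal.ofReal (lossIntegrand3 γ b₃ (movingMaxwellian α β s) (movingMaxwellian α β s)
      (movingMaxwellian α β s) (p.1 + s • p.2, p.2) q) ∂(collMeasure3 d) =
    ENNReal.ofReal (maxwellian α β p) * ∫⁻ q : Sph2 d × Vel2 d,
      ENNReal.ofReal (crossSection3 γ b₃ 0 (q.2 - WithLp.toLp 2 (p.2, p.2)).fst
        (q.2 - WithLp.toLp 2 (p.2, p.2)).snd q.1) * ENNReal.ofReal
        (Real.exp (-α * ‖(WithLp.toLp 2 (p.1, p.1) : Vel2 d) -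
            s • (q.2 - WithLp.toLp 2 (p.2, p.2))‖ ^ 2 - β * ‖q.2‖ ^ 2))
          ∂((sph2Measure d).prod volume) := by
  have hmp : MeasurePreserving (Prod.map id (WithLp.toLp 2) :
      Sph2 d × (Vel d × Vel d) → Sph2 d × Vel2 d)
      ((sph2Measure d).prod volume) ((sph2Measure d).prod volume) :=
    (MeasurePreserving.id _).prod (WithLp.volume_preserving_toLp (Vel d) (Vel d))
  have hB := measurable_ofReal_crossSection3 hb γ
  rw [← hmp.lintegral_comp, ← lintegral_const_mul' _ _ ENNReal.ofReal_ne_top]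
  · refine lintegral_congr fun q => ?_
    rw [lossIntegrand3_movingMaxwellian, ENNReal.ofReal_mul (maxwellian_pos _ _ _).le,
      ENNReal.ofReal_mul (crossSection3_nonneg hb _ _ _ _ _)]
    have h : crossSection3 γ b₃ 0
        ((WithLp.toLp 2 q.2 : Vel2 d) - WithLp.toLp 2 (p.2, p.2)).fst
        ((WithLp.toLp 2 q.2 : Vel2 d) - WithLp.toLp 2 (p.2, p.2)).snd q.1 =
        crossSection3 γ b₃ p.2 q.2.1 q.2.2 q.1 := crossSection3_zero_sub γ _ _ _ _
    simp only [Prod.map, id, h]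
    rfl
  · have hB' : Measurable (fun q : Sph2 d × Vel2 d => ENNReal.ofReal (crossSection3 γ b₃ 0
        (q.2 - WithLp.toLp 2 (p.2, p.2)).fst (q.2 - WithLp.toLp 2 (p.2, p.2)).snd q.1)) :=
      hB.comp (f := fun q : Sph2 d × Vel2 d => (q.2 - WithLp.toLp 2 (p.2, p.2), q.1))
        (by fun_prop)
    exact hB'.mul (by fun_prop)

theorem lintegral_crossSection3_fst_snd_le {γ : ℝ} (hγ : γ ≤ 1) {u : Vel2 d} (hu : u ≠ 0) :
    ∫⁻ ω, ENNReal.ofReal (crossSection3 γ b₃ 0 u.fst u.snd ω) ∂(sph2Measure d) ≤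
      angularNorm3 d b₃ * ENNReal.ofReal (Real.sqrt 3 * (‖u‖ ^ (γ - 1) * ‖u‖)) := by
  have h : relVel3 0 u.fst u.snd = u := by
    simp only [relVel3, sub_zero]
    rfl
  have := lintegral_crossSection3_le (b₃ := b₃) hγ (v := 0) (v₁ := u.fst) (v₂ := u.snd)
    (by rwa [h])
  rwa [h] at this

/-- A constant, depending only on the dimension, in front of the collision estimates. -/
def collisionConst (d : ℕ) : ℝ :=
  Real.sqrt (3 * Real.pi) * (Real.pi ^ ((d : ℝ) / 2) + Real.pi ^ (d : ℝ) +
    d * volume.real (ball (0 : Vel d) 1) + 2 * d * volume.real (ball (0 : Vel2 d) 1))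

theorem collisionConst_pos (d : ℕ) : 0 < collisionConst d := by
  unfold collisionConst
  have : 0 < Real.pi ^ ((d : ℝ) / 2) := by positivity
  positivity

/-- One inequality for `n = d`, `c = 1` and for `n = 2d`, `c = √3`: it separates the dimensional
constant from the dependence on `α`, `β` and `r = γ - 1`. -/
theorem const_mul_gaussSingularBound_le {E : Type*} [NormedAddCommGroup E]
    [InnerProductSpace ℝ E] [MeasureSpace E] {n r c C : ℝ} (hn : (Module.finrank ℝ E : ℝ) = n)
    (hα : 0 < α) (hβ : 0 < β) (hr : 0 < n + r) (hc : c ≤ Real.sqrt 3)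
    (hC1 : Real.sqrt (3 * Real.pi) * Real.pi ^ (n / 2) ≤ C)
    (hC2 : Real.sqrt (3 * Real.pi) * (n * volume.real (ball (0 : E) 1)) ≤ C) :
    c * Real.sqrt (Real.pi / α) * gaussSingularBound E β r ≤
      C * (β ^ (-n / 2) + 1 / (n + r)) * α ^ (-(1 / 2) : ℝ) := by
  have hn0 : 0 ≤ n := by rw [← hn]; positivity
  have h1 : Real.sqrt (Real.pi / α) = Real.sqrt Real.pi * α ^ (-(1 / 2) : ℝ) := by
    rw [Real.sqrt_div' _ hα.le, Real.rpow_neg hα.le, ← Real.sqrt_eq_rpow, div_eq_mul_inv]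
  have h2 : gaussSingularBound E β r =
      Real.pi ^ (n / 2) * β ^ (-n / 2) + n * volume.real (ball (0 : E) 1) * (1 / (n + r)) := by
    rw [gaussSingularBound, hn, Real.div_rpow Real.pi_pos.le hβ.le, neg_div, Real.rpow_neg hβ.le]
    ring
  have hb : 0 < β ^ (-n / 2) := by positivity
  have hi : 0 < 1 / (n + r) := by positivity
  have hs : Real.sqrt (3 * Real.pi) = Real.sqrt 3 * Real.sqrt Real.pi :=
    Real.sqrt_mul (by norm_num) _
  have hg : 0 ≤ gaussSingularBound E β r := by rw [h2]; positivity
  calc c * Real.sqrt (Real.pi / α) * gaussSingularBound E β r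
      ≤ Real.sqrt 3 * Real.sqrt (Real.pi / α) * gaussSingularBound E β r := by gcongr
    _ = ((Real.sqrt (3 * Real.pi) * Real.pi ^ (n / 2)) * β ^ (-n / 2) +
        (Real.sqrt (3 * Real.pi) * (n * volume.real (ball (0 : E) 1))) * (1 / (n + r))) *
          α ^ (-(1 / 2) : ℝ) := by
        rw [h1, h2, hs]; ring
    _ ≤ (C * β ^ (-n / 2) + C * (1 / (n + r))) * α ^ (-(1 / 2) : ℝ) := by gcongr
    _ = _ := by ring

/-- The binary half of the dispersive estimate. The dwell time lowers the exponent to `γ₂ - 1`, so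
the singular integral in dimension `d` converges exactly when `d + γ₂ - 1 > 0`. -/
theorem lintegral_lintegral_lossIntegrand2_le (hd : 2 ≤ d) (hb : IsBinaryAngular d b₂)
    (hγ : γ₂ ∈ Ioc (-(d : ℝ) + 1) 1) (hα : 0 < α) (hβ : 0 < β) (p : Phase d) :
    ∫⁻ s : ℝ, ∫⁻ q, ENNReal.ofReal (lossIntegrand2 γ₂ b₂ (movingMaxwellian α β s)
      (movingMaxwellian α β s) (p.1 + s • p.2, p.2) q) ∂(collMeasure2 d) ≤
    ENNReal.ofReal (collisionConst d * ((angularNorm2 d b₂).toReal *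
      (β ^ (-(d : ℝ) / 2) + 1 / ((d : ℝ) + γ₂ - 1))) * α ^ (-(1 / 2) : ℝ) *
        maxwellian α β p) := by
  have := nontrivial_vel hd
  have hf : (Module.finrank ℝ (Vel d) : ℝ) = d := by rw [finrank_euclideanSpace_fin]
  have hr : 0 < (d : ℝ) + (γ₂ - 1) := by linarith [hγ.1]
  simp_rw [lintegral_lossIntegrand2 hb]
  rw [lintegral_const_mul' _ _ ENNReal.ofReal_ne_top]
  have h := lintegral_lintegral_collision_le (σ := sphMeasure d)
    (measurable_ofReal_crossSection2 hb γ₂) hb.integrable.ne zero_le_one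
    (fun u hu => lintegral_crossSection2_le (b₂ := b₂) γ₂ hu) hα hβ
    (by linarith [hγ.2]) (by rwa [hf]) p.1 p.2
  have hC : 1 * Real.sqrt (Real.pi / α) * gaussSingularBound (Vel d) β (γ₂ - 1) ≤
      collisionConst d * (β ^ (-(d : ℝ) / 2) + 1 / ((d : ℝ) + (γ₂ - 1))) *
        α ^ (-(1 / 2) : ℝ) := by
    apply const_mul_gaussSingularBound_le hf hα hβ hr
    · exact Real.one_le_sqrt.2 (by norm_num)
    all_goals
      unfold collisionConst
      gcongr
      have h1 : 0 < Real.pi ^ ((d : ℝ) / 2) := by positivity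
      have h2 : 0 < Real.pi ^ (d : ℝ) := by positivity
      have h3 : 0 ≤ (d : ℝ) * volume.real (ball (0 : Vel d) 1) := by positivity
      have h4 : 0 ≤ 2 * (d : ℝ) * volume.real (ball (0 : Vel2 d) 1) := by positivity
      linarith
  calc _ ≤ ENNReal.ofReal (maxwellian α β p) * (ENNReal.ofReal (angularNorm2 d b₂).toReal *
        ENNReal.ofReal (collisionConst d * (β ^ (-(d : ℝ) / 2) + 1 / ((d : ℝ) + (γ₂ - 1))) *
          α ^ (-(1 / 2) : ℝ))) := by
        rw [ENNReal.ofReal_toReal hb.integrable.ne]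
        gcongr
        exact h.trans (by gcongr)
    _ = _ := by
        rw [← ENNReal.ofReal_mul (by positivity),
          ← ENNReal.ofReal_mul (maxwellian_pos _ _ _).le]
        congr 1
        rw [add_sub_assoc]
        ring

theorem lintegral_lintegral_lossIntegrand3_le (hd : 2 ≤ d) (hb : IsTernaryAngular d b₃)
    (hγ : γ₃ ∈ Ioc (-(2 * (d : ℝ)) + 1) 1) (hα : 0 < α) (hβ : 0 < β) (p : Phase d) :
    ∫⁻ s : ℝ, ∫⁻ q, ENNReal.ofReal (lossIntegrand3 γ₃ b₃ (movingMaxwellian α β s)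
      (movingMaxwellian α β s) (movingMaxwellian α β s) (p.1 + s • p.2, p.2) q)
        ∂(collMeasure3 d) ≤
    ENNReal.ofReal (collisionConst d * ((angularNorm3 d b₃).toReal *
      (β ^ (-(d : ℝ)) + 1 / (2 * (d : ℝ) + γ₃ - 1))) * α ^ (-(1 / 2) : ℝ) *
        maxwellian α β p) := by
  have := nontrivial_vel2 hd
  have hf : (Module.finrank ℝ (Vel2 d) : ℝ) = 2 * d := by rw [finrank_vel2]; push_cast; ring
  have hr : 0 < 2 * (d : ℝ) + (γ₃ - 1) := by linarith [hγ.1]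
  simp_rw [lintegral_lossIntegrand3 hb]
  rw [lintegral_const_mul' _ _ ENNReal.ofReal_ne_top]
  have h := lintegral_lintegral_collision_le (σ := sph2Measure d)
    (measurable_ofReal_crossSection3 hb γ₃) hb.integrable.ne (Real.sqrt_nonneg 3)
    (fun u hu => lintegral_crossSection3_fst_snd_le (b₃ := b₃) hγ.2 hu) hα hβ
    (by linarith [hγ.2]) (by rwa [hf]) (WithLp.toLp 2 (p.1, p.1)) (WithLp.toLp 2 (p.2, p.2))
  have hC : Real.sqrt 3 * Real.sqrt (Real.pi / α) * gaussSingularBound (Vel2 d) β (γ₃ - 1) ≤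
      collisionConst d * (β ^ (-(2 * (d : ℝ)) / 2) + 1 / (2 * (d : ℝ) + (γ₃ - 1))) *
        α ^ (-(1 / 2) : ℝ) := by
    apply const_mul_gaussSingularBound_le hf hα hβ hr le_rfl
    all_goals
      unfold collisionConst
      try rw [mul_div_cancel_left₀ _ (two_ne_zero' ℝ)]
      gcongr
      have h1 : 0 < Real.pi ^ ((d : ℝ) / 2) := by positivity
      have h2 : 0 < Real.pi ^ (d : ℝ) := by positivity
      have h3 : 0 ≤ (d : ℝ) * volume.real (ball (0 : Vel d) 1) := by positivity
      have h4 : 0 ≤ 2 * (d : ℝ) * volume.real (ball (0 : Vel2 d) 1) := by positivity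
      linarith
  calc _ ≤ ENNReal.ofReal (maxwellian α β p) * (ENNReal.ofReal (angularNorm3 d b₃).toReal *
        ENNReal.ofReal (collisionConst d * (β ^ (-(2 * (d : ℝ)) / 2) +
          1 / (2 * (d : ℝ) + (γ₃ - 1))) * α ^ (-(1 / 2) : ℝ))) := by
        rw [ENNReal.ofReal_toReal hb.integrable.ne]
        gcongr
        exact h.trans (by gcongr)
    _ = _ := by
        rw [← ENNReal.ofReal_mul (by positivity),
          ← ENNReal.ofReal_mul (maxwellian_pos _ _ _).le]
        congr 1
        have : -(2 * (d : ℝ)) / 2 = -d := by ring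
        rw [add_sub_assoc, this]
        ring

/-- Linear growth in `v` is paid for with half of the Gaussian decay, through `1 + y ≤ exp y`. -/
theorem one_add_norm_mul_maxwellian_le (hβ : 0 < β) {c : ℝ} (hc : 0 ≤ c) :
    ∃ C : ℝ, 0 ≤ C ∧ ∀ p : Phase d,
      (1 + c * ‖p.2‖) * maxwellian α β p ≤ C * maxwellian α (β / 2) p := by
  refine ⟨1 + c * (1 + 1 / β), by positivity, fun p => ?_⟩
  have h1 : maxwellian α β p = Real.exp (-(β / 2) * ‖p.2‖ ^ 2) * maxwellian α (β / 2) p := by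
    simp only [maxwellian]
    rw [← Real.exp_add]; ring_nf
  set e := Real.exp (-(β / 2) * ‖p.2‖ ^ 2) with he
  have he0 : 0 < e := Real.exp_pos _
  have h2 : 1 + β / 2 * ‖p.2‖ ^ 2 ≤ e⁻¹ := by
    rw [he, ← Real.exp_neg]
    have := Real.add_one_le_exp (-(-(β / 2) * ‖p.2‖ ^ 2))
    linarith
  have h3 : 1 + c * ‖p.2‖ ≤ (1 + c * (1 + 1 / β)) * (1 + β / 2 * ‖p.2‖ ^ 2) := by
    have h4 : ‖p.2‖ ≤ (1 + 1 / β) * (1 + β / 2 * ‖p.2‖ ^ 2) := by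
      have : (1 + 1 / β) * (1 + β / 2 * ‖p.2‖ ^ 2) =
          1 + 1 / β + β / 2 * ‖p.2‖ ^ 2 + ‖p.2‖ ^ 2 / 2 := by field_simp; ring
      rw [this]
      have : 0 ≤ 1 / β + β / 2 * ‖p.2‖ ^ 2 := by positivity
      nlinarith [sq_nonneg (‖p.2‖ - 1)]
    have h5 : 0 ≤ β / 2 * ‖p.2‖ ^ 2 := by positivity
    nlinarith
  rw [h1, ← mul_assoc]
  gcongr ?_ * _
  · exact (maxwellian_pos _ _ _).le
  calc (1 + c * ‖p.2‖) * e ≤ (1 + c * (1 + 1 / β)) * (1 + β / 2 * ‖p.2‖ ^ 2) * e := by gcongr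
    _ ≤ (1 + c * (1 + 1 / β)) * e⁻¹ * e := by gcongr
    _ = _ := by field_simp

/-- Without time integration no dwell time compensates `|u|`, hence the loss of half of `β`. This is
harmless: the bound only serves to make the integrals finite at every time and to supply an
integrable envelope uniform in `s`. -/
theorem exists_lintegral_lossIntegrand2_le (hd : 2 ≤ d) (hb : IsBinaryAngular d b₂)
    (hγ : γ₂ ∈ Ioc (-(d : ℝ) + 1) 1) (hα : 0 < α) (hβ : 0 < β) :
    ∃ C : ℝ, 0 ≤ C ∧ ∀ (s : ℝ) (p : Phase d), ∫⁻ q, ENNReal.ofReal (lossIntegrand2 γ₂ b₂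
      (movingMaxwellian α β s) (movingMaxwellian α β s) (p.1 + s • p.2, p.2) q)
        ∂(collMeasure2 d) ≤ ENNReal.ofReal (C * maxwellian α (β / 2) p) := by
  have := nontrivial_vel hd
  have hf : (Module.finrank ℝ (Vel d) : ℝ) = d := by rw [finrank_euclideanSpace_fin]
  have hr : 0 < (d : ℝ) + (γ₂ - 1) := by linarith [hγ.1]
  obtain ⟨C, hC, hCp⟩ := one_add_norm_mul_maxwellian_le (d := d) (α := α) hβ zero_le_one
  have hg : 0 ≤ gaussSingularBound (Vel d) (β / 2) (γ₂ - 1) := by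
    unfold gaussSingularBound; rw [hf]; positivity
  refine ⟨(angularNorm2 d b₂).toReal * ((1 + 1 / β) *
    gaussSingularBound (Vel d) (β / 2) (γ₂ - 1)) * C, by positivity, fun s p => ?_⟩
  have h := lintegral_collision_gaussian_le (σ := sphMeasure d)
    (measurable_ofReal_crossSection2 hb γ₂) hb.integrable.ne zero_le_one
    (fun u hu => lintegral_crossSection2_le (b₂ := b₂) γ₂ hu) hα hβ
    (by linarith [hγ.2]) (by rwa [hf]) s p.1 p.2
  rw [lintegral_lossIntegrand2 hb]
  have h2 := hCp p
  rw [one_mul] at h2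
  calc _ ≤ ENNReal.ofReal (maxwellian α β p) * (ENNReal.ofReal (angularNorm2 d b₂).toReal *
        ENNReal.ofReal (1 * (1 + 1 / β) * (1 + ‖p.2‖) *
          gaussSingularBound (Vel d) (β / 2) (γ₂ - 1))) := by
        rw [ENNReal.ofReal_toReal hb.integrable.ne]
        gcongr
    _ = ENNReal.ofReal ((angularNorm2 d b₂).toReal * ((1 + 1 / β) *
          gaussSingularBound (Vel d) (β / 2) (γ₂ - 1)) *
            ((1 + ‖p.2‖) * maxwellian α β p)) := by
        rw [← ENNReal.ofReal_mul (by positivity),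
          ← ENNReal.ofReal_mul (maxwellian_pos _ _ _).le]
        congr 1
        ring
    _ ≤ _ := by
        apply ENNReal.ofReal_le_ofReal
        rw [mul_assoc _ C]
        gcongr

theorem exists_lintegral_lossIntegrand3_le (hd : 2 ≤ d) (hb : IsTernaryAngular d b₃)
    (hγ : γ₃ ∈ Ioc (-(2 * (d : ℝ)) + 1) 1) (hα : 0 < α) (hβ : 0 < β) :
    ∃ C : ℝ, 0 ≤ C ∧ ∀ (s : ℝ) (p : Phase d), ∫⁻ q, ENNReal.ofReal (lossIntegrand3 γ₃ b₃
      (movingMaxwellian α β s) (movingMaxwellian α β s) (movingMaxwellian α β s)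
        (p.1 + s • p.2, p.2) q) ∂(collMeasure3 d) ≤
          ENNReal.ofReal (C * maxwellian α (β / 2) p) := by
  have := nontrivial_vel2 hd
  have hf : (Module.finrank ℝ (Vel2 d) : ℝ) = 2 * d := by rw [finrank_vel2]; push_cast; ring
  have hr : 0 < 2 * (d : ℝ) + (γ₃ - 1) := by linarith [hγ.1]
  obtain ⟨C, hC, hCp⟩ := one_add_norm_mul_maxwellian_le (d := d) (α := α) hβ
    (Real.sqrt_nonneg 2)
  have hg : 0 ≤ gaussSingularBound (Vel2 d) (β / 2) (γ₃ - 1) := by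
    unfold gaussSingularBound; rw [hf]; positivity
  refine ⟨(angularNorm3 d b₃).toReal * (Real.sqrt 3 * (1 + 1 / β) *
    gaussSingularBound (Vel2 d) (β / 2) (γ₃ - 1)) * C, by positivity, fun s p => ?_⟩
  have h := lintegral_collision_gaussian_le (σ := sph2Measure d)
    (measurable_ofReal_crossSection3 hb γ₃) hb.integrable.ne (Real.sqrt_nonneg 3)
    (fun u hu => lintegral_crossSection3_fst_snd_le (b₃ := b₃) hγ.2 hu) hα hβ
    (by linarith [hγ.2]) (by rwa [hf]) s (WithLp.toLp 2 (p.1, p.1)) (WithLp.toLp 2 (p.2, p.2))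
  have hV : ‖(WithLp.toLp 2 (p.2, p.2) : Vel2 d)‖ = Real.sqrt 2 * ‖p.2‖ := by
    rw [WithLp.prod_norm_eq_of_L2, WithLp.toLp_fst, WithLp.toLp_snd, ← two_mul,
      Real.sqrt_mul (by norm_num),
      Real.sqrt_sq (norm_nonneg _)]
  rw [hV] at h
  rw [lintegral_lossIntegrand3 hb]
  calc _ ≤ ENNReal.ofReal (maxwellian α β p) * (ENNReal.ofReal (angularNorm3 d b₃).toReal *
        ENNReal.ofReal (Real.sqrt 3 * (1 + 1 / β) * (1 + Real.sqrt 2 * ‖p.2‖) *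
          gaussSingularBound (Vel2 d) (β / 2) (γ₃ - 1))) := by
        rw [ENNReal.ofReal_toReal hb.integrable.ne]
        gcongr
    _ = ENNReal.ofReal ((angularNorm3 d b₃).toReal * (Real.sqrt 3 * (1 + 1 / β) *
          gaussSingularBound (Vel2 d) (β / 2) (γ₃ - 1)) *
            ((1 + Real.sqrt 2 * ‖p.2‖) * maxwellian α β p)) := by
        rw [← ENNReal.ofReal_mul (by positivity),
          ← ENNReal.ofReal_mul (maxwellian_pos _ _ _).le]
        congr 1
        ring
    _ ≤ _ := by
        apply ENNReal.ofReal_le_ofReal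
        rw [mul_assoc _ C]
        gcongr ?_ * ?_
        exact hCp p

end Majorant

/-! ### Conservation laws and pointwise estimates -/

section Integrands

variable {d : ℕ} {γ₂ γ₃ : ℝ} {b₂ : ℝ → ℝ} {b₃ : ℝ → ℝ → ℝ} {α β : ℝ}

theorem norm_sub_smul_sq (y v : Vel d) (s : ℝ) :
    ‖y - s • v‖ ^ 2 = ‖y‖ ^ 2 - 2 * s * inner ℝ y v + s ^ 2 * ‖v‖ ^ 2 := by
  rw [norm_sub_sq_real, real_inner_smul_right, norm_smul, mul_pow, Real.norm_eq_abs, sq_abs]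
  ring

/-- Expanding `|y - s w|²`, the cross terms are linear in the velocities and match by momentum
conservation; the quadratic terms match by energy conservation. -/
theorem movingMaxwellian_mul_eq {s : ℝ} {y v v₁ w w₁ : Vel d} (h1 : w + w₁ = v + v₁)
    (h2 : ‖w‖ ^ 2 + ‖w₁‖ ^ 2 = ‖v‖ ^ 2 + ‖v₁‖ ^ 2) :
    movingMaxwellian α β s (y, w) * movingMaxwellian α β s (y, w₁) =
      movingMaxwellian α β s (y, v) * movingMaxwellian α β s (y, v₁) := by
  have h3 : inner ℝ y w + inner ℝ y w₁ = inner ℝ y v + (inner ℝ y v₁ : ℝ) := by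
    rw [← inner_add_right, h1, inner_add_right]
  simp only [movingMaxwellian, maxwellian, ← Real.exp_add, norm_sub_smul_sq]
  congr 1
  linear_combination (2 * α * s) * h3 - (α * s ^ 2 + β) * h2

theorem movingMaxwellian_mul_mul_eq {s : ℝ} {y v v₁ v₂ w w₁ w₂ : Vel d}
    (h1 : w + w₁ + w₂ = v + v₁ + v₂)
    (h2 : ‖w‖ ^ 2 + ‖w₁‖ ^ 2 + ‖w₂‖ ^ 2 = ‖v‖ ^ 2 + ‖v₁‖ ^ 2 + ‖v₂‖ ^ 2) :
    movingMaxwellian α β s (y, w) * movingMaxwellian α β s (y, w₁) *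
        movingMaxwellian α β s (y, w₂) =
      movingMaxwellian α β s (y, v) * movingMaxwellian α β s (y, v₁) *
        movingMaxwellian α β s (y, v₂) := by
  have h3 : inner ℝ y w + inner ℝ y w₁ + inner ℝ y w₂ =
      inner ℝ y v + inner ℝ y v₁ + (inner ℝ y v₂ : ℝ) := by
    rw [← inner_add_right, ← inner_add_right, h1, inner_add_right, inner_add_right]
  simp only [movingMaxwellian, maxwellian, ← Real.exp_add, norm_sub_smul_sq]
  congr 1
  linear_combination (2 * α * s) * h3 - (α * s ^ 2 + β) * h2

theorem post2_momentum (ω : Sph d) (v v₁ : Vel d) : post2 ω v v₁ + post2₁ ω v v₁ = v + v₁ := by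
  unfold post2 post2₁
  abel

theorem post2_energy (ω : Sph d) (v v₁ : Vel d) :
    ‖post2 ω v v₁‖ ^ 2 + ‖post2₁ ω v v₁‖ ^ 2 = ‖v‖ ^ 2 + ‖v₁‖ ^ 2 := by
  have hω : ‖(ω : Vel d)‖ = 1 := by simp
  unfold post2 post2₁
  rw [norm_add_sq_real, norm_sub_sq_real, norm_smul, hω, mul_one, Real.norm_eq_abs, sq_abs,
    real_inner_smul_right, real_inner_smul_right, inner_sub_right, real_inner_comm v,
    real_inner_comm v₁]
  ring

theorem post3_momentum (ω : Sph2 d) (v v₁ v₂ : Vel d) :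
    post3 ω v v₁ v₂ + post3₁ ω v v₁ v₂ + post3₂ ω v v₁ v₂ = v + v₁ + v₂ := by
  unfold post3 post3₁ post3₂
  rw [smul_add]
  abel

/-- The energy changes by `2c²(|ω₁|² + |ω₂|² + ω₁·ω₂) - 2c ω·𝐮`, and `c` is the non-trivial root of
this expression on the unit sphere. -/
theorem post3_energy (ω : Sph2 d) (v v₁ v₂ : Vel d) :
    ‖post3 ω v v₁ v₂‖ ^ 2 + ‖post3₁ ω v v₁ v₂‖ ^ 2 + ‖post3₂ ω v v₁ v₂‖ ^ 2 =
      ‖v‖ ^ 2 + ‖v₁‖ ^ 2 + ‖v₂‖ ^ 2 := by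
  have hω : ‖(ω : Vel2 d).fst‖ ^ 2 + ‖(ω : Vel2 d).snd‖ ^ 2 = 1 := by
    rw [← WithLp.prod_norm_sq_eq_of_L2]; simp
  have hb := blockInner_mem_Icc ω
  have hpos : 0 < 1 + blockInner ω := by linarith [hb.1]
  have hc : impulse3 ω v v₁ v₂ * (1 + blockInner ω) =
      inner ℝ (ω : Vel2 d).fst (v₁ - v) + inner ℝ (ω : Vel2 d).snd (v₂ - v) :=
    div_mul_cancel₀ _ hpos.ne'
  unfold post3 post3₁ post3₂
  set c := impulse3 ω v v₁ v₂
  unfold blockInner at hc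
  simp only [norm_add_sq_real, norm_sub_sq_real, norm_smul, mul_pow, Real.norm_eq_abs, sq_abs,
    real_inner_smul_right, inner_add_right, inner_sub_right] at hc ⊢
  rw [real_inner_comm v, real_inner_comm v₁, real_inner_comm v, real_inner_comm v₂] at hc
  linear_combination (2 * c ^ 2) * hω + 2 * c * hc

/-- Telescoping, one factor at a time; each of the two terms contributes `a δ`. -/
theorem abs_mul_mul_sub_le {c x x' y y' X Y a δ : ℝ} (hc : 0 ≤ c) (hX : 0 ≤ X)
    (ha : 0 ≤ a) (hx' : |x'| ≤ a * X) (hy : |y| ≤ a * Y) (hx : |x - x'| ≤ δ * X)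
    (hyy : |y - y'| ≤ δ * Y) :
    |c * x * y - c * x' * y'| ≤ 2 * a * δ * (c * X * Y) := by
  have hδX : 0 ≤ δ * X := (abs_nonneg _).trans hx
  have e : c * x * y - c * x' * y' = c * ((x - x') * y + x' * (y - y')) := by ring
  rw [e, abs_mul, abs_of_nonneg hc]
  calc c * |(x - x') * y + x' * (y - y')| ≤ c * (|x - x'| * |y| + |x'| * |y - y'|) := by
        gcongr
        rw [← abs_mul, ← abs_mul]
        exact abs_add_le _ _
    _ ≤ c * (δ * X * (a * Y) + a * X * (δ * Y)) := by gcongr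
    _ = _ := by ring

theorem abs_mul_mul_mul_sub_le {c x x' y y' z z' X Y Z a δ : ℝ} (hc : 0 ≤ c) (hX : 0 ≤ X)
    (hY : 0 ≤ Y) (ha : 0 ≤ a) (hx' : |x'| ≤ a * X) (hy : |y| ≤ a * Y)
    (hy' : |y'| ≤ a * Y) (hz : |z| ≤ a * Z) (hx : |x - x'| ≤ δ * X) (hyy : |y - y'| ≤ δ * Y)
    (hzz : |z - z'| ≤ δ * Z) :
    |c * x * y * z - c * x' * y' * z'| ≤ 3 * a ^ 2 * δ * (c * X * Y * Z) := by
  have hδX : 0 ≤ δ * X := (abs_nonneg _).trans hx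
  have hδY : 0 ≤ δ * Y := (abs_nonneg _).trans hyy
  have e : c * x * y * z - c * x' * y' * z' =
      c * ((x - x') * y * z + x' * (y - y') * z + x' * y' * (z - z')) := by ring
  rw [e, abs_mul, abs_of_nonneg hc]
  calc c * |(x - x') * y * z + x' * (y - y') * z + x' * y' * (z - z')|
      ≤ c * (|x - x'| * |y| * |z| + |x'| * |y - y'| * |z| + |x'| * |y'| * |z - z'|) := by
        gcongr
        simp only [← abs_mul]
        exact abs_add_three _ _ _
    _ ≤ c * (δ * X * (a * Y) * (a * Z) + a * X * (δ * Y) * (a * Z) +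
          a * X * (a * Y) * (δ * Z)) := by gcongr
    _ = _ := by ring

variable {a δ s : ℝ} {f f' g g' h h' : Phase d → ℝ}

/-- Gain differences are bounded by a loss integrand: the Maxwellians produced at the outgoing
velocities are moved back to the incoming ones by the conservation laws. -/
theorem abs_gainIntegrand2_sub_le (hb : IsBinaryAngular d b₂) (ha : 0 ≤ a)
    (hf' : ∀ q, |f' q| ≤ a * movingMaxwellian α β s q)
    (hg : ∀ q, |g q| ≤ a * movingMaxwellian α β s q)
    (hff : ∀ q, |f q - f' q| ≤ δ * movingMaxwellian α β s q)
    (hgg : ∀ q, |g q - g' q| ≤ δ * movingMaxwellian α β s q) (p : Phase d)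
    (q : Sph d × Vel d) :
    |gainIntegrand2 γ₂ b₂ f g p q - gainIntegrand2 γ₂ b₂ f' g' p q| ≤
      2 * a * δ * lossIntegrand2 γ₂ b₂ (movingMaxwellian α β s) (movingMaxwellian α β s) p q := by
  unfold gainIntegrand2 lossIntegrand2
  refine (abs_mul_mul_sub_le (crossSection2_nonneg hb _ _ _) (movingMaxwellian_pos _ _ _ _).le
    ha (hf' _) (hg _) (hff _) (hgg _)).trans_eq ?_
  linear_combination (2 * a * δ * crossSection2 γ₂ b₂ (q.2 - p.2) q.1) *
    movingMaxwellian_mul_eq (α := α) (β := β) (s := s) (y := p.1)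
      (post2_momentum q.1 p.2 q.2) (post2_energy q.1 p.2 q.2)

theorem abs_lossIntegrand2_sub_le (hb : IsBinaryAngular d b₂) (ha : 0 ≤ a)
    (hf' : ∀ q, |f' q| ≤ a * movingMaxwellian α β s q)
    (hg : ∀ q, |g q| ≤ a * movingMaxwellian α β s q)
    (hff : ∀ q, |f q - f' q| ≤ δ * movingMaxwellian α β s q)
    (hgg : ∀ q, |g q - g' q| ≤ δ * movingMaxwellian α β s q) (p : Phase d)
    (q : Sph d × Vel d) :
    |lossIntegrand2 γ₂ b₂ f g p q - lossIntegrand2 γ₂ b₂ f' g' p q| ≤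
      2 * a * δ * lossIntegrand2 γ₂ b₂ (movingMaxwellian α β s) (movingMaxwellian α β s) p q :=
  abs_mul_mul_sub_le (crossSection2_nonneg hb _ _ _) (movingMaxwellian_pos _ _ _ _).le
    ha (hf' _) (hg _) (hff _) (hgg _)

theorem abs_gainIntegrand3_sub_le (hb : IsTernaryAngular d b₃) (ha : 0 ≤ a)
    (hf' : ∀ q, |f' q| ≤ a * movingMaxwellian α β s q)
    (hg : ∀ q, |g q| ≤ a * movingMaxwellian α β s q)
    (hg' : ∀ q, |g' q| ≤ a * movingMaxwellian α β s q)
    (hh : ∀ q, |h q| ≤ a * movingMaxwellian α β s q)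
    (hff : ∀ q, |f q - f' q| ≤ δ * movingMaxwellian α β s q)
    (hgg : ∀ q, |g q - g' q| ≤ δ * movingMaxwellian α β s q)
    (hhh : ∀ q, |h q - h' q| ≤ δ * movingMaxwellian α β s q) (p : Phase d)
    (q : Sph2 d × (Vel d × Vel d)) :
    |gainIntegrand3 γ₃ b₃ f g h p q - gainIntegrand3 γ₃ b₃ f' g' h' p q| ≤
      3 * a ^ 2 * δ * lossIntegrand3 γ₃ b₃ (movingMaxwellian α β s) (movingMaxwellian α β s)
        (movingMaxwellian α β s) p q := by
  unfold gainIntegrand3 lossIntegrand3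
  refine (abs_mul_mul_mul_sub_le (crossSection3_nonneg hb _ _ _ _ _)
    (movingMaxwellian_pos _ _ _ _).le (movingMaxwellian_pos _ _ _ _).le
    ha (hf' _) (hg _) (hg' _) (hh _) (hff _) (hgg _) (hhh _)).trans_eq ?_
  linear_combination (3 * a ^ 2 * δ * crossSection3 γ₃ b₃ p.2 q.2.1 q.2.2 q.1) *
    movingMaxwellian_mul_mul_eq (α := α) (β := β) (s := s) (y := p.1)
      (post3_momentum q.1 p.2 q.2.1 q.2.2) (post3_energy q.1 p.2 q.2.1 q.2.2)

theorem abs_lossIntegrand3_sub_le (hb : IsTernaryAngular d b₃) (ha : 0 ≤ a)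
    (hf' : ∀ q, |f' q| ≤ a * movingMaxwellian α β s q)
    (hg : ∀ q, |g q| ≤ a * movingMaxwellian α β s q)
    (hg' : ∀ q, |g' q| ≤ a * movingMaxwellian α β s q)
    (hh : ∀ q, |h q| ≤ a * movingMaxwellian α β s q)
    (hff : ∀ q, |f q - f' q| ≤ δ * movingMaxwellian α β s q)
    (hgg : ∀ q, |g q - g' q| ≤ δ * movingMaxwellian α β s q)
    (hhh : ∀ q, |h q - h' q| ≤ δ * movingMaxwellian α β s q) (p : Phase d)
    (q : Sph2 d × (Vel d × Vel d)) :
    |lossIntegrand3 γ₃ b₃ f g h p q - lossIntegrand3 γ₃ b₃ f' g' h' p q| ≤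
      3 * a ^ 2 * δ * lossIntegrand3 γ₃ b₃ (movingMaxwellian α β s) (movingMaxwellian α β s)
        (movingMaxwellian α β s) p q :=
  abs_mul_mul_mul_sub_le (crossSection3_nonneg hb _ _ _ _ _)
    (movingMaxwellian_pos _ _ _ _).le (movingMaxwellian_pos _ _ _ _).le
    ha (hf' _) (hg _) (hg' _) (hh _) (hff _) (hgg _) (hhh _)

/-! ### Measurability of the collision integrands -/

theorem measurable_post2 : Measurable
    (fun z : Sph d × Vel d × Vel d => post2 z.1 z.2.1 z.2.2) := by
  unfold post2; fun_prop

theorem measurable_post2₁ : Measurable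
    (fun z : Sph d × Vel d × Vel d => post2₁ z.1 z.2.1 z.2.2) := by
  unfold post2₁; fun_prop

theorem measurable_impulse3 : Measurable
    (fun z : Sph2 d × Vel d × Vel d × Vel d => impulse3 z.1 z.2.1 z.2.2.1 z.2.2.2) := by
  unfold impulse3
  fun_prop

theorem measurable_post3 : Measurable
    (fun z : Sph2 d × Vel d × Vel d × Vel d => post3 z.1 z.2.1 z.2.2.1 z.2.2.2) := by
  unfold post3
  exact measurable_snd.fst.add (measurable_impulse3.smul (by fun_prop))

theorem measurable_post3₁ : Measurable
    (fun z : Sph2 d × Vel d × Vel d × Vel d => post3₁ z.1 z.2.1 z.2.2.1 z.2.2.2) := by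
  unfold post3₁
  exact measurable_snd.snd.fst.sub (measurable_impulse3.smul (by fun_prop))

theorem measurable_post3₂ : Measurable
    (fun z : Sph2 d × Vel d × Vel d × Vel d => post3₂ z.1 z.2.1 z.2.2.1 z.2.2.2) := by
  unfold post3₂
  exact measurable_snd.snd.snd.sub (measurable_impulse3.smul (by fun_prop))

variable {X : Type*} [MeasurableSpace X] {F G H : X → Phase d → ℝ} {P : X → Phase d}

/-- The parameter space `X` will carry time together with the phase point, so that the operators are
jointly measurable. -/
theorem measurable_gainIntegrand2 (hb : IsBinaryAngular d b₂)
    (hF : Measurable (Function.uncurry F)) (hG : Measurable (Function.uncurry G))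
    (hP : Measurable P) : Measurable (fun z : X × (Sph d × Vel d) =>
      gainIntegrand2 γ₂ b₂ (F z.1) (G z.1) (P z.1) z.2) := by
  have h0 : Measurable (fun z : X × (Sph d × Vel d) => (z.2.1, (P z.1).2, z.2.2)) := by fun_prop
  have h1 := measurable_post2.comp h0
  have h2 := measurable_post2₁.comp h0
  have hB : Measurable (fun z : X × (Sph d × Vel d) =>
      crossSection2 γ₂ b₂ (z.2.2 - (P z.1).2) z.2.1) :=
    (measurable_crossSection2 hb γ₂).comp
      (g := fun z : Vel d × Sph d => crossSection2 γ₂ b₂ z.1 z.2)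
      (f := fun z : X × (Sph d × Vel d) => (z.2.2 - (P z.1).2, z.2.1)) (by fun_prop)
  have hP1 : Measurable (fun z : X × (Sph d × Vel d) => (P z.1).1) := by fun_prop
  exact (hB.mul (hF.comp (measurable_fst.prodMk (hP1.prodMk h1)))).mul
    (hG.comp (measurable_fst.prodMk (hP1.prodMk h2)))

theorem measurable_lossIntegrand2 (hb : IsBinaryAngular d b₂)
    (hF : Measurable (Function.uncurry F)) (hG : Measurable (Function.uncurry G))
    (hP : Measurable P) : Measurable (fun z : X × (Sph d × Vel d) =>
      lossIntegrand2 γ₂ b₂ (F z.1) (G z.1) (P z.1) z.2) := by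
  have hB : Measurable (fun z : X × (Sph d × Vel d) =>
      crossSection2 γ₂ b₂ (z.2.2 - (P z.1).2) z.2.1) :=
    (measurable_crossSection2 hb γ₂).comp
      (g := fun z : Vel d × Sph d => crossSection2 γ₂ b₂ z.1 z.2)
      (f := fun z : X × (Sph d × Vel d) => (z.2.2 - (P z.1).2, z.2.1)) (by fun_prop)
  have hP1 : Measurable (fun z : X × (Sph d × Vel d) => (P z.1).1) := by fun_prop
  have hP2 : Measurable (fun z : X × (Sph d × Vel d) => (P z.1).2) := by fun_prop
  exact (hB.mul (hF.comp (measurable_fst.prodMk (hP1.prodMk hP2)))).mul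
    (hG.comp (measurable_fst.prodMk (hP1.prodMk (by fun_prop))))

theorem measurable_gainIntegrand3 (hb : IsTernaryAngular d b₃)
    (hF : Measurable (Function.uncurry F)) (hG : Measurable (Function.uncurry G))
    (hH : Measurable (Function.uncurry H)) (hP : Measurable P) :
    Measurable (fun z : X × (Sph2 d × (Vel d × Vel d)) =>
      gainIntegrand3 γ₃ b₃ (F z.1) (G z.1) (H z.1) (P z.1) z.2) := by
  have h0 : Measurable (fun z : X × (Sph2 d × (Vel d × Vel d)) =>
      (z.2.1, (P z.1).2, z.2.2.1, z.2.2.2)) := by fun_prop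
  have h1 := measurable_post3.comp h0
  have h2 := measurable_post3₁.comp h0
  have h3 := measurable_post3₂.comp h0
  have hB : Measurable (fun z : X × (Sph2 d × (Vel d × Vel d)) =>
      crossSection3 γ₃ b₃ (P z.1).2 z.2.2.1 z.2.2.2 z.2.1) :=
    (measurable_crossSection3 hb γ₃).comp (g := fun z : (Vel d × Vel d × Vel d) × Sph2 d =>
        crossSection3 γ₃ b₃ z.1.1 z.1.2.1 z.1.2.2 z.2)
      (f := fun z : X × (Sph2 d × (Vel d × Vel d)) => (((P z.1).2, z.2.2.1, z.2.2.2), z.2.1))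
      (by fun_prop)
  have hP1 : Measurable (fun z : X × (Sph2 d × (Vel d × Vel d)) => (P z.1).1) := by fun_prop
  exact ((hB.mul (hF.comp (measurable_fst.prodMk (hP1.prodMk h1)))).mul
    (hG.comp (measurable_fst.prodMk (hP1.prodMk h2)))).mul
    (hH.comp (measurable_fst.prodMk (hP1.prodMk h3)))

theorem measurable_lossIntegrand3 (hb : IsTernaryAngular d b₃)
    (hF : Measurable (Function.uncurry F)) (hG : Measurable (Function.uncurry G))
    (hH : Measurable (Function.uncurry H)) (hP : Measurable P) :
    Measurable (fun z : X × (Sph2 d × (Vel d × Vel d)) =>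
      lossIntegrand3 γ₃ b₃ (F z.1) (G z.1) (H z.1) (P z.1) z.2) := by
  have hB : Measurable (fun z : X × (Sph2 d × (Vel d × Vel d)) =>
      crossSection3 γ₃ b₃ (P z.1).2 z.2.2.1 z.2.2.2 z.2.1) :=
    (measurable_crossSection3 hb γ₃).comp (g := fun z : (Vel d × Vel d × Vel d) × Sph2 d =>
        crossSection3 γ₃ b₃ z.1.1 z.1.2.1 z.1.2.2 z.2)
      (f := fun z : X × (Sph2 d × (Vel d × Vel d)) => (((P z.1).2, z.2.2.1, z.2.2.2), z.2.1))
      (by fun_prop)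
  have hP1 : Measurable (fun z : X × (Sph2 d × (Vel d × Vel d)) => (P z.1).1) := by fun_prop
  have hP2 : Measurable (fun z : X × (Sph2 d × (Vel d × Vel d)) => (P z.1).2) := by fun_prop
  exact ((hB.mul (hF.comp (measurable_fst.prodMk (hP1.prodMk hP2)))).mul
    (hG.comp (measurable_fst.prodMk (hP1.prodMk (by fun_prop))))).mul
    (hH.comp (measurable_fst.prodMk (hP1.prodMk (by fun_prop))))

theorem measurable_gain (hb₂ : IsBinaryAngular d b₂) (hb₃ : IsTernaryAngular d b₃)
    (hF : Measurable (Function.uncurry F)) (hG : Measurable (Function.uncurry G))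
    (hH : Measurable (Function.uncurry H)) (hP : Measurable P) :
    Measurable (fun z => gain γ₂ γ₃ b₂ b₃ (F z) (G z) (H z) (P z)) :=
  ((measurable_gainIntegrand2 hb₂ hF hG hP).stronglyMeasurable.integral_prod_right'
      (ν := collMeasure2 d)).measurable.add
    ((measurable_gainIntegrand3 hb₃ hF hG hH hP).stronglyMeasurable.integral_prod_right'
      (ν := collMeasure3 d)).measurable

theorem measurable_loss (hb₂ : IsBinaryAngular d b₂) (hb₃ : IsTernaryAngular d b₃)
    (hF : Measurable (Function.uncurry F)) (hG : Measurable (Function.uncurry G))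
    (hH : Measurable (Function.uncurry H)) (hP : Measurable P) :
    Measurable (fun z => loss γ₂ γ₃ b₂ b₃ (F z) (G z) (H z) (P z)) :=
  ((measurable_lossIntegrand2 hb₂ hF hG hP).stronglyMeasurable.integral_prod_right'
      (ν := collMeasure2 d)).measurable.add
    ((measurable_lossIntegrand3 hb₃ hF hG hH hP).stronglyMeasurable.integral_prod_right'
      (ν := collMeasure3 d)).measurable

end Integrands

/-! ### Estimates of the collision operators -/

section Operators

/-- The standing assumptions on the dimension, the cross-sections and the Maxwellian. -/
structure CollisionSetting (d : ℕ) (γ₂ γ₃ : ℝ) (b₂ : ℝ → ℝ) (b₃ : ℝ → ℝ → ℝ) (α β : ℝ) :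
    Prop where
  two_le : 2 ≤ d
  mem₂ : γ₂ ∈ Ioc (-(d : ℝ) + 1) 1
  mem₃ : γ₃ ∈ Ioc (-(2 * (d : ℝ)) + 1) 1
  ang₂ : IsBinaryAngular d b₂
  ang₃ : IsTernaryAngular d b₃
  α_pos : 0 < α
  β_pos : 0 < β

/-- The weighted sum of the binary and ternary majorants that controls functions bounded by `a`
Maxwellians. -/
def majorant {d : ℕ} (γ₂ γ₃ : ℝ) (b₂ : ℝ → ℝ) (b₃ : ℝ → ℝ → ℝ) (α β a s : ℝ) (p : Phase d) : ℝ :=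
  majorant2 γ₂ b₂ α β s p + a * majorant3 γ₃ b₃ α β s p

/-- `f` is measurable and pointwise bounded by `a` times the transported Maxwellian. -/
structure Dominated {d : ℕ} (α β a s : ℝ) (f : Phase d → ℝ) : Prop where
  measurable : Measurable f
  le : ∀ q, |f q| ≤ a * movingMaxwellian α β s q

variable {d : ℕ} {γ₂ γ₃ : ℝ} {b₂ : ℝ → ℝ} {b₃ : ℝ → ℝ → ℝ} {α β : ℝ}
  {a δ s : ℝ} {f f' g g' h h' : Phase d → ℝ}

theorem Dominated.abs (hf : Dominated α β a s f) : Dominated α β a s (fun q => |f q|) :=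
  ⟨hf.measurable.abs, fun q => by rw [abs_abs]; exact hf.le q⟩

theorem dominated_zero (ha : 0 ≤ a) : Dominated α β a s (fun _ : Phase d => (0 : ℝ)) :=
  ⟨measurable_const, fun q => by
    rw [abs_zero]; exact mul_nonneg ha (movingMaxwellian_pos _ _ _ _).le⟩

theorem dominated_movingMaxwellian : Dominated α β 1 s (movingMaxwellian α β s : Phase d → ℝ) :=
  ⟨measurable_movingMaxwellian.of_uncurry_left (f := movingMaxwellian α β), fun q => by
    rw [abs_of_pos (movingMaxwellian_pos _ _ _ _), one_mul]⟩

theorem Dominated.nonneg (hf : Dominated α β a s f) : 0 ≤ a :=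
  nonneg_of_mul_nonneg_left ((abs_nonneg _).trans (hf.le 0)) (movingMaxwellian_pos _ _ _ _)

theorem lossIntegrand2_movingMaxwellian_nonneg (hb : IsBinaryAngular d b₂) (p : Phase d)
    (q : Sph d × Vel d) :
    0 ≤ lossIntegrand2 γ₂ b₂ (movingMaxwellian α β s) (movingMaxwellian α β s) p q :=
  mul_nonneg (mul_nonneg (crossSection2_nonneg hb _ _ _) (movingMaxwellian_pos _ _ _ _).le)
    (movingMaxwellian_pos _ _ _ _).le

theorem lossIntegrand3_movingMaxwellian_nonneg (hb : IsTernaryAngular d b₃) (p : Phase d)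
    (q : Sph2 d × (Vel d × Vel d)) :
    0 ≤ lossIntegrand3 γ₃ b₃ (movingMaxwellian α β s) (movingMaxwellian α β s)
      (movingMaxwellian α β s) p q :=
  mul_nonneg (mul_nonneg (mul_nonneg (crossSection3_nonneg hb _ _ _ _ _)
    (movingMaxwellian_pos _ _ _ _).le) (movingMaxwellian_pos _ _ _ _).le)
    (movingMaxwellian_pos _ _ _ _).le

theorem majorant2_nonneg (hb : IsBinaryAngular d b₂) (p : Phase d) :
    0 ≤ majorant2 γ₂ b₂ α β s p :=
  integral_nonneg fun _ => lossIntegrand2_movingMaxwellian_nonneg hb _ _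

theorem majorant3_nonneg (hb : IsTernaryAngular d b₃) (p : Phase d) :
    0 ≤ majorant3 γ₃ b₃ α β s p :=
  integral_nonneg fun _ => lossIntegrand3_movingMaxwellian_nonneg hb _ _

theorem measurable_lossIntegrand2_right (hb : IsBinaryAngular d b₂) (hf : Measurable f)
    (hg : Measurable g) (p : Phase d) :
    Measurable (lossIntegrand2 γ₂ b₂ f g p) := by
  have h1 : Measurable (fun z : Unit × (Sph d × Vel d) => lossIntegrand2 γ₂ b₂ f g p z.2) :=
    measurable_lossIntegrand2 (X := Unit) hb (F := fun _ => f) (G := fun _ => g)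
      (P := fun _ => p) (hf.comp measurable_snd) (hg.comp measurable_snd) measurable_const
  exact h1.comp (f := fun q => ((), q)) measurable_prodMk_left

theorem measurable_gainIntegrand2_right (hb : IsBinaryAngular d b₂) (hf : Measurable f)
    (hg : Measurable g) (p : Phase d) :
    Measurable (gainIntegrand2 γ₂ b₂ f g p) := by
  have h1 : Measurable (fun z : Unit × (Sph d × Vel d) => gainIntegrand2 γ₂ b₂ f g p z.2) :=
    measurable_gainIntegrand2 (X := Unit) hb (F := fun _ => f) (G := fun _ => g)
      (P := fun _ => p) (hf.comp measurable_snd) (hg.comp measurable_snd) measurable_const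
  exact h1.comp (f := fun q => ((), q)) measurable_prodMk_left

theorem measurable_lossIntegrand3_right (hb : IsTernaryAngular d b₃) (hf : Measurable f)
    (hg : Measurable g) (hh : Measurable h) (p : Phase d) :
    Measurable (lossIntegrand3 γ₃ b₃ f g h p) := by
  have h1 : Measurable (fun z : Unit × (Sph2 d × (Vel d × Vel d)) =>
      lossIntegrand3 γ₃ b₃ f g h p z.2) :=
    measurable_lossIntegrand3 (X := Unit) hb (F := fun _ => f) (G := fun _ => g)
      (H := fun _ => h)
      (P := fun _ => p) (hf.comp measurable_snd) (hg.comp measurable_snd)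
      (hh.comp measurable_snd) measurable_const
  exact h1.comp (f := fun q => ((), q)) measurable_prodMk_left

theorem measurable_gainIntegrand3_right (hb : IsTernaryAngular d b₃) (hf : Measurable f)
    (hg : Measurable g) (hh : Measurable h) (p : Phase d) :
    Measurable (gainIntegrand3 γ₃ b₃ f g h p) := by
  have h1 : Measurable (fun z : Unit × (Sph2 d × (Vel d × Vel d)) =>
      gainIntegrand3 γ₃ b₃ f g h p z.2) :=
    measurable_gainIntegrand3 (X := Unit) hb (F := fun _ => f) (G := fun _ => g)
      (H := fun _ => h)
      (P := fun _ => p) (hf.comp measurable_snd) (hg.comp measurable_snd)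
      (hh.comp measurable_snd) measurable_const
  exact h1.comp (f := fun q => ((), q)) measurable_prodMk_left

namespace CollisionSetting

variable (hS : CollisionSetting d γ₂ γ₃ b₂ b₃ α β)
include hS

theorem majorant_nonneg (ha : 0 ≤ a) (p : Phase d) :
    0 ≤ majorant γ₂ γ₃ b₂ b₃ α β a s p :=
  add_nonneg (majorant2_nonneg hS.ang₂ p) (mul_nonneg ha (majorant3_nonneg hS.ang₃ p))

theorem integrable_majorantIntegrand2 (s : ℝ) (p : Phase d) :
    Integrable (lossIntegrand2 γ₂ b₂ (movingMaxwellian α β s) (movingMaxwellian α β s)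
      (p.1 + s • p.2, p.2)) (collMeasure2 d) := by
  obtain ⟨C, -, hC⟩ := exists_lintegral_lossIntegrand2_le hS.two_le hS.ang₂ hS.mem₂ hS.α_pos
    hS.β_pos
  have hM := (dominated_movingMaxwellian (d := d) (α := α) (β := β) (s := s)).measurable
  have hm : Measurable (lossIntegrand2 γ₂ b₂ (movingMaxwellian α β s) (movingMaxwellian α β s)
      (p.1 + s • p.2, p.2)) :=
    measurable_lossIntegrand2_right hS.ang₂ hM hM _
  refine ⟨hm.aestronglyMeasurable, ?_⟩
  have hnn : 0 ≤ᵐ[collMeasure2 d]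
      lossIntegrand2 γ₂ b₂ (movingMaxwellian α β s) (movingMaxwellian α β s)
      (p.1 + s • p.2, p.2) :=
    ae_of_all _ fun q => lossIntegrand2_movingMaxwellian_nonneg hS.ang₂ _ q
  rw [hasFiniteIntegral_iff_ofReal hnn]
  exact (hC s p).trans_lt ENNReal.ofReal_lt_top

theorem integrable_majorantIntegrand3 (s : ℝ) (p : Phase d) :
    Integrable (lossIntegrand3 γ₃ b₃ (movingMaxwellian α β s) (movingMaxwellian α β s)
      (movingMaxwellian α β s) (p.1 + s • p.2, p.2)) (collMeasure3 d) := by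
  obtain ⟨C, -, hC⟩ := exists_lintegral_lossIntegrand3_le hS.two_le hS.ang₃ hS.mem₃ hS.α_pos
    hS.β_pos
  have hM := (dominated_movingMaxwellian (d := d) (α := α) (β := β) (s := s)).measurable
  have hm : Measurable (lossIntegrand3 γ₃ b₃ (movingMaxwellian α β s) (movingMaxwellian α β s)
      (movingMaxwellian α β s) (p.1 + s • p.2, p.2)) :=
    measurable_lossIntegrand3_right hS.ang₃ hM hM hM _
  refine ⟨hm.aestronglyMeasurable, ?_⟩
  have hnn : 0 ≤ᵐ[collMeasure3 d]
      lossIntegrand3 γ₃ b₃ (movingMaxwellian α β s) (movingMaxwellian α β s)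
      (movingMaxwellian α β s)
      (p.1 + s • p.2, p.2) :=
    ae_of_all _ fun q => lossIntegrand3_movingMaxwellian_nonneg hS.ang₃ _ q
  rw [hasFiniteIntegral_iff_ofReal hnn]
  exact (hC s p).trans_lt ENNReal.ofReal_lt_top

theorem ofReal_majorant2 (s : ℝ) (p : Phase d) : ENNReal.ofReal (majorant2 γ₂ b₂ α β s p) =
    ∫⁻ q, ENNReal.ofReal (lossIntegrand2 γ₂ b₂ (movingMaxwellian α β s)
      (movingMaxwellian α β s) (p.1 + s • p.2, p.2) q) ∂(collMeasure2 d) :=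
  ofReal_integral_eq_lintegral_ofReal (hS.integrable_majorantIntegrand2 s p)
    (ae_of_all _ fun _ => lossIntegrand2_movingMaxwellian_nonneg hS.ang₂ _ _)

theorem ofReal_majorant3 (s : ℝ) (p : Phase d) : ENNReal.ofReal (majorant3 γ₃ b₃ α β s p) =
    ∫⁻ q, ENNReal.ofReal (lossIntegrand3 γ₃ b₃ (movingMaxwellian α β s)
      (movingMaxwellian α β s) (movingMaxwellian α β s) (p.1 + s • p.2, p.2) q)
        ∂(collMeasure3 d) :=
  ofReal_integral_eq_lintegral_ofReal (hS.integrable_majorantIntegrand3 s p)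
    (ae_of_all _ fun _ => lossIntegrand3_movingMaxwellian_nonneg hS.ang₃ _ _)

theorem measurable_majorant2 :
    Measurable (fun z : ℝ × Phase d => majorant2 γ₂ b₂ α β z.1 z.2) :=
  ((measurable_lossIntegrand2 (X := ℝ × Phase d) (γ₂ := γ₂) hS.ang₂
    (F := fun z => movingMaxwellian α β z.1) (G := fun z => movingMaxwellian α β z.1)
    (measurable_movingMaxwellian.comp (f := fun z : (ℝ × Phase d) × Phase d => (z.1.1, z.2))
      (by fun_prop))
    (measurable_movingMaxwellian.comp (f := fun z : (ℝ × Phase d) × Phase d => (z.1.1, z.2))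
      (by fun_prop))
    (P := fun z => (z.2.1 + z.1 • z.2.2, z.2.2))
    (by fun_prop)).stronglyMeasurable.integral_prod_right' (ν := collMeasure2 d)).measurable

theorem measurable_majorant3 :
    Measurable (fun z : ℝ × Phase d => majorant3 γ₃ b₃ α β z.1 z.2) :=
  ((measurable_lossIntegrand3 (X := ℝ × Phase d) (γ₃ := γ₃) hS.ang₃
    (F := fun z => movingMaxwellian α β z.1) (G := fun z => movingMaxwellian α β z.1)
    (H := fun z => movingMaxwellian α β z.1)
    (measurable_movingMaxwellian.comp (f := fun z : (ℝ × Phase d) × Phase d => (z.1.1, z.2))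
      (by fun_prop))
    (measurable_movingMaxwellian.comp (f := fun z : (ℝ × Phase d) × Phase d => (z.1.1, z.2))
      (by fun_prop))
    (measurable_movingMaxwellian.comp (f := fun z : (ℝ × Phase d) × Phase d => (z.1.1, z.2))
      (by fun_prop))
    (P := fun z => (z.2.1 + z.1 • z.2.2, z.2.2))
    (by fun_prop)).stronglyMeasurable.integral_prod_right' (ν := collMeasure3 d)).measurable

theorem measurable_majorant (a : ℝ) :
    Measurable (Function.uncurry (majorant γ₂ γ₃ b₂ b₃ α β a : ℝ → Phase d → ℝ)) :=
  hS.measurable_majorant2.add (hS.measurable_majorant3.const_mul a)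

/-- This gives the envelope in phase space, integrable and independent of time, behind all
dominated-integral arguments in `L¹`. -/
theorem exists_majorant_le (ha : 0 ≤ a) : ∃ C : ℝ, 0 ≤ C ∧ ∀ (s : ℝ) (p : Phase d),
    majorant γ₂ γ₃ b₂ b₃ α β a s p ≤ C * maxwellian α (β / 2) p := by
  obtain ⟨C₂, h₂, hC₂⟩ := exists_lintegral_lossIntegrand2_le hS.two_le hS.ang₂ hS.mem₂ hS.α_pos
    hS.β_pos
  obtain ⟨C₃, h₃, hC₃⟩ := exists_lintegral_lossIntegrand3_le hS.two_le hS.ang₃ hS.mem₃ hS.α_pos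
    hS.β_pos
  refine ⟨C₂ + a * C₃, by positivity, fun s p => ?_⟩
  have hM := (maxwellian_pos α (β / 2) p).le
  have e₂ : majorant2 γ₂ b₂ α β s p ≤ C₂ * maxwellian α (β / 2) p := by
    rw [← ENNReal.ofReal_le_ofReal_iff (by positivity), hS.ofReal_majorant2]
    exact hC₂ s p
  have e₃ : majorant3 γ₃ b₃ α β s p ≤ C₃ * maxwellian α (β / 2) p := by
    rw [← ENNReal.ofReal_le_ofReal_iff (by positivity), hS.ofReal_majorant3]
    exact hC₃ s p
  unfold majorant
  nlinarith

/-- The time-integrated bound of the majorant along characteristics. -/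
theorem lintegral_majorant_le (ha : 0 ≤ a) (p : Phase d) :
    ∫⁻ s : ℝ, ENNReal.ofReal (majorant γ₂ γ₃ b₂ b₃ α β a s p) ≤
      ENNReal.ofReal (constK d (collisionConst d) γ₂ γ₃ b₂ b₃ β * α ^ (-(1 / 2) : ℝ) * (1 + a) *
        maxwellian α β p) := by
  have hM := (maxwellian_pos α β p).le
  have h₂ := lintegral_lintegral_lossIntegrand2_le hS.two_le hS.ang₂ hS.mem₂ hS.α_pos hS.β_pos p
  have h₃ := lintegral_lintegral_lossIntegrand3_le hS.two_le hS.ang₃ hS.mem₃ hS.α_pos hS.β_pos p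
  simp_rw [← hS.ofReal_majorant2] at h₂
  simp_rw [← hS.ofReal_majorant3] at h₃
  have hC := collisionConst_pos d
  have hβ := hS.β_pos
  have hα := hS.α_pos
  have hA : 0 < α ^ (-(1 / 2) : ℝ) := by positivity
  have hr₂ : 0 < (d : ℝ) + γ₂ - 1 := by linarith [hS.mem₂.1]
  have hr₃ : 0 < 2 * (d : ℝ) + γ₃ - 1 := by linarith [hS.mem₃.1]
  set k₂ : ℝ := collisionConst d * ((angularNorm2 d b₂).toReal *
      (β ^ (-(d : ℝ) / 2) + 1 / ((d : ℝ) + γ₂ - 1))) with hk₂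
  set k₃ : ℝ := collisionConst d * ((angularNorm3 d b₃).toReal *
      (β ^ (-(d : ℝ)) + 1 / (2 * (d : ℝ) + γ₃ - 1))) with hk₃
  have p₂ : 0 ≤ k₂ := by positivity
  have p₃ : 0 ≤ k₃ := by positivity
  have hK : constK d (collisionConst d) γ₂ γ₃ b₂ b₃ β = k₂ + k₃ := by
    simp only [constK, hk₂, hk₃]; ring
  have hadd : ∀ s : ℝ, ENNReal.ofReal (majorant γ₂ γ₃ b₂ b₃ α β a s p) =
      ENNReal.ofReal (majorant2 γ₂ b₂ α β s p) +
        ENNReal.ofReal a * ENNReal.ofReal (majorant3 γ₃ b₃ α β s p) := fun s => by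
    rw [majorant, ENNReal.ofReal_add (majorant2_nonneg hS.ang₂ p)
      (mul_nonneg ha (majorant3_nonneg hS.ang₃ p)), ENNReal.ofReal_mul ha]
  simp_rw [hadd]
  have hm₂ : Measurable (fun s : ℝ => ENNReal.ofReal (majorant2 γ₂ b₂ α β s p)) :=
    (hS.measurable_majorant2.comp (measurable_prodMk_right (y := p))).ennreal_ofReal
  rw [lintegral_add_left hm₂, lintegral_const_mul' _ _ ENNReal.ofReal_ne_top]
  calc _ ≤ ENNReal.ofReal (k₂ * α ^ (-(1 / 2) : ℝ) * maxwellian α β p) +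
        ENNReal.ofReal a * ENNReal.ofReal (k₃ * α ^ (-(1 / 2) : ℝ) * maxwellian α β p) := by
        gcongr
    _ = ENNReal.ofReal (k₂ * α ^ (-(1 / 2) : ℝ) * maxwellian α β p +
          a * (k₃ * α ^ (-(1 / 2) : ℝ) * maxwellian α β p)) := by
        rw [← ENNReal.ofReal_mul ha, ← ENNReal.ofReal_add (by positivity) (by positivity)]
    _ ≤ _ := by
        apply ENNReal.ofReal_le_ofReal
        rw [hK]
        -- The cross terms `k₃ + a k₂` are given away in order to obtain the single constant `K (1 +
        -- a)`.
        have e : (k₂ + k₃) * α ^ (-(1 / 2) : ℝ) * (1 + a) * maxwellian α β p -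
            (k₂ * α ^ (-(1 / 2) : ℝ) * maxwellian α β p +
              a * (k₃ * α ^ (-(1 / 2) : ℝ) * maxwellian α β p)) =
            (k₃ + a * k₂) * (α ^ (-(1 / 2) : ℝ) * maxwellian α β p) := by ring
        have : 0 ≤ (k₃ + a * k₂) * (α ^ (-(1 / 2) : ℝ) * maxwellian α β p) := by positivity
        linarith

theorem constK_nonneg : 0 ≤ constK d (collisionConst d) γ₂ γ₃ b₂ b₃ β := by
  have hC := collisionConst_pos d
  have hβ := hS.β_pos
  have hr₂ : 0 < (d : ℝ) + γ₂ - 1 := by linarith [hS.mem₂.1]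
  have hr₃ : 0 < 2 * (d : ℝ) + γ₃ - 1 := by linarith [hS.mem₃.1]
  unfold constK
  positivity

theorem integrable_majorant (ha : 0 ≤ a) (p : Phase d) :
    Integrable (fun s => majorant γ₂ γ₃ b₂ b₃ α β a s p) volume := by
  refine ⟨((hS.measurable_majorant a).comp
    (measurable_prodMk_right (y := p))).aestronglyMeasurable, ?_⟩
  rw [hasFiniteIntegral_iff_ofReal (ae_of_all _ fun s => hS.majorant_nonneg ha p)]
  exact (hS.lintegral_majorant_le ha p).trans_lt ENNReal.ofReal_lt_top

theorem integral_majorant_le (ha : 0 ≤ a) (p : Phase d) :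
    ∫ s : ℝ, majorant γ₂ γ₃ b₂ b₃ α β a s p ≤
      constK d (collisionConst d) γ₂ γ₃ b₂ b₃ β * α ^ (-(1 / 2) : ℝ) * (1 + a) *
        maxwellian α β p := by
  have hM := (maxwellian_pos α β p).le
  have hK := hS.constK_nonneg
  have hα := hS.α_pos
  rw [← ENNReal.ofReal_le_ofReal_iff (by positivity),
    ofReal_integral_eq_lintegral_ofReal (hS.integrable_majorant ha p)
      (ae_of_all _ fun s => hS.majorant_nonneg ha p)]
  exact hS.lintegral_majorant_le ha p

/-- A bound on the integrand is the difference estimate taken against the zero function. -/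
theorem integrable_gainIntegrand2 (hf : Dominated α β a s f) (hg : Dominated α β a s g)
    (p : Phase d) : Integrable (gainIntegrand2 γ₂ b₂ f g (p.1 + s • p.2, p.2))
      (collMeasure2 d) := by
  refine ((hS.integrable_majorantIntegrand2 s p).const_mul (2 * a * a)).mono'
    (measurable_gainIntegrand2_right hS.ang₂ hf.measurable hg.measurable _).aestronglyMeasurable
    (ae_of_all _ fun q => ?_)
  have h0 := dominated_zero (d := d) (α := α) (β := β) (s := s) hf.nonneg
  have := abs_gainIntegrand2_sub_le (γ₂ := γ₂) (g' := fun _ => 0) hS.ang₂ hf.nonneg h0.le hg.le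
    (by simpa using hf.le) (by simpa using hg.le) (p.1 + s • p.2, p.2) q
  simpa [gainIntegrand2] using this

theorem integrable_lossIntegrand2 (hf : Dominated α β a s f) (hg : Dominated α β a s g)
    (p : Phase d) : Integrable (lossIntegrand2 γ₂ b₂ f g (p.1 + s • p.2, p.2))
      (collMeasure2 d) := by
  refine ((hS.integrable_majorantIntegrand2 s p).const_mul (2 * a * a)).mono'
    (measurable_lossIntegrand2_right hS.ang₂ hf.measurable hg.measurable _).aestronglyMeasurable
    (ae_of_all _ fun q => ?_)
  have h0 := dominated_zero (d := d) (α := α) (β := β) (s := s) hf.nonneg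
  have := abs_lossIntegrand2_sub_le (γ₂ := γ₂) (g' := fun _ => 0) hS.ang₂ hf.nonneg h0.le hg.le
    (by simpa using hf.le) (by simpa using hg.le) (p.1 + s • p.2, p.2) q
  simpa [lossIntegrand2] using this

theorem integrable_gainIntegrand3 (hf : Dominated α β a s f) (hg : Dominated α β a s g)
    (hh : Dominated α β a s h) (p : Phase d) :
    Integrable (gainIntegrand3 γ₃ b₃ f g h (p.1 + s • p.2, p.2)) (collMeasure3 d) := by
  refine ((hS.integrable_majorantIntegrand3 s p).const_mul (3 * a ^ 2 * a)).mono'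
    (measurable_gainIntegrand3_right hS.ang₃ hf.measurable hg.measurable hh.measurable
      _).aestronglyMeasurable
    (ae_of_all _ fun q => ?_)
  have h0 := dominated_zero (d := d) (α := α) (β := β) (s := s) hf.nonneg
  have := abs_gainIntegrand3_sub_le (γ₃ := γ₃) (h' := fun _ => 0) hS.ang₃ hf.nonneg h0.le hg.le
    h0.le hh.le (by simpa using hf.le) (by simpa using hg.le) (by simpa using hh.le)
    (p.1 + s • p.2, p.2) q
  simpa [gainIntegrand3] using this

theorem integrable_lossIntegrand3 (hf : Dominated α β a s f) (hg : Dominated α β a s g)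
    (hh : Dominated α β a s h) (p : Phase d) :
    Integrable (lossIntegrand3 γ₃ b₃ f g h (p.1 + s • p.2, p.2)) (collMeasure3 d) := by
  refine ((hS.integrable_majorantIntegrand3 s p).const_mul (3 * a ^ 2 * a)).mono'
    (measurable_lossIntegrand3_right hS.ang₃ hf.measurable hg.measurable hh.measurable
      _).aestronglyMeasurable
    (ae_of_all _ fun q => ?_)
  have h0 := dominated_zero (d := d) (α := α) (β := β) (s := s) hf.nonneg
  have := abs_lossIntegrand3_sub_le (γ₃ := γ₃) (h' := fun _ => 0) hS.ang₃ hf.nonneg h0.le hg.le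
    h0.le hh.le (by simpa using hf.le) (by simpa using hg.le) (by simpa using hh.le)
    (p.1 + s • p.2, p.2) q
  simpa [lossIntegrand3] using this

/-- The binary part contributes `2aδ` and the ternary part `3a²δ`. The weight `a` inside `majorant`
is what allows a common factor `3aδ`. -/
theorem abs_gain_sub_le (hf : Dominated α β a s f) (hf' : Dominated α β a s f')
    (hg : Dominated α β a s g) (hg' : Dominated α β a s g') (hh : Dominated α β a s h)
    (hh' : Dominated α β a s h') (hδ : 0 ≤ δ)
    (hff : ∀ q, |f q - f' q| ≤ δ * movingMaxwellian α β s q)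
    (hgg : ∀ q, |g q - g' q| ≤ δ * movingMaxwellian α β s q)
    (hhh : ∀ q, |h q - h' q| ≤ δ * movingMaxwellian α β s q) (p : Phase d) :
    |gain γ₂ γ₃ b₂ b₃ f g h (p.1 + s • p.2, p.2) -
        gain γ₂ γ₃ b₂ b₃ f' g' h' (p.1 + s • p.2, p.2)| ≤
      3 * a * δ * majorant γ₂ γ₃ b₂ b₃ α β a s p := by
  have ha := hf.nonneg
  have m₂ := majorant2_nonneg (γ₂ := γ₂) (α := α) (β := β) (s := s) hS.ang₂ p
  have e₂ : |(∫ q, gainIntegrand2 γ₂ b₂ f g (p.1 + s • p.2, p.2) q ∂(collMeasure2 d)) -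
      ∫ q, gainIntegrand2 γ₂ b₂ f' g' (p.1 + s • p.2, p.2) q ∂(collMeasure2 d)| ≤
      2 * a * δ * majorant2 γ₂ b₂ α β s p := by
    rw [← integral_sub (hS.integrable_gainIntegrand2 hf hg p)
      (hS.integrable_gainIntegrand2 hf' hg' p), majorant2, ← integral_const_mul,
      ← Real.norm_eq_abs]
    exact norm_integral_le_of_norm_le ((hS.integrable_majorantIntegrand2 s p).const_mul _)
      (ae_of_all _ fun q => abs_gainIntegrand2_sub_le hS.ang₂ ha hf'.le hg.le hff hgg _ q)
  have e₃ : |(∫ q, gainIntegrand3 γ₃ b₃ f g h (p.1 + s • p.2, p.2) q ∂(collMeasure3 d)) -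
      ∫ q, gainIntegrand3 γ₃ b₃ f' g' h' (p.1 + s • p.2, p.2) q ∂(collMeasure3 d)| ≤
      3 * a ^ 2 * δ * majorant3 γ₃ b₃ α β s p := by
    rw [← integral_sub (hS.integrable_gainIntegrand3 hf hg hh p)
      (hS.integrable_gainIntegrand3 hf' hg' hh' p), majorant3, ← integral_const_mul,
      ← Real.norm_eq_abs]
    exact norm_integral_le_of_norm_le ((hS.integrable_majorantIntegrand3 s p).const_mul _)
      (ae_of_all _ fun q => abs_gainIntegrand3_sub_le hS.ang₃ ha hf'.le hg.le hg'.le hh.le hff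
        hgg hhh _ q)
  unfold gain majorant
  rw [add_sub_add_comm]
  refine (abs_add_le _ _).trans ((add_le_add e₂ e₃).trans ?_)
  have : 0 ≤ a * δ * majorant2 γ₂ b₂ α β s p := by positivity
  linarith

theorem abs_loss_sub_le (hf : Dominated α β a s f) (hf' : Dominated α β a s f')
    (hg : Dominated α β a s g) (hg' : Dominated α β a s g') (hh : Dominated α β a s h)
    (hh' : Dominated α β a s h') (hδ : 0 ≤ δ)
    (hff : ∀ q, |f q - f' q| ≤ δ * movingMaxwellian α β s q)
    (hgg : ∀ q, |g q - g' q| ≤ δ * movingMaxwellian α β s q)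
    (hhh : ∀ q, |h q - h' q| ≤ δ * movingMaxwellian α β s q) (p : Phase d) :
    |loss γ₂ γ₃ b₂ b₃ f g h (p.1 + s • p.2, p.2) -
        loss γ₂ γ₃ b₂ b₃ f' g' h' (p.1 + s • p.2, p.2)| ≤
      3 * a * δ * majorant γ₂ γ₃ b₂ b₃ α β a s p := by
  have ha := hf.nonneg
  have m₂ := majorant2_nonneg (γ₂ := γ₂) (α := α) (β := β) (s := s) hS.ang₂ p
  have e₂ : |(∫ q, lossIntegrand2 γ₂ b₂ f g (p.1 + s • p.2, p.2) q ∂(collMeasure2 d)) -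
      ∫ q, lossIntegrand2 γ₂ b₂ f' g' (p.1 + s • p.2, p.2) q ∂(collMeasure2 d)| ≤
      2 * a * δ * majorant2 γ₂ b₂ α β s p := by
    rw [← integral_sub (hS.integrable_lossIntegrand2 hf hg p)
      (hS.integrable_lossIntegrand2 hf' hg' p), majorant2, ← integral_const_mul,
      ← Real.norm_eq_abs]
    exact norm_integral_le_of_norm_le ((hS.integrable_majorantIntegrand2 s p).const_mul _)
      (ae_of_all _ fun q => abs_lossIntegrand2_sub_le hS.ang₂ ha hf'.le hg.le hff hgg _ q)
  have e₃ : |(∫ q, lossIntegrand3 γ₃ b₃ f g h (p.1 + s • p.2, p.2) q ∂(collMeasure3 d)) -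
      ∫ q, lossIntegrand3 γ₃ b₃ f' g' h' (p.1 + s • p.2, p.2) q ∂(collMeasure3 d)| ≤
      3 * a ^ 2 * δ * majorant3 γ₃ b₃ α β s p := by
    rw [← integral_sub (hS.integrable_lossIntegrand3 hf hg hh p)
      (hS.integrable_lossIntegrand3 hf' hg' hh' p), majorant3, ← integral_const_mul,
      ← Real.norm_eq_abs]
    exact norm_integral_le_of_norm_le ((hS.integrable_majorantIntegrand3 s p).const_mul _)
      (ae_of_all _ fun q => abs_lossIntegrand3_sub_le hS.ang₃ ha hf'.le hg.le hg'.le hh.le hff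
        hgg hhh _ q)
  unfold loss majorant
  rw [add_sub_add_comm]
  refine (abs_add_le _ _).trans ((add_le_add e₂ e₃).trans ?_)
  have : 0 ≤ a * δ * majorant2 γ₂ b₂ α β s p := by positivity
  linarith

end CollisionSetting

end Operators

/-! ### Time-dependent functions with values in `L¹` -/

section L1

variable {d : ℕ}

theorem toL1_of_integrable {f : Phase d → ℝ} (hf : Integrable f volume) : toL1 f = hf.toL1 f :=
  dif_pos hf

theorem coeFn_toL1 {f : Phase d → ℝ} (hf : Integrable f volume) : toL1 f =ᵐ[volume] f := by
  rw [toL1_of_integrable hf]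
  exact hf.coeFn_toL1

theorem toL1_congr {f g : Phase d → ℝ} (h : f =ᵐ[volume] g) : toL1 f = toL1 g := by
  by_cases hf : Integrable f volume
  · rw [toL1_of_integrable hf, toL1_of_integrable (hf.congr h)]
    exact (Integrable.toL1_eq_toL1_iff _ _ _ _).2 h
  · have hg : ¬ Integrable g volume := fun hg => hf (hg.congr h.symm)
    simp only [toL1, dif_neg hf, dif_neg hg]

theorem toL1_sub {f g : Phase d → ℝ} (hf : Integrable f volume) (hg : Integrable g volume) :
    toL1 (fun p => f p - g p) = toL1 f - toL1 g := by
  rw [toL1_of_integrable hf, toL1_of_integrable hg, ← Integrable.toL1_sub]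
  exact toL1_of_integrable (hf.sub hg)

theorem toL1_add {f g : Phase d → ℝ} (hf : Integrable f volume) (hg : Integrable g volume) :
    toL1 (fun p => f p + g p) = toL1 f + toL1 g := by
  rw [toL1_of_integrable hf, toL1_of_integrable hg, ← Integrable.toL1_add]
  exact toL1_of_integrable (hf.add hg)

theorem norm_toL1_le {f h : Phase d → ℝ} (hf : Integrable f volume) (hh : Integrable h volume)
    (hle : ∀ᵐ p, |f p| ≤ h p) : ‖toL1 f‖ ≤ ∫ p, h p := by
  rw [toL1_of_integrable hf, L1.norm_eq_integral_norm]
  calc ∫ p, ‖hf.toL1 f p‖ = ∫ p, ‖f p‖ := by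
        refine integral_congr_ae ?_
        filter_upwards [hf.coeFn_toL1] with p hp
        rw [hp]
    _ ≤ ∫ p, h p := integral_mono_ae hf.norm hh hle

theorem toL1_le_toL1 {f g : Phase d → ℝ} (hf : Integrable f volume) (hg : Integrable g volume)
    (h : f ≤ᵐ[volume] g) : toL1 f ≤ toL1 g := by
  rw [← Lp.coeFn_le]
  filter_upwards [coeFn_toL1 hf, coeFn_toL1 hg, h] with p h1 h2 h3
  rwa [h1, h2]

theorem ae_le_of_toL1_le {f g : Phase d → ℝ} (hf : Integrable f volume)
    (hg : Integrable g volume) (h : toL1 f ≤ toL1 g) : f ≤ᵐ[volume] g := by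
  rw [← Lp.coeFn_le] at h
  filter_upwards [coeFn_toL1 hf, coeFn_toL1 hg, h] with p h1 h2 h3
  rwa [h1, h2] at h3

/-- A jointly measurable function with integrable slices is strongly measurable in time as a
function with values in `L¹`. -/
theorem stronglyMeasurable_toL1 {G : ℝ → Phase d → ℝ} (hG : Measurable (Function.uncurry G))
    (hi : ∀ t, Integrable (G t) volume) : StronglyMeasurable (fun t => toL1 (G t)) := by
  let _ : MeasurableSpace (Phase d →₁[volume] ℝ) := borel _
  have hBorel : BorelSpace (Phase d →₁[volume] ℝ) := ⟨rfl⟩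
  have : Fact ((1 : ℝ≥0∞) ≠ ∞) := ⟨ENNReal.one_ne_top⟩
  have hcg : MeasurableSpace.CountablyGenerated (Phase d) := inferInstance
  have hsf : SFinite (volume : Measure (Phase d)) := inferInstance
  have hsep : MeasureTheory.IsSeparable (volume : Measure (Phase d)) := inferInstance
  have hsc : SecondCountableTopology (Phase d →₁[volume] ℝ) := inferInstance
  refine Measurable.stronglyMeasurable ?_
  -- Since this `L¹` is second countable, its balls generate the Borel sets. Only distances to a
  -- fixed `g` have to be measurable, and these are integrals over phase space.
  have hB : TopologicalSpace.IsTopologicalBasis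
      {U : Set (Phase d →₁[volume] ℝ) | ∃ x, ∃ r : ℝ, U = ball x r} := by
    refine TopologicalSpace.isTopologicalBasis_of_isOpen_of_nhds ?_ ?_
    · rintro U ⟨x, r, rfl⟩
      exact isOpen_ball
    · intro x U hx hU
      obtain ⟨r, hr, hrU⟩ := Metric.isOpen_iff.1 hU x hx
      exact ⟨ball x r, ⟨x, r, rfl⟩, mem_ball_self hr, hrU⟩
  rw [hBorel.measurable_eq, hB.borel_eq_generateFrom]
  refine measurable_generateFrom ?_
  rintro U ⟨g, r, rfl⟩
  have hd : Measurable (fun t => edist (toL1 (G t)) g) := by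
    have : (fun t => edist (toL1 (G t)) g) = fun t => ∫⁻ p, edist (G t p) (g p) := by
      funext t
      rw [toL1_of_integrable (hi t)]
      conv_lhs => rw [← Integrable.toL1_coeFn g (L1.integrable_coeFn g)]
      exact Integrable.edist_toL1_toL1 _ _ _ _
    rw [this]
    have hg : Measurable g := (Lp.stronglyMeasurable g).measurable
    exact Measurable.lintegral_prod_right' (f := fun z : ℝ × Phase d => edist (G z.1 z.2) (g z.2))
      (hG.edist (hg.comp measurable_snd))
  have : (fun t => toL1 (G t)) ⁻¹' ball g r = {t | edist (toL1 (G t)) g < ENNReal.ofReal r} := by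
    ext t
    rw [mem_preimage, ← Metric.eball_ofReal]
    rfl
  rw [this]
  exact measurableSet_lt hd measurable_const

theorem integrable_uncurry_of_le {W : ℝ → Phase d → ℝ} {h : Phase d → ℝ}
    (hW : Measurable (Function.uncurry W)) (hh : Integrable h volume)
    (hle : ∀ s p, |W s p| ≤ h p) (A : Set ℝ) [IsFiniteMeasure (volume.restrict A)] :
    Integrable (Function.uncurry W) ((volume.restrict A).prod volume) :=
  (hh.comp_snd (volume.restrict A)).mono' hW.aestronglyMeasurable
    (ae_of_all _ fun z => hle z.1 z.2)

theorem integrable_slice_of_le {W : ℝ → Phase d → ℝ} {h : Phase d → ℝ}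
    (hW : Measurable (Function.uncurry W)) (hh : Integrable h volume)
    (hle : ∀ s p, |W s p| ≤ h p) (s : ℝ) : Integrable (W s) volume :=
  hh.mono' hW.of_uncurry_left.aestronglyMeasurable (ae_of_all _ (hle s))

/-- The Bochner integral in `L¹` of a jointly measurable dominated function is the pointwise
integral. -/
theorem toL1_setIntegral {W : ℝ → Phase d → ℝ} {h : Phase d → ℝ}
    (hW : Measurable (Function.uncurry W)) (hh : Integrable h volume)
    (hle : ∀ s p, |W s p| ≤ h p) (A : Set ℝ) [IsFiniteMeasure (volume.restrict A)] :
    Integrable (fun p => ∫ s in A, W s p) volume ∧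
      IntegrableOn (fun s => toL1 (W s)) A volume ∧
      toL1 (fun p => ∫ s in A, W s p) = ∫ s in A, toL1 (W s) := by
  have hi := integrable_slice_of_le hW hh hle
  have hprod := integrable_uncurry_of_le hW hh hle A
  have hK : Integrable (fun p => ∫ s in A, W s p) volume := hprod.integral_prod_right
  have hI : IntegrableOn (fun s => toL1 (W s)) A volume := by
    refine (integrable_const (μ := volume.restrict A) (∫ p, h p)).mono'
      (stronglyMeasurable_toL1 hW hi).aestronglyMeasurable (ae_of_all _ fun s => ?_)
    exact norm_toL1_le (hi s) hh (ae_of_all _ (hle s))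
  refine ⟨hK, hI, ?_⟩
  apply Lp.ext
  refine (coeFn_toL1 hK).trans ?_
  refine Integrable.ae_eq_of_forall_setIntegral_eq _ _ hK (L1.integrable_coeFn _) fun S hS _ => ?_
  -- Both sides are compared through their integrals over every measurable `S`. The functional `f ↦
  -- ∫_S f` is continuous, hence commutes with the Bochner integral, and Fubini does the rest.
  let ℓ : (Phase d →₁[volume] ℝ) →L[ℝ] ℝ :=
    (L1.integralCLM (μ := volume.restrict S)).comp
      (LpToLpRestrictCLM (Phase d) ℝ ℝ volume 1 S)
  have hℓ : ∀ f : Phase d →₁[volume] ℝ, ℓ f = ∫ p in S, f p := fun f => by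
    change L1.integralCLM (LpToLpRestrictCLM (Phase d) ℝ ℝ volume 1 S f) = _
    rw [← L1.integral_eq, L1.integral_eq_integral]
    exact integral_congr_ae (LpToLpRestrictCLM_coeFn ℝ S f)
  rw [← hℓ, ← ℓ.integral_comp_comm hI]
  have hsw : ∫ p in S, ∫ s in A, W s p = ∫ s in A, ∫ p in S, W s p := by
    have : Integrable (Function.uncurry W) ((volume.restrict A).prod (volume.restrict S)) := by
      refine hprod.mono_measure ?_
      exact Measure.prod_mono le_rfl Measure.restrict_le_self
    exact (integral_integral_swap this).symm
  rw [hsw]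
  refine integral_congr_ae (ae_of_all _ fun s => ?_)
  simp only [hℓ]
  exact integral_congr_ae (ae_restrict_of_ae (coeFn_toL1 (hi s)).symm)

end L1

/-! ### Weak derivatives in time -/

section Weak

variable {X : Type*} [NormedAddCommGroup X] [NormedSpace ℝ X]

theorem timeInterval_mem_of_le {T : EReal} {s t : ℝ} (hs : 0 ≤ s) (hst : s ≤ t)
    (ht : t ∈ timeInterval T) : s ∈ timeInterval T :=
  ⟨hs, (EReal.coe_le_coe_iff.2 hst).trans_lt ht.2⟩

theorem isOpen_openTime (T : EReal) : IsOpen {t : ℝ | 0 < t ∧ (t : EReal) < T} :=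
  (isOpen_lt continuous_const continuous_id).inter
    (isOpen_lt continuous_coe_real_ereal continuous_const)

theorem exists_Icc_of_isCompact {T : EReal} {K : Set ℝ} (hK : IsCompact K) (hne : K.Nonempty)
    (hKT : K ⊆ {t : ℝ | 0 < t ∧ (t : EReal) < T}) :
    ∃ a b : ℝ, 0 < a ∧ (b : EReal) < T ∧ K ⊆ Icc a b :=
  ⟨sInf K, sSup K, (hKT (hK.sInf_mem hne)).1, (hKT (hK.sSup_mem hne)).2,
    fun _ hx => ⟨csInf_le hK.bddBelow hx, le_csSup hK.bddAbove hx⟩⟩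

/-- A primitive is weakly differentiable. -/
theorem integral_deriv_smul_primitive [CompleteSpace X] {T : EReal} {u w : ℝ → X} {u₀ : X}
    (hw : ∀ t ∈ timeInterval T, IntegrableOn w (Ioc 0 t) volume)
    (hu : ∀ t ∈ timeInterval T, u t = u₀ + ∫ s in Ioc 0 t, w s) {φ : ℝ → ℝ}
    (hφ : ContDiff ℝ (⊤ : ℕ∞) φ) (hc : HasCompactSupport φ)
    (hs : tsupport φ ⊆ {t : ℝ | 0 < t ∧ (t : EReal) < T}) :
    ∫ t, deriv φ t • u t = -∫ t, φ t • w t := by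
  by_cases hne : (tsupport φ).Nonempty
  swap
  · have h0 : φ = 0 := tsupport_eq_empty_iff.1 (not_nonempty_iff_eq_empty.1 hne)
    subst h0
    simp
  obtain ⟨a, b', ha, hb', hab⟩ := exists_Icc_of_isCompact hc hne hs
  -- The endpoint `b` is taken strictly beyond the support, so that `φ b = 0`.
  obtain ⟨b, hb'b, hbT⟩ := EReal.lt_iff_exists_real_btwn.1 hb'
  have hb'b : b' < b := EReal.coe_lt_coe_iff.1 hb'b
  obtain ⟨x₀, hx₀⟩ := hne
  have hab' : a ≤ b' := (hab hx₀).1.trans (hab hx₀).2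
  have hb0 : 0 ≤ b := by linarith
  have hbmem : b ∈ timeInterval T := ⟨hb0, hbT⟩
  have hout : ∀ t, t ∉ Ioo 0 b → t ∉ tsupport φ := fun t ht h =>
    ht ⟨ha.trans_le (hab h).1, (hab h).2.trans_lt hb'b⟩
  have hφ0 : ∀ t, t ∉ Ioo 0 b → φ t = 0 := fun t ht => image_eq_zero_of_notMem_tsupport (hout t ht)
  have hφ'0 : ∀ t, t ∉ Ioo 0 b → deriv φ t = 0 := fun t ht => by
    have : t ∉ tsupport (deriv φ) := fun h => hout t ht (tsupport_deriv_subset h)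
    exact image_eq_zero_of_notMem_tsupport this
  have hφd : Differentiable ℝ φ := hφ.differentiable (by simp)
  have hφ'c : Continuous (deriv φ) := hφ.continuous_deriv (by simp)
  have hφ'i : Integrable (deriv φ) volume :=
    hφ'c.integrable_of_hasCompactSupport hc.deriv
  have hFTC : ∀ s ∈ Icc 0 b, ∫ t in Ioc s b, deriv φ t = -φ s := fun s hs => by
    rw [← intervalIntegral.integral_of_le hs.2, intervalIntegral.integral_deriv_eq_sub
      (fun x _ => hφd x) (hφ'c.intervalIntegrable _ _), hφ0 b (fun h => lt_irrefl _ h.2), zero_sub]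
  have e1 : ∫ t, deriv φ t • u t = ∫ t in Ioc 0 b, deriv φ t • u t := by
    symm
    refine setIntegral_eq_integral_of_forall_compl_eq_zero fun t ht => ?_
    rw [hφ'0 t (fun h => ht (Ioo_subset_Ioc_self h)), zero_smul]
  have e2 : ∫ t, φ t • w t = ∫ t in Ioc 0 b, φ t • w t := by
    symm
    refine setIntegral_eq_integral_of_forall_compl_eq_zero fun t ht => ?_
    rw [hφ0 t (fun h => ht (Ioo_subset_Ioc_self h)), zero_smul]
  set μ := (volume : Measure ℝ).restrict (Ioc 0 b) with hμ
  have hwi : Integrable w μ := hw b hbmem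
  have hφ'μ : Integrable (deriv φ) μ := hφ'i.restrict
  have hS : MeasurableSet {z : ℝ × ℝ | z.2 ≤ z.1} := measurableSet_le measurable_snd measurable_fst
  -- The kernel on the triangle `s ≤ t`. Integrating in `s` first gives the primitive of `w`,
  -- integrating in `t` first gives `-φ s`; Fubini equates the two.
  set k : ℝ → ℝ → X := fun t s =>
    ({z : ℝ × ℝ | z.2 ≤ z.1}.indicator (fun z => deriv φ z.1 • w z.2)) (t, s) with hk
  have hki : Integrable (Function.uncurry k) (μ.prod μ) :=
    (hφ'μ.smul_prod hwi).indicator hS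
  have e3 : ∀ t ∈ Ioc 0 b, ∫ s, k t s ∂μ = deriv φ t • ∫ s in Ioc 0 t, w s := fun t ht => by
    rw [← integral_smul]
    have : (fun s => k t s) = (Iic t).indicator (fun s => deriv φ t • w s) := by
      funext s
      simp only [hk, indicator, mem_ofPred_eq, mem_Iic]
    rw [this, integral_indicator measurableSet_Iic, hμ, Measure.restrict_restrict measurableSet_Iic]
    congr 2
    ext s
    simp only [mem_inter_iff, mem_Iic, mem_Ioc]
    exact ⟨fun h => ⟨h.2.1, h.1⟩, fun h => ⟨h.2, h.1, h.2.trans ht.2⟩⟩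
  have e4 : ∀ s ∈ Ioc 0 b, ∫ t, k t s ∂μ = -(φ s • w s) := fun s hs => by
    have : (fun t => k t s) = (Ici s).indicator (fun t => deriv φ t • w s) := by
      funext t
      simp only [hk, indicator, mem_ofPred_eq, mem_Ici]
    rw [this, integral_indicator measurableSet_Ici, integral_smul_const, hμ,
      Measure.restrict_restrict measurableSet_Ici]
    have : Ici s ∩ Ioc 0 b = Icc s b := by
      ext t
      simp only [mem_inter_iff, mem_Ici, mem_Ioc, mem_Icc]
      exact ⟨fun h => ⟨h.1, h.2.2⟩, fun h => ⟨h.1, hs.1.trans_le h.1, h.2⟩⟩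
    rw [this, integral_Icc_eq_integral_Ioc, hFTC s ⟨hs.1.le, hs.2⟩, neg_smul]
  have e5 : ∫ t, deriv φ t • u t ∂μ = ∫ t, deriv φ t • u₀ ∂μ + ∫ t, ∫ s, k t s ∂μ ∂μ := by
    have hki' : Integrable (fun t => ∫ s, k t s ∂μ) μ := hki.integral_prod_left
    rw [← integral_add (hφ'μ.smul_const u₀) hki']
    refine setIntegral_congr_fun measurableSet_Ioc fun t ht => ?_
    change deriv φ t • u t = deriv φ t • u₀ + ∫ s, k t s ∂μ
    rw [e3 t ht, ← smul_add, hu t (timeInterval_mem_of_le ht.1.le ht.2 hbmem)]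
  rw [e1, e2, e5, integral_smul_const, hFTC 0 ⟨le_rfl, hb0⟩, hφ0 0 (fun h => lt_irrefl _ h.1),
    neg_zero, zero_smul, zero_add, integral_integral_swap hki, ← integral_neg]
  exact setIntegral_congr_fun measurableSet_Ioc fun s hs => e4 s hs

/-- A continuous function with a weak derivative is a primitive of it. -/
theorem eq_add_integral_of_hasWeakTimeDeriv [CompleteSpace X] {T : EReal} {u w : ℝ → X}
    (hT : 0 < T) (hu : ContinuousOn u (timeInterval T)) (h : HasWeakTimeDeriv T u w) {t : ℝ}
    (ht : t ∈ timeInterval T) : u t = u 0 + ∫ s in Ioc 0 t, w s := by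
  obtain ⟨-, hwl, hweak⟩ := h
  have hwI : ∀ t ∈ timeInterval T, IntegrableOn w (Icc 0 t) volume := fun t ht =>
    hwl.integrableOn_compact_subset (fun s hs => timeInterval_mem_of_le hs.1 hs.2 ht) isCompact_Icc
  have hw : ∀ t ∈ timeInterval T, IntegrableOn w (Ioc 0 t) volume := fun t ht =>
    (hwI t ht).mono_set Ioc_subset_Icc_self
  set U : Set ℝ := {t : ℝ | 0 < t ∧ (t : EReal) < T} with hU
  have hUo : IsOpen U := isOpen_openTime T
  have hUT : U ⊆ timeInterval T := fun t ht => ⟨ht.1.le, ht.2⟩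
  set P : ℝ → X := fun t => ∫ s in Ioc 0 t, w s with hP
  have hPc : ContinuousOn P (timeInterval T) := by
    intro t ht
    obtain ⟨b, htb, hbT⟩ := EReal.lt_iff_exists_real_btwn.1 ht.2
    have htb : t < b := EReal.coe_lt_coe_iff.1 htb
    have hb : b ∈ timeInterval T := ⟨ht.1.trans htb.le, hbT⟩
    have hc := intervalIntegral.continuousOn_primitive (hwI b hb)
    have hc' := hc t ⟨ht.1, htb.le⟩
    refine hc'.mono_of_mem_nhdsWithin ?_
    have : Icc 0 b ∈ nhdsWithin t (Ici 0) := by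
      rw [← Ici_inter_Iic]
      exact Filter.inter_mem self_mem_nhdsWithin (mem_nhdsWithin_of_mem_nhds (Iic_mem_nhds htb))
    exact nhdsWithin_mono t (fun s hs => hs.1) this
  set z : ℝ → X := fun t => u t - P t with hz
  have hzc : ContinuousOn z (timeInterval T) := hu.sub hPc
  have hzl : LocallyIntegrableOn z U volume :=
    (hzc.mono hUT).locallyIntegrableOn hUo.measurableSet
  have hint : ∀ {v : ℝ → X}, ContinuousOn v (timeInterval T) → ∀ {g : ℝ → ℝ}, Continuous g →
      HasCompactSupport g → tsupport g ⊆ U → Integrable (fun t => g t • v t) volume := by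
    intro v hv g hg hgc hgs
    have hi : IntegrableOn (fun t => g t • v t) (tsupport g) volume :=
      ContinuousOn.integrableOn_compact hgc
        (hg.continuousOn.smul (hv.mono (hgs.trans hUT)))
    rw [← integrableOn_iff_integrable_of_support_subset (s := tsupport g)]
    · exact hi
    · intro t ht
      by_contra hn
      exact ht (by simp [image_eq_zero_of_notMem_tsupport hn])
  have hz0 : ∀ φ : ℝ → ℝ, ContDiff ℝ (⊤ : ℕ∞) φ → HasCompactSupport φ → tsupport φ ⊆ U →
      ∫ t, deriv φ t • z t = 0 := by
    intro φ hφ hc hs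
    have h1 := hweak φ hφ hc hs
    have h2 := integral_deriv_smul_primitive (u := P) (u₀ := 0) hw
      (fun t _ => by rw [zero_add]) hφ hc hs
    have hs' : tsupport (deriv φ) ⊆ U := tsupport_deriv_subset.trans hs
    have hφ' : Continuous (deriv φ) := hφ.continuous_deriv (by simp)
    simp only [hz, smul_sub]
    rw [integral_sub (hint hu hφ' hc.deriv hs') (hint hPc hφ' hc.deriv hs'), h1, h2, sub_self]
  -- A normalised bump function.
  obtain ⟨t₀, ht₀⟩ : U.Nonempty := by
    obtain ⟨b, hb0, hbT⟩ := EReal.lt_iff_exists_real_btwn.1 hT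
    exact ⟨b, by exact_mod_cast hb0, hbT⟩
  obtain ⟨r, hr, hrU⟩ := Metric.isOpen_iff.1 hUo t₀ ht₀
  let ρ : ContDiffBump t₀ := ⟨r / 4, r / 2, by positivity, by linarith⟩
  set η : ℝ → ℝ := ρ.normed volume with hη
  have hηd : ContDiff ℝ (⊤ : ℕ∞) η := ρ.contDiff_normed
  have hηc : HasCompactSupport η := ρ.hasCompactSupport_normed
  have hηs : tsupport η ⊆ U := by
    rw [hη, ρ.tsupport_normed_eq]
    exact (closedBall_subset_ball (by change r / 2 < r; linarith)).trans hrU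
  have hη1 : ∫ t, η t = 1 := ρ.integral_normed
  set c : X := ∫ t, η t • z t with hc
  have hconst : ∀ᵐ t, t ∈ U → z t - c = 0 := by
    refine hUo.ae_eq_zero_of_integral_contDiff_smul_eq_zero
      (hzl.sub (continuousOn_const.locallyIntegrableOn hUo.measurableSet)) ?_
    intro g hg hgc hgs
    set m : ℝ := ∫ t, g t with hm
    -- Subtracting the mean makes the integral of `ψ` zero, so its primitive has compact support and
    -- is an admissible test function. Hence `∫ g z = (∫ g) c`.
    set ψ : ℝ → ℝ := fun t => g t - m * η t with hψ
    have hgi : Integrable g volume := hg.continuous.integrable_of_hasCompactSupport hgc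
    have hηi : Integrable η volume := hηd.continuous.integrable_of_hasCompactSupport hηc
    have hψd : ContDiff ℝ (⊤ : ℕ∞) ψ := hg.sub (contDiff_const.mul hηd)
    have hψi : Integrable ψ volume := hgi.sub (hηi.const_mul m)
    have hψ0 : ∫ t, ψ t = 0 := by
      rw [hψ, integral_sub hgi (hηi.const_mul m), integral_const_mul, hη1, mul_one, ← hm, sub_self]
    have hK : IsCompact (tsupport g ∪ tsupport η) := hgc.isCompact.union hηc.isCompact
    have hKne : (tsupport g ∪ tsupport η).Nonempty := by
      rw [hη, ρ.tsupport_normed_eq]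
      exact ⟨t₀, Or.inr (mem_closedBall_self (by change 0 ≤ r / 2; linarith))⟩
    obtain ⟨a, b, ha, hbT, hab⟩ := exists_Icc_of_isCompact hK hKne (union_subset hgs hηs)
    have hψout : ∀ t, t ∉ Icc a b → ψ t = 0 := fun t ht => by
      have h1 : g t = 0 := image_eq_zero_of_notMem_tsupport fun h => ht (hab (Or.inl h))
      have h2 : η t = 0 := image_eq_zero_of_notMem_tsupport fun h => ht (hab (Or.inr h))
      simp [hψ, h1, h2]
    set φ : ℝ → ℝ := fun t => ∫ s in (0 : ℝ)..t, ψ s with hφ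
    have hφd : ∀ t, HasDerivAt φ (ψ t) t := fun t =>
      intervalIntegral.integral_hasDerivAt_right (hψd.continuous.intervalIntegrable _ _)
        (hψd.continuous.stronglyMeasurableAtFilter _ _) hψd.continuous.continuousAt
    have hφ' : deriv φ = ψ := funext fun t => (hφd t).deriv
    have hφs : ContDiff ℝ (⊤ : ℕ∞) φ :=
      contDiff_infty_iff_deriv.2 ⟨fun t => (hφd t).differentiableAt, by rw [hφ']; exact hψd⟩
    have hφout : ∀ t, t ∉ Icc a b → φ t = 0 := fun t ht => by
      rcases lt_or_ge t a with h | h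
      · rw [hφ]
        simp only
        rw [intervalIntegral.integral_congr (g := fun _ => (0 : ℝ)), intervalIntegral.integral_zero]
        intro s hs
        refine hψout s fun hsI => ?_
        rcases mem_uIcc.1 hs with h' | h' <;> linarith [hsI.1, h'.1, h'.2]
      · have hbt : b < t := not_le.1 fun h' => ht ⟨h, h'⟩
        rw [hφ]
        simp only
        rw [intervalIntegral.integral_of_le (ha.le.trans h),
          setIntegral_eq_integral_of_forall_compl_eq_zero, hψ0]
        intro s hs
        exact hψout s fun hsI => hs ⟨ha.trans_le hsI.1, hsI.2.trans hbt.le⟩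
    have hφsupp : tsupport φ ⊆ Icc a b :=
      closure_minimal (fun t ht => by_contra fun h => ht (hφout t h)) isClosed_Icc
    have hφcs : HasCompactSupport φ := isCompact_Icc.of_isClosed_subset (isClosed_tsupport _) hφsupp
    have hφU : tsupport φ ⊆ U := hφsupp.trans fun t ht =>
      ⟨ha.trans_le ht.1, (EReal.coe_le_coe_iff.2 ht.2).trans_lt hbT⟩
    have hkey := hz0 φ hφs hφcs hφU
    rw [hφ'] at hkey
    have hgz := hint hzc hg.continuous hgc hgs
    have hηz := hint hzc hηd.continuous hηc hηs
    have e1 : ∫ t, ψ t • z t = (∫ t, g t • z t) - m • c := by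
      simp only [hψ, sub_smul, mul_smul]
      have hmz : Integrable (fun t => m • η t • z t) volume := hηz.smul m
      rw [integral_sub hgz hmz, integral_smul]
    have e2 : ∫ t, g t • (z t - c) = (∫ t, g t • z t) - m • c := by
      simp only [smul_sub]
      rw [integral_sub hgz (hgi.smul_const c), integral_smul_const]
    rw [e2, ← e1, hkey]
  -- Continuity upgrades almost everywhere to everywhere on the open interval, and the endpoint `0`
  -- is reached as a limit.
  have hEq : EqOn z (fun _ => c) (timeInterval T) := by
    have hae : z =ᵐ[volume.restrict U] fun _ => c := by
      rw [Filter.EventuallyEq, ae_restrict_iff' hUo.measurableSet]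
      filter_upwards [hconst] with t ht htU
      exact sub_eq_zero.1 (ht htU)
    have h1 := Measure.eqOn_open_of_ae_eq hae hUo (hzc.mono hUT) continuousOn_const
    refine h1.of_subset_closure hzc continuousOn_const hUT fun t ht => ?_
    rcases ht.1.lt_or_eq with h | h
    · exact subset_closure ⟨h, ht.2⟩
    · rw [← h, Metric.mem_closure_iff]
      intro ε hε
      refine ⟨min (ε / 2) t₀, ⟨lt_min (by positivity) ht₀.1, ?_⟩, ?_⟩
      · exact (EReal.coe_le_coe_iff.2 (min_le_right _ _)).trans_lt ht₀.2
      · rw [Real.dist_eq, zero_sub, abs_neg, abs_of_pos (lt_min (by positivity) ht₀.1)]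
        exact (min_le_left _ _).trans_lt (by linarith)
  have h0T : (0 : ℝ) ∈ timeInterval T := ⟨le_rfl, by exact_mod_cast hT⟩
  have ez := (hEq ht).trans (hEq h0T).symm
  simp only [hz, hP, Ioc_self, Measure.restrict_empty, integral_zero_measure, sub_zero] at ez
  rw [← ez]
  abel

end Weak

/-! ### Construction of a solution along characteristics -/

section Picard

variable {d : ℕ} {γ₂ γ₃ : ℝ} {b₂ : ℝ → ℝ} {b₃ : ℝ → ℝ → ℝ} {α β : ℝ} {a δ : ℝ}

/-- The collision operator with the non-negativity built in: `G(|f|,|f|,|f|) - L(f,|f|,|f|)`. -/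
def signedCollision {d : ℕ} (γ₂ γ₃ : ℝ) (b₂ : ℝ → ℝ) (b₃ : ℝ → ℝ → ℝ) (f : Phase d → ℝ)
    (p : Phase d) : ℝ :=
  gain γ₂ γ₃ b₂ b₃ (fun q => |f q|) (fun q => |f q|) (fun q => |f q|) p -
    loss γ₂ γ₃ b₂ b₃ f (fun q => |f q|) (fun q => |f q|) p

/-- The inverse of `sharp`. -/
def unsharp {d : ℕ} (F : ℝ → Phase d → ℝ) (t : ℝ) (q : Phase d) : ℝ :=
  F t (q.1 - t • q.2, q.2)

theorem sharp_unsharp (F : ℝ → Phase d → ℝ) : sharp (unsharp F) = F := by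
  funext t p
  simp [sharp, unsharp]

/-- `F` is jointly measurable and pointwise bounded by `a` Maxwellians. -/
structure DominatedPath {d : ℕ} (α β a : ℝ) (F : ℝ → Phase d → ℝ) : Prop where
  measurable : Measurable (Function.uncurry F)
  le : ∀ s p, |F s p| ≤ a * maxwellian α β p

/-- `signedCollision` along characteristics. -/
def signedCollisionSharp {d : ℕ} (γ₂ γ₃ : ℝ) (b₂ : ℝ → ℝ) (b₃ : ℝ → ℝ → ℝ)
    (F : ℝ → Phase d → ℝ) (s : ℝ) (p : Phase d) : ℝ :=
  signedCollision γ₂ γ₃ b₂ b₃ (unsharp F s) (p.1 + s • p.2, p.2)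

theorem measurable_unsharp {F : ℝ → Phase d → ℝ} (hF : Measurable (Function.uncurry F)) :
    Measurable (Function.uncurry (unsharp F)) :=
  hF.comp (f := fun z : ℝ × Phase d => (z.1, (z.2.1 - z.1 • z.2.2, z.2.2))) (by fun_prop)

theorem DominatedPath.dominated {F : ℝ → Phase d → ℝ} (hF : DominatedPath α β a F) (s : ℝ) :
    Dominated α β a s (unsharp F s) :=
  ⟨(measurable_unsharp hF.measurable).of_uncurry_left, fun _ => hF.le s _⟩

theorem DominatedPath.nonneg {F : ℝ → Phase d → ℝ} (hF : DominatedPath α β a F) : 0 ≤ a :=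
  (hF.dominated 0).nonneg

theorem measurable_gain_unsharp (hS : CollisionSetting d γ₂ γ₃ b₂ b₃ α β)
    {F G H : ℝ → Phase d → ℝ} (hF : Measurable (Function.uncurry F))
    (hG : Measurable (Function.uncurry G)) (hH : Measurable (Function.uncurry H)) :
    Measurable (fun z : ℝ × Phase d => gain γ₂ γ₃ b₂ b₃ (F z.1) (G z.1) (H z.1)
      (z.2.1 + z.1 • z.2.2, z.2.2)) := by
  have hz : Measurable (fun z : (ℝ × Phase d) × Phase d => (z.1.1, z.2)) := by fun_prop
  exact measurable_gain (X := ℝ × Phase d) hS.ang₂ hS.ang₃ (F := fun z => F z.1)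
    (G := fun z => G z.1) (H := fun z => H z.1) (P := fun z => (z.2.1 + z.1 • z.2.2, z.2.2))
    (hF.comp hz) (hG.comp hz) (hH.comp hz) (by fun_prop)

theorem measurable_loss_unsharp (hS : CollisionSetting d γ₂ γ₃ b₂ b₃ α β)
    {F G H : ℝ → Phase d → ℝ} (hF : Measurable (Function.uncurry F))
    (hG : Measurable (Function.uncurry G)) (hH : Measurable (Function.uncurry H)) :
    Measurable (fun z : ℝ × Phase d => loss γ₂ γ₃ b₂ b₃ (F z.1) (G z.1) (H z.1)
      (z.2.1 + z.1 • z.2.2, z.2.2)) := by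
  have hz : Measurable (fun z : (ℝ × Phase d) × Phase d => (z.1.1, z.2)) := by fun_prop
  exact measurable_loss (X := ℝ × Phase d) hS.ang₂ hS.ang₃ (F := fun z => F z.1)
    (G := fun z => G z.1) (H := fun z => H z.1) (P := fun z => (z.2.1 + z.1 • z.2.2, z.2.2))
    (hF.comp hz) (hG.comp hz) (hH.comp hz) (by fun_prop)

theorem measurable_signedCollisionSharp (hS : CollisionSetting d γ₂ γ₃ b₂ b₃ α β)
    {F : ℝ → Phase d → ℝ} (hF : Measurable (Function.uncurry F)) :
    Measurable (Function.uncurry (signedCollisionSharp γ₂ γ₃ b₂ b₃ F)) := by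
  have h := measurable_unsharp hF
  have h' : Measurable (Function.uncurry fun s q => |unsharp F s q|) := h.abs
  exact (measurable_gain_unsharp hS h' h' h').sub (measurable_loss_unsharp hS h h' h')

/-- Taking absolute values does not increase distances, so the modified operator has the same
Lipschitz bound: `3` from the gain and `3` from the loss. -/
theorem abs_signedCollision_sub_le (hS : CollisionSetting d γ₂ γ₃ b₂ b₃ α β) {s : ℝ}
    {f f' : Phase d → ℝ} (hf : Dominated α β a s f) (hf' : Dominated α β a s f') (hδ : 0 ≤ δ)
    (hff : ∀ q, |f q - f' q| ≤ δ * movingMaxwellian α β s q) (p : Phase d) :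
    |signedCollision γ₂ γ₃ b₂ b₃ f (p.1 + s • p.2, p.2) -
        signedCollision γ₂ γ₃ b₂ b₃ f' (p.1 + s • p.2, p.2)| ≤
      6 * a * δ * majorant γ₂ γ₃ b₂ b₃ α β a s p := by
  have habs : ∀ q, |(|f q|) - (|f' q|)| ≤ δ * movingMaxwellian α β s q := fun q =>
    (abs_abs_sub_abs_le _ _).trans (hff q)
  have h1 := hS.abs_gain_sub_le hf.abs hf'.abs hf.abs hf'.abs hf.abs hf'.abs hδ habs habs habs p
  have h2 := hS.abs_loss_sub_le hf hf' hf.abs hf'.abs hf.abs hf'.abs hδ hff habs habs p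
  unfold signedCollision
  rw [abs_le] at h1 h2 ⊢
  constructor <;> linarith [h1.1, h1.2, h2.1, h2.2]

theorem signedCollision_zero (p : Phase d) :
    signedCollision γ₂ γ₃ b₂ b₃ (fun _ => 0) p = 0 := by
  simp [signedCollision, gain, loss, gainIntegrand2, gainIntegrand3, lossIntegrand2,
    lossIntegrand3]

theorem abs_signedCollision_le (hS : CollisionSetting d γ₂ γ₃ b₂ b₃ α β) {s : ℝ}
    {f : Phase d → ℝ} (hf : Dominated α β a s f) (p : Phase d) :
    |signedCollision γ₂ γ₃ b₂ b₃ f (p.1 + s • p.2, p.2)| ≤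
      6 * a * a * majorant γ₂ γ₃ b₂ b₃ α β a s p := by
  have := abs_signedCollision_sub_le hS hf (dominated_zero hf.nonneg) hf.nonneg
    (by simpa using hf.le) p
  simpa [signedCollision_zero] using this

theorem integrable_signedCollisionSharp (hS : CollisionSetting d γ₂ γ₃ b₂ b₃ α β)
    {F : ℝ → Phase d → ℝ} (hF : DominatedPath α β a F) (p : Phase d) :
    Integrable (fun s => signedCollisionSharp γ₂ γ₃ b₂ b₃ F s p) volume :=
  ((hS.integrable_majorant hF.nonneg p).const_mul (6 * a * a)).mono'
    ((measurable_signedCollisionSharp hS hF.measurable).comp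
      (measurable_prodMk_right (y := p))).aestronglyMeasurable
    (ae_of_all _ fun s => abs_signedCollision_le hS (hF.dominated s) p)

/-- The Lipschitz constant of the Picard map on functions bounded by `a` Maxwellians. -/
def picardRate (d : ℕ) (γ₂ γ₃ : ℝ) (b₂ : ℝ → ℝ) (b₃ : ℝ → ℝ → ℝ) (α β a : ℝ) : ℝ :=
  6 * a * (constK d (collisionConst d) γ₂ γ₃ b₂ b₃ β * α ^ (-(1 / 2) : ℝ) * (1 + a))

/-- Enlarging `A` to the whole time axis makes the rate independent of the length of the time
interval. -/
theorem setIntegral_majorant_le (hS : CollisionSetting d γ₂ γ₃ b₂ b₃ α β) (ha : 0 ≤ a)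
    (hδ : 0 ≤ δ) (A : Set ℝ) (p : Phase d) :
    ∫ s in A, 6 * a * δ * majorant γ₂ γ₃ b₂ b₃ α β a s p ≤
      δ * picardRate d γ₂ γ₃ b₂ b₃ α β a * maxwellian α β p := by
  rw [integral_const_mul]
  have h1 : ∫ s in A, majorant γ₂ γ₃ b₂ b₃ α β a s p ≤
      ∫ s, majorant γ₂ γ₃ b₂ b₃ α β a s p :=
    setIntegral_le_integral (hS.integrable_majorant ha p)
      (ae_of_all _ fun s => hS.majorant_nonneg ha p)
  calc _ ≤ 6 * a * δ * (constK d (collisionConst d) γ₂ γ₃ b₂ b₃ β * α ^ (-(1 / 2) : ℝ) *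
        (1 + a) * maxwellian α β p) := by
        gcongr
        exact h1.trans (hS.integral_majorant_le ha p)
    _ = _ := by unfold picardRate; ring

/-- The Picard map. -/
def picard {d : ℕ} (γ₂ γ₃ : ℝ) (b₂ : ℝ → ℝ) (b₃ : ℝ → ℝ → ℝ) (f₀ : Phase d → ℝ)
    (F : ℝ → Phase d → ℝ) (t : ℝ) (p : Phase d) : ℝ :=
  -- For `t ≤ 0` the interval is empty and the value is `f₀`; paths thus live on all of `ℝ`,
  -- whatever `T` is.
  f₀ p + ∫ s in Ioc 0 t, signedCollisionSharp γ₂ γ₃ b₂ b₃ F s p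

theorem measurable_setIntegral_Ioc {W : ℝ → Phase d → ℝ} (hW : Measurable (Function.uncurry W)) :
    Measurable (fun z : ℝ × Phase d => ∫ s in Ioc 0 z.1, W s z.2) := by
  have h1 : (fun z : ℝ × Phase d => ∫ s in Ioc 0 z.1, W s z.2) = fun z =>
      ∫ s, ({y : (ℝ × Phase d) × ℝ | 0 < y.2 ∧ y.2 ≤ y.1.1}.indicator
        (fun y => W y.2 y.1.2)) (z, s) := by
    funext z
    rw [← integral_indicator measurableSet_Ioc]
    rfl
  rw [h1]
  have hm : Measurable ({y : (ℝ × Phase d) × ℝ | 0 < y.2 ∧ y.2 ≤ y.1.1}.indicator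
      (fun y => W y.2 y.1.2)) := by
    refine Measurable.indicator ?_ ?_
    · exact hW.comp (f := fun y : (ℝ × Phase d) × ℝ => (y.2, y.1.2)) (by fun_prop)
    · exact (measurableSet_lt measurable_const measurable_snd).inter
        (measurableSet_le measurable_snd measurable_fst.fst)
  exact (hm.stronglyMeasurable.integral_prod_right' (ν := volume)).measurable

theorem abs_picard_sub_le (hS : CollisionSetting d γ₂ γ₃ b₂ b₃ α β) (f₀ : Phase d → ℝ)
    {F F' : ℝ → Phase d → ℝ} (hF : DominatedPath α β a F) (hF' : DominatedPath α β a F')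
    (hδ : 0 ≤ δ) (h : ∀ s p, |F s p - F' s p| ≤ δ * maxwellian α β p) (t : ℝ) (p : Phase d) :
    |picard γ₂ γ₃ b₂ b₃ f₀ F t p - picard γ₂ γ₃ b₂ b₃ f₀ F' t p| ≤
      δ * picardRate d γ₂ γ₃ b₂ b₃ α β a * maxwellian α β p := by
  have ha := hF.nonneg
  unfold picard
  rw [add_sub_add_left_eq_sub, ← integral_sub (integrable_signedCollisionSharp hS hF p).restrict
    (integrable_signedCollisionSharp hS hF' p).restrict, ← Real.norm_eq_abs]
  refine (norm_integral_le_of_norm_le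
    (g := fun s => 6 * a * δ * majorant γ₂ γ₃ b₂ b₃ α β a s p)
    ((hS.integrable_majorant ha p).const_mul _).restrict (ae_of_all _ fun s => ?_)).trans
    (setIntegral_majorant_le hS ha hδ _ p)
  exact abs_signedCollision_sub_le hS (hF.dominated s) (hF'.dominated s) hδ (fun q => h s _) p

/-- Invariance of the set on which the map contracts: `m` accounts for the initial datum and `a *
picardRate` for the collisions. -/
theorem DominatedPath.picard (hS : CollisionSetting d γ₂ γ₃ b₂ b₃ α β) {f₀ : Phase d → ℝ}
    (hf₀ : Measurable f₀) {m : ℝ} (hm : ∀ p, |f₀ p| ≤ m * maxwellian α β p)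
    (hle : m + a * picardRate d γ₂ γ₃ b₂ b₃ α β a ≤ a) {F : ℝ → Phase d → ℝ}
    (hF : DominatedPath α β a F) : DominatedPath α β a (picard γ₂ γ₃ b₂ b₃ f₀ F) := by
  have ha := hF.nonneg
  refine ⟨(hf₀.comp measurable_snd).add
    (measurable_setIntegral_Ioc (measurable_signedCollisionSharp hS hF.measurable)),
    fun t p => ?_⟩
  have hM := maxwellian_pos α β p
  have h1 : |∫ s in Ioc 0 t, signedCollisionSharp γ₂ γ₃ b₂ b₃ F s p| ≤
      a * picardRate d γ₂ γ₃ b₂ b₃ α β a * maxwellian α β p := by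
    rw [← Real.norm_eq_abs]
    exact (norm_integral_le_of_norm_le
      (g := fun s => 6 * a * a * majorant γ₂ γ₃ b₂ b₃ α β a s p)
      ((hS.integrable_majorant ha p).const_mul _).restrict
      (ae_of_all _ fun s => abs_signedCollision_le hS (hF.dominated s) p)).trans
      (setIntegral_majorant_le hS ha ha _ p)
  calc |BinaryTernaryBoltzmann.picard γ₂ γ₃ b₂ b₃ f₀ F t p| ≤ _ := abs_add_le _ _
    _ ≤ m * maxwellian α β p + a * picardRate d γ₂ γ₃ b₂ b₃ α β a * maxwellian α β p :=
        add_le_add (hm p) h1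
    _ = (m + a * picardRate d γ₂ γ₃ b₂ b₃ α β a) * maxwellian α β p := by ring
    _ ≤ a * maxwellian α β p := by gcongr

/-- The Picard map has a fixed point. -/
theorem exists_picard_eq (hS : CollisionSetting d γ₂ γ₃ b₂ b₃ α β) {f₀ : Phase d → ℝ}
    (hf₀ : Measurable f₀) {m : ℝ} (hm : ∀ p, |f₀ p| ≤ m * maxwellian α β p) (ha : 0 ≤ a)
    (hle : m + a * picardRate d γ₂ γ₃ b₂ b₃ α β a ≤ a)
    (hlt : picardRate d γ₂ γ₃ b₂ b₃ α β a < 1) :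
    ∃ F : ℝ → Phase d → ℝ, DominatedPath α β a F ∧ picard γ₂ γ₃ b₂ b₃ f₀ F = F := by
  set θ := picardRate d γ₂ γ₃ b₂ b₃ α β a with hθ
  have hθ0 : 0 ≤ θ := by
    have := hS.constK_nonneg
    have := hS.α_pos
    rw [hθ, picardRate]; positivity
  set Φ := picard γ₂ γ₃ b₂ b₃ f₀ with hΦ
  -- The iterates converge geometrically at every `(t, p)`, so a pointwise limit replaces
  -- completeness of a function space and inherits bounds and measurability directly.
  set S : ℕ → ℝ → Phase d → ℝ := fun n => Φ^[n] (fun _ _ => 0) with hSn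
  have hsucc : ∀ n, S (n + 1) = Φ (S n) := fun n => Function.iterate_succ_apply' _ _ _
  have hdom : ∀ n, DominatedPath α β a (S n) := by
    intro n
    induction n with
    | zero =>
      refine ⟨measurable_const, fun s p => ?_⟩
      simp only [hSn, Function.iterate_zero, id, abs_zero]
      exact mul_nonneg ha (maxwellian_pos _ _ _).le
    | succ n ih =>
      rw [hsucc]
      exact ih.picard hS hf₀ hm hle
  have hdiff : ∀ n t p, |S n t p - S (n + 1) t p| ≤ a * θ ^ n * maxwellian α β p := by
    intro n
    induction n with
    | zero =>
      intro t p
      have h0 : S 0 t p = 0 := rfl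
      rw [h0, zero_sub, abs_neg, pow_zero, mul_one]
      exact (hdom 1).le t p
    | succ n ih =>
      intro t p
      have e : S (n + 1) t p = Φ (S n) t p := by rw [hsucc]
      rw [hsucc (n + 1), e]
      refine (abs_picard_sub_le hS f₀ (hdom n) (hdom (n + 1)) (by positivity) ih t p).trans_eq ?_
      rw [← hθ]; ring
  have hdist : ∀ t p n, dist (S n t p) (S (n + 1) t p) ≤ a * maxwellian α β p * θ ^ n :=
    fun t p n => by
      rw [Real.dist_eq]
      exact (hdiff n t p).trans_eq (by ring)
  have hlim : ∀ t p, ∃ x, Filter.Tendsto (fun n => S n t p) Filter.atTop (nhds x) := fun t p =>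
    cauchySeq_tendsto_of_complete (cauchySeq_of_le_geometric _ _ hlt (hdist t p))
  choose F hF using hlim
  have hFn : ∀ n t p, |S n t p - F t p| ≤ a * θ ^ n / (1 - θ) * maxwellian α β p := by
    intro n t p
    have := dist_le_of_le_geometric_of_tendsto _ _ hlt (hdist t p) (hF t p) n
    rw [Real.dist_eq] at this
    exact this.trans_eq (by ring)
  have hFd : DominatedPath α β a F := by
    refine ⟨?_, fun t p => ?_⟩
    · refine measurable_of_tendsto_metrizable (f := fun n => Function.uncurry (S n))
        (fun n => (hdom n).measurable) ?_
      rw [tendsto_pi_nhds]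
      exact fun z => hF z.1 z.2
    · exact le_of_tendsto (hF t p).abs (Filter.Eventually.of_forall fun n => (hdom n).le t p)
  refine ⟨F, hFd, ?_⟩
  funext t p
  have h1θ : 0 < 1 - θ := by linarith
  have h1 : Filter.Tendsto (fun n => S (n + 1) t p) Filter.atTop (nhds (F t p)) :=
    (hF t p).comp (Filter.tendsto_add_atTop_nat 1)
  have h2 : Filter.Tendsto (fun n => S (n + 1) t p) Filter.atTop (nhds (Φ F t p)) := by
    rw [tendsto_iff_dist_tendsto_zero]
    have hb : ∀ n, dist (S (n + 1) t p) (Φ F t p) ≤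
        θ ^ n * (a / (1 - θ) * θ * maxwellian α β p) := fun n => by
      rw [Real.dist_eq, hsucc]
      refine (abs_picard_sub_le hS f₀ (hdom n) hFd (δ := a * θ ^ n / (1 - θ)) (by positivity)
        (hFn n) t p).trans_eq ?_
      rw [← hθ]; ring
    refine squeeze_zero (fun _ => dist_nonneg) hb ?_
    have := (tendsto_pow_atTop_nhds_zero_of_lt_one hθ0 hlt).mul_const
      (a / (1 - θ) * θ * maxwellian α β p)
    rwa [zero_mul] at this
  exact tendsto_nhds_unique h2 h1

/-- A function which is non-decreasing whenever it is non-positive stays non-negative. -/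
theorem nonneg_of_primitive {u w : ℝ → ℝ} {u₀ : ℝ} (hu₀ : 0 ≤ u₀) (hw : Integrable w volume)
    (hu : ∀ t, u t = u₀ + ∫ s in Ioc 0 t, w s) (hpos : ∀ s, u s ≤ 0 → 0 ≤ w s) (t : ℝ) :
    0 ≤ u t := by
  by_contra hneg
  rw [not_le] at hneg
  have h0 : u 0 = u₀ := by rw [hu]; simp
  have ht : 0 < t := by
    by_contra h
    rw [hu, Ioc_eq_empty (by simpa using h)] at hneg
    simp at hneg
    linarith
  have hc : ContinuousOn u (Icc 0 t) := by
    have := intervalIntegral.continuousOn_primitive (a := 0) (b := t) (f := w)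
      (μ := volume) hw.integrableOn
    exact (continuousOn_const.add this).congr fun s _ => hu s
  have hcl : IsCompact (Icc 0 t ∩ u ⁻¹' Ici 0) :=
    isCompact_Icc.of_isClosed_subset (hc.preimage_isClosed_of_isClosed isClosed_Icc isClosed_Ici)
      inter_subset_left
  have hne : (Icc 0 t ∩ u ⁻¹' Ici 0).Nonempty := ⟨0, ⟨le_rfl, ht.le⟩, by
    rw [mem_preimage, h0]; exact hu₀⟩
  -- `τ` is the last time up to `t` at which `u ≥ 0`. After it `u` is negative, so `w ≥ 0` and `u t
  -- ≥ u τ ≥ 0`, a contradiction.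
  set τ := sSup (Icc 0 t ∩ u ⁻¹' Ici 0) with hτ
  have hτm := hcl.sSup_mem hne
  rw [← hτ] at hτm
  have hsplit : u t = u τ + ∫ s in Ioc τ t, w s := by
    rw [hu t, hu τ, add_assoc, ← setIntegral_union]
    · rw [Ioc_union_Ioc_eq_Ioc hτm.1.1 hτm.1.2]
    · exact Ioc_disjoint_Ioc_of_le le_rfl
    · exact measurableSet_Ioc
    · exact hw.integrableOn
    · exact hw.integrableOn
  have hint : 0 ≤ ∫ s in Ioc τ t, w s := by
    refine setIntegral_nonneg measurableSet_Ioc fun s hs => hpos s ?_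
    by_contra h
    have : s ≤ τ := le_csSup hcl.bddAbove ⟨⟨hτm.1.1.trans hs.1.le, hs.2⟩, (not_le.1 h).le⟩
    exact absurd hs.1 (not_lt.2 this)
  have : 0 ≤ u τ := hτm.2
  linarith

theorem gain_nonneg (hS : CollisionSetting d γ₂ γ₃ b₂ b₃ α β) {f g h : Phase d → ℝ}
    (hf : ∀ q, 0 ≤ f q) (hg : ∀ q, 0 ≤ g q) (hh : ∀ q, 0 ≤ h q) (p : Phase d) :
    0 ≤ gain γ₂ γ₃ b₂ b₃ f g h p :=
  add_nonneg
    (integral_nonneg fun _ => mul_nonneg (mul_nonneg (crossSection2_nonneg hS.ang₂ _ _ _) (hf _))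
      (hg _))
    (integral_nonneg fun _ => mul_nonneg (mul_nonneg (mul_nonneg
      (crossSection3_nonneg hS.ang₃ _ _ _ _ _) (hf _)) (hg _)) (hh _))

/-- The first argument enters the loss only through its value at `p`. This is why `signedCollision`
keeps that slot free of an absolute value. -/
theorem loss_nonpos (hS : CollisionSetting d γ₂ γ₃ b₂ b₃ α β) {f g h : Phase d → ℝ}
    {p : Phase d} (hf : f p ≤ 0) (hg : ∀ q, 0 ≤ g q) (hh : ∀ q, 0 ≤ h q) :
    loss γ₂ γ₃ b₂ b₃ f g h p ≤ 0 :=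
  add_nonpos
    (integral_nonpos fun _ => mul_nonpos_of_nonpos_of_nonneg
      (mul_nonpos_of_nonneg_of_nonpos (crossSection2_nonneg hS.ang₂ _ _ _) hf) (hg _))
    (integral_nonpos fun _ => mul_nonpos_of_nonpos_of_nonneg (mul_nonpos_of_nonpos_of_nonneg
      (mul_nonpos_of_nonneg_of_nonpos (crossSection3_nonneg hS.ang₃ _ _ _ _ _) hf) (hg _)) (hh _))

theorem loss_nonneg (hS : CollisionSetting d γ₂ γ₃ b₂ b₃ α β) {f g h : Phase d → ℝ}
    (hf : ∀ q, 0 ≤ f q) (hg : ∀ q, 0 ≤ g q) (hh : ∀ q, 0 ≤ h q) (p : Phase d) :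
    0 ≤ loss γ₂ γ₃ b₂ b₃ f g h p :=
  add_nonneg
    (integral_nonneg fun _ => mul_nonneg (mul_nonneg (crossSection2_nonneg hS.ang₂ _ _ _) (hf _))
      (hg _))
    (integral_nonneg fun _ => mul_nonneg (mul_nonneg (mul_nonneg
      (crossSection3_nonneg hS.ang₃ _ _ _ _ _) (hf _)) (hg _)) (hh _))

/-- Where the path is non-positive, the gain is non-negative and the loss non-positive, so the path
cannot decrease there. -/
theorem nonneg_of_picard_eq (hS : CollisionSetting d γ₂ γ₃ b₂ b₃ α β) {f₀ : Phase d → ℝ}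
    (hf₀ : ∀ p, 0 ≤ f₀ p) {F : ℝ → Phase d → ℝ} (hF : DominatedPath α β a F)
    (heq : picard γ₂ γ₃ b₂ b₃ f₀ F = F) (t : ℝ) (p : Phase d) : 0 ≤ F t p := by
  refine nonneg_of_primitive (u := fun t => F t p) (hf₀ p)
    (integrable_signedCollisionSharp hS hF p) (fun t => (congrFun (congrFun heq t) p).symm)
    (fun s hs => ?_) t
  have h1 := gain_nonneg hS (fun q => abs_nonneg (unsharp F s q)) (fun q => abs_nonneg _)
    (fun q => abs_nonneg _) (h := fun q => |unsharp F s q|) (g := fun q => |unsharp F s q|)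
    (p.1 + s • p.2, p.2)
  have h2 : unsharp F s (p.1 + s • p.2, p.2) ≤ 0 := by simpa [unsharp] using hs
  have h3 := loss_nonpos hS h2 (fun q => abs_nonneg (unsharp F s q))
    (fun q => abs_nonneg (unsharp F s q))
  unfold signedCollisionSharp signedCollision
  linarith

end Picard

/-! ### The collision operators respect almost everywhere equality -/

section AeCongr

theorem measurableSet_ae_mem {Y Z : Type*} [MeasurableSpace Y] [MeasurableSpace Z]
    {ν : Measure Z} [SFinite ν] {S : Set (Y × Z)} (hS : MeasurableSet S) :
    MeasurableSet {y | ∀ᵐ z ∂ν, (y, z) ∈ S} := by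
  have : {y | ∀ᵐ z ∂ν, (y, z) ∈ S} = (fun y => ν (Prod.mk y ⁻¹' Sᶜ)) ⁻¹' {0} := by
    ext y
    rfl
  rw [this]
  exact measurable_measure_prodMk_left hS.compl (measurableSet_singleton 0)

variable {d : ℕ} {Ω : Type*} [MeasurableSpace Ω] {σ : Measure Ω} [SFinite σ]
  {W : Type*} [NormedAddCommGroup W] [NormedSpace ℝ W] [FiniteDimensional ℝ W]
  [MeasureSpace W] [BorelSpace W] [(volume : Measure W).IsAddHaarMeasure]

/-- A property that holds for almost every point of phase space holds for almost every collision
at velocities that depend linearly and surjectively on the incoming ones. -/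
theorem ae_ae_mem_of_surjective {L : Ω → (Vel d × W) →ₗ[ℝ] Vel d}
    (hL : ∀ ω, Function.Surjective (L ω))
    (hLm : Measurable (fun z : Ω × (Vel d × W) => L z.1 z.2)) {S : Set (Phase d)}
    (hS : MeasurableSet S) (hae : ∀ᵐ y, y ∈ S) :
    ∀ᵐ p : Phase d, ∀ᵐ q : Ω × W ∂(σ.prod volume), (p.1, L q.1 (p.2, q.2)) ∈ S := by
  have hmeas : MeasurableSet {z : Phase d × (Ω × W) |
      (z.1.1, L z.2.1 (z.1.2, z.2.2)) ∈ S} := by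
    have h1 : Measurable (fun z : Phase d × (Ω × W) => L z.2.1 (z.1.2, z.2.2)) :=
      hLm.comp (f := fun z : Phase d × (Ω × W) => (z.2.1, (z.1.2, z.2.2))) (by fun_prop)
    exact (measurable_fst.fst.prodMk h1) hS
  refine (Measure.ae_prod_iff_ae_ae (μ := (volume : Measure (Vel d)))
    (ν := (volume : Measure (Vel d)))
    (p := fun p => ∀ᵐ q : Ω × W ∂(σ.prod volume), (p.1, L q.1 (p.2, q.2)) ∈ S)
    (measurableSet_ae_mem hmeas)).2 ?_
  have hx : ∀ᵐ x : Vel d, ∀ᵐ v : Vel d, (x, v) ∈ S := Measure.ae_ae_of_ae_prod hae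
  filter_upwards [hx] with x hx
  have hSx : MeasurableSet {v | (x, v) ∈ S} := measurable_prodMk_left hS
  have hH : (volume : Measure (Vel d × W)).IsAddHaarMeasure :=
    Measure.prod.instIsAddHaarMeasure _ _
  -- For each fixed `ω` a surjective linear map pulls null sets back to null sets. Fubini then moves
  -- the quantifier over `ω` inside the one over `v`.
  have h1 : ∀ ω, ∀ᵐ v : Vel d, ∀ᵐ w : W, (x, L ω (v, w)) ∈ S := fun ω =>
    Measure.ae_ae_of_ae_prod
      ((ae_comp_linearMap_mem_iff (L ω) (volume : Measure (Vel d × W)) volume (hL ω) hSx).2 hx)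
  have hm2 : MeasurableSet {z : Ω × Vel d | ∀ᵐ w : W, (x, L z.1 (z.2, w)) ∈ S} := by
    refine measurableSet_ae_mem (S := {y : (Ω × Vel d) × W | (x, L y.1.1 (y.1.2, y.2)) ∈ S}) ?_
    have h1 : Measurable (fun z : (Ω × Vel d) × W => L z.1.1 (z.1.2, z.2)) :=
      hLm.comp (f := fun z : (Ω × Vel d) × W => (z.1.1, (z.1.2, z.2))) (by fun_prop)
    exact (measurable_const.prodMk h1) hS
  have h2 : ∀ᵐ v : Vel d, ∀ᵐ ω ∂σ, ∀ᵐ w : W, (x, L ω (v, w)) ∈ S :=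
    (Measure.ae_ae_comm hm2).1 (ae_of_all σ h1)
  filter_upwards [h2] with v hv
  rw [Measure.ae_prod_iff_ae_ae]
  · exact hv
  · have h1 : Measurable (fun z : Ω × W => L z.1 (v, z.2)) :=
      hLm.comp (f := fun z : Ω × W => (z.1, (v, z.2))) (by fun_prop)
    exact (measurable_const.prodMk h1) hS

/-- `v'` as a linear function of the incoming velocities. -/
def post2Linear (ω : Sph d) : (Vel d × Vel d) →ₗ[ℝ] Vel d where
  toFun z := post2 ω z.1 z.2
  map_add' x y := by
    simp only [post2, Prod.fst_add, Prod.snd_add, inner_sub_right, inner_add_right]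
    module
  map_smul' c x := by
    simp only [post2, Prod.smul_fst, Prod.smul_snd, inner_sub_right, real_inner_smul_right,
      RingHom.id_apply]
    module

/-- `v₁'` as a linear function of the incoming velocities. -/
def post2₁Linear (ω : Sph d) : (Vel d × Vel d) →ₗ[ℝ] Vel d where
  toFun z := post2₁ ω z.1 z.2
  map_add' x y := by
    simp only [post2₁, Prod.fst_add, Prod.snd_add, inner_sub_right, inner_add_right]
    module
  map_smul' c x := by
    simp only [post2₁, Prod.smul_fst, Prod.smul_snd, inner_sub_right, real_inner_smul_right,
      RingHom.id_apply]
    module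

theorem impulse3_add (ω : Sph2 d) (v v₁ v₂ w w₁ w₂ : Vel d) :
    impulse3 ω (v + w) (v₁ + w₁) (v₂ + w₂) = impulse3 ω v v₁ v₂ + impulse3 ω w w₁ w₂ := by
  simp only [impulse3, inner_sub_right, inner_add_right]
  ring

theorem impulse3_smul (ω : Sph2 d) (c : ℝ) (v v₁ v₂ : Vel d) :
    impulse3 ω (c • v) (c • v₁) (c • v₂) = c * impulse3 ω v v₁ v₂ := by
  simp only [impulse3, inner_sub_right, real_inner_smul_right]
  ring

/-- `v*` as a linear function of the incoming velocities. -/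
def post3Linear (ω : Sph2 d) : (Vel d × (Vel d × Vel d)) →ₗ[ℝ] Vel d where
  toFun z := post3 ω z.1 z.2.1 z.2.2
  map_add' x y := by
    simp only [post3, Prod.fst_add, Prod.snd_add, impulse3_add]
    module
  map_smul' c x := by
    simp only [post3, Prod.smul_fst, Prod.smul_snd, impulse3_smul, RingHom.id_apply]
    module

/-- `v₁*` as a linear function of the incoming velocities. -/
def post3₁Linear (ω : Sph2 d) : (Vel d × (Vel d × Vel d)) →ₗ[ℝ] Vel d where
  toFun z := post3₁ ω z.1 z.2.1 z.2.2
  map_add' x y := by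
    simp only [post3₁, Prod.fst_add, Prod.snd_add, impulse3_add]
    module
  map_smul' c x := by
    simp only [post3₁, Prod.smul_fst, Prod.smul_snd, impulse3_smul, RingHom.id_apply]
    module

/-- `v₂*` as a linear function of the incoming velocities. -/
def post3₂Linear (ω : Sph2 d) : (Vel d × (Vel d × Vel d)) →ₗ[ℝ] Vel d where
  toFun z := post3₂ ω z.1 z.2.1 z.2.2
  map_add' x y := by
    simp only [post3₂, Prod.fst_add, Prod.snd_add, impulse3_add]
    module
  map_smul' c x := by
    simp only [post3₂, Prod.smul_fst, Prod.smul_snd, impulse3_smul, RingHom.id_apply]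
    module

theorem impulse3_self (ω : Sph2 d) (v : Vel d) : impulse3 ω v v v = 0 := by
  simp [impulse3]

variable {γ₂ γ₃ : ℝ} {b₂ : ℝ → ℝ} {b₃ : ℝ → ℝ → ℝ} {f f' : Phase d → ℝ}

/-- For fixed `ω` each velocity appearing in the partner and outgoing arguments is linear in the
incoming velocities, and surjective because a collision between equal velocities `y` returns `y`. -/
theorem ae_collision_congr (hff : f =ᵐ[volume] f') : ∀ᵐ p : Phase d,
    gainIntegrand2 γ₂ b₂ f f p =ᵐ[collMeasure2 d] gainIntegrand2 γ₂ b₂ f' f' p ∧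
    lossIntegrand2 γ₂ b₂ f f p =ᵐ[collMeasure2 d] lossIntegrand2 γ₂ b₂ f' f' p ∧
    gainIntegrand3 γ₃ b₃ f f f p =ᵐ[collMeasure3 d] gainIntegrand3 γ₃ b₃ f' f' f' p ∧
    lossIntegrand3 γ₃ b₃ f f f p =ᵐ[collMeasure3 d] lossIntegrand3 γ₃ b₃ f' f' f' p := by
  -- The set where the two functions agree need not be measurable; it is shrunk to a measurable set
  -- of full measure.
  obtain ⟨S, hSsub, hS, hSae⟩ : ∃ S : Set (Phase d), (∀ q ∈ S, f q = f' q) ∧ MeasurableSet S ∧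
      ∀ᵐ q, q ∈ S := by
    refine ⟨(toMeasurable volume {q | ¬ f q = f' q})ᶜ, fun q hq => ?_,
      (measurableSet_toMeasurable _ _).compl, ?_⟩
    · by_contra h
      exact hq (subset_toMeasurable _ _ h)
    · rw [ae_iff]
      simp only [mem_compl_iff, not_not]
      change volume (toMeasurable volume {q | ¬ f q = f' q}) = 0
      rw [measure_toMeasurable]
      exact hff
  have a1 := ae_ae_mem_of_surjective (σ := sphMeasure d) (L := post2Linear)
    (fun ω y => ⟨(y, y), by simp [post2Linear, post2]⟩) measurable_post2 hS hSae
  have a2 := ae_ae_mem_of_surjective (σ := sphMeasure d) (L := post2₁Linear)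
    (fun ω y => ⟨(y, y), by simp [post2₁Linear, post2₁]⟩) measurable_post2₁ hS hSae
  have a3 := ae_ae_mem_of_surjective (σ := sphMeasure d) (W := Vel d)
    (L := fun _ => LinearMap.snd ℝ (Vel d) (Vel d)) (fun ω y => ⟨(y, y), rfl⟩)
    (by simp only [LinearMap.snd_apply]; fun_prop) hS hSae
  have hW : (volume : Measure (Vel d × Vel d)).IsAddHaarMeasure :=
    Measure.prod.instIsAddHaarMeasure _ _
  have c1 := ae_ae_mem_of_surjective (σ := sph2Measure d) (L := post3Linear)
    (fun ω y => ⟨(y, y, y), by simp [post3Linear, post3, impulse3_self]⟩) measurable_post3 hS hSae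
  have c2 := ae_ae_mem_of_surjective (σ := sph2Measure d) (L := post3₁Linear)
    (fun ω y => ⟨(y, y, y), by simp [post3₁Linear, post3₁, impulse3_self]⟩) measurable_post3₁
    hS hSae
  have c3 := ae_ae_mem_of_surjective (σ := sph2Measure d) (L := post3₂Linear)
    (fun ω y => ⟨(y, y, y), by simp [post3₂Linear, post3₂, impulse3_self]⟩) measurable_post3₂
    hS hSae
  have c4 := ae_ae_mem_of_surjective (σ := sph2Measure d) (W := Vel d × Vel d)
    (L := fun _ => (LinearMap.fst ℝ (Vel d) (Vel d)).comp (LinearMap.snd ℝ (Vel d) _))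
    (fun ω y => ⟨(y, y, y), rfl⟩)
    (by simp only [LinearMap.comp_apply, LinearMap.snd_apply, LinearMap.fst_apply]; fun_prop)
    hS hSae
  have c5 := ae_ae_mem_of_surjective (σ := sph2Measure d) (W := Vel d × Vel d)
    (L := fun _ => (LinearMap.snd ℝ (Vel d) (Vel d)).comp (LinearMap.snd ℝ (Vel d) _))
    (fun ω y => ⟨(y, y, y), rfl⟩)
    (by simp only [LinearMap.comp_apply, LinearMap.snd_apply]; fun_prop)
    hS hSae
  filter_upwards [hSae, a1, a2, a3, c1, c2, c3, c4, c5] with p h0 a1 a2 a3 c1 c2 c3 c4 c5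
  have h0 := hSsub _ h0
  refine ⟨?_, ?_, ?_, ?_⟩
  · filter_upwards [a1, a2] with q h1 h2
    have h1 : f (p.1, post2 q.1 p.2 q.2) = f' (p.1, post2 q.1 p.2 q.2) := hSsub _ h1
    have h2 : f (p.1, post2₁ q.1 p.2 q.2) = f' (p.1, post2₁ q.1 p.2 q.2) := hSsub _ h2
    simp only [gainIntegrand2, h1, h2]
  · filter_upwards [a3] with q h1
    have h1 : f (p.1, q.2) = f' (p.1, q.2) := hSsub _ h1
    simp only [lossIntegrand2, h1, h0]
  · filter_upwards [c1, c2, c3] with q h1 h2 h3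
    have h1 : f (p.1, post3 q.1 p.2 q.2.1 q.2.2) = f' (p.1, post3 q.1 p.2 q.2.1 q.2.2) :=
      hSsub _ h1
    have h2 : f (p.1, post3₁ q.1 p.2 q.2.1 q.2.2) = f' (p.1, post3₁ q.1 p.2 q.2.1 q.2.2) :=
      hSsub _ h2
    have h3 : f (p.1, post3₂ q.1 p.2 q.2.1 q.2.2) = f' (p.1, post3₂ q.1 p.2 q.2.1 q.2.2) :=
      hSsub _ h3
    simp only [gainIntegrand3, h1, h2, h3]
  · filter_upwards [c4, c5] with q h1 h2
    have h1 : f (p.1, q.2.1) = f' (p.1, q.2.1) := hSsub _ h1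
    have h2 : f (p.1, q.2.2) = f' (p.1, q.2.2) := hSsub _ h2
    simp only [lossIntegrand3, h0, h1, h2]

theorem gain_congr_ae (hff : f =ᵐ[volume] f') :
    gain γ₂ γ₃ b₂ b₃ f f f =ᵐ[volume] gain γ₂ γ₃ b₂ b₃ f' f' f' := by
  filter_upwards [ae_collision_congr (γ₂ := γ₂) (γ₃ := γ₃) (b₂ := b₂) (b₃ := b₃) hff] with p hp
  unfold gain
  rw [integral_congr_ae hp.1, integral_congr_ae hp.2.2.1]

theorem loss_congr_ae (hff : f =ᵐ[volume] f') :
    loss γ₂ γ₃ b₂ b₃ f f f =ᵐ[volume] loss γ₂ γ₃ b₂ b₃ f' f' f' := by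
  filter_upwards [ae_collision_congr (γ₂ := γ₂) (γ₃ := γ₃) (b₂ := b₂) (b₃ := b₃) hff] with p hp
  unfold loss
  rw [integral_congr_ae hp.2.1, integral_congr_ae hp.2.2.2]

/-- Free transport preserves the measure of phase space. -/
theorem measurePreserving_transport (t : ℝ) :
    MeasurePreserving (fun p : Phase d => (p.1 + t • p.2, p.2)) volume volume := by
  have h := MeasurePreserving.skew_product (f := (id : Vel d → Vel d))
    (g := fun (v x : Vel d) => x + t • v) (μa := volume) (μb := volume) (μc := volume)
    (μd := volume) (MeasurePreserving.id _) (by fun_prop)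
    (ae_of_all _ fun v => (measurePreserving_add_right volume (t • v)).map_eq)
  exact (Measure.measurePreserving_swap.comp h).comp Measure.measurePreserving_swap

theorem ae_eq_of_sharp_ae_eq {f g : ℝ → Phase d → ℝ} {t : ℝ}
    (h : sharp f t =ᵐ[volume] sharp g t) : f t =ᵐ[volume] g t := by
  have := (measurePreserving_transport (d := d) (-t)).quasiMeasurePreserving.ae_eq h
  filter_upwards [this] with p hp
  simpa [sharp] using hp

end AeCongr

/-! ### Existence of mild solutions -/

section Existence

variable {d : ℕ} {γ₂ γ₃ : ℝ} {b₂ : ℝ → ℝ} {b₃ : ℝ → ℝ → ℝ} {α β : ℝ} {a s : ℝ}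

theorem abs_gain_le (hS : CollisionSetting d γ₂ γ₃ b₂ b₃ α β) {f : Phase d → ℝ}
    (hf : Dominated α β a s f) (p : Phase d) :
    |gain γ₂ γ₃ b₂ b₃ f f f (p.1 + s • p.2, p.2)| ≤
      3 * a * a * majorant γ₂ γ₃ b₂ b₃ α β a s p := by
  have h0 := dominated_zero (d := d) (α := α) (β := β) (s := s) hf.nonneg
  have hle : ∀ q, |f q - (fun _ => 0) q| ≤ a * movingMaxwellian α β s q := by simpa using hf.le
  have := hS.abs_gain_sub_le hf h0 hf h0 hf h0 hf.nonneg hle hle hle p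
  have hz : ∀ q, gain γ₂ γ₃ b₂ b₃ (fun _ : Phase d => 0) (fun _ => 0) (fun _ => 0) q = 0 := by
    simp [gain, gainIntegrand2, gainIntegrand3]
  rwa [hz, sub_zero] at this

theorem abs_loss_le (hS : CollisionSetting d γ₂ γ₃ b₂ b₃ α β) {f : Phase d → ℝ}
    (hf : Dominated α β a s f) (p : Phase d) :
    |loss γ₂ γ₃ b₂ b₃ f f f (p.1 + s • p.2, p.2)| ≤
      3 * a * a * majorant γ₂ γ₃ b₂ b₃ α β a s p := by
  have h0 := dominated_zero (d := d) (α := α) (β := β) (s := s) hf.nonneg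
  have hle : ∀ q, |f q - (fun _ => 0) q| ≤ a * movingMaxwellian α β s q := by simpa using hf.le
  have := hS.abs_loss_sub_le hf h0 hf h0 hf h0 hf.nonneg hle hle hle p
  have hz : ∀ q, loss γ₂ γ₃ b₂ b₃ (fun _ : Phase d => 0) (fun _ => 0) (fun _ => 0) q = 0 := by
    simp [loss, lossIntegrand2, lossIntegrand3]
  rwa [hz, sub_zero] at this

/-- The gain and loss terms of a dominated path along characteristics have a common integrable
bound. -/
theorem exists_gainSharp_lossSharp_le (hS : CollisionSetting d γ₂ γ₃ b₂ b₃ α β)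
    (ha : 0 ≤ a) : ∃ h : Phase d → ℝ, Integrable h volume ∧
      ∀ (s : ℝ) (f : Phase d → ℝ), Dominated α β a s f → ∀ p,
        |gain γ₂ γ₃ b₂ b₃ f f f (p.1 + s • p.2, p.2)| ≤ h p ∧
        |loss γ₂ γ₃ b₂ b₃ f f f (p.1 + s • p.2, p.2)| ≤ h p := by
  obtain ⟨C, -, hC⟩ := hS.exists_majorant_le ha
  refine ⟨fun p => 3 * a * a * (C * maxwellian α (β / 2) p),
    ((integrable_maxwellian hS.α_pos (half_pos hS.β_pos)).const_mul C).const_mul _,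
    fun s f hf p => ⟨(abs_gain_le hS hf p).trans ?_, (abs_loss_le hS hf p).trans ?_⟩⟩ <;>
  exact mul_le_mul_of_nonneg_left (hC s p) (by positivity)

theorem memLinfL1Pos_of_le {T : EReal} {G : ℝ → Phase d → ℝ} {h : Phase d → ℝ}
    (hG : Measurable (Function.uncurry G)) (h0 : ∀ t p, 0 ≤ G t p) (hh : Integrable h volume)
    (hle : ∀ t p, |G t p| ≤ h p) : MemLinfL1Pos T G := by
  have hi := integrable_slice_of_le hG hh hle
  exact ⟨fun t _ => ⟨hG.of_uncurry_left.aemeasurable, ae_of_all _ (h0 t)⟩, ae_of_all _ hi,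
    memLp_top_of_bound (stronglyMeasurable_toL1 hG hi).aestronglyMeasurable (∫ p, h p)
      (ae_of_all _ fun t => norm_toL1_le (hi t) hh (ae_of_all _ (hle t)))⟩

theorem locallyIntegrable_toL1 {G : ℝ → Phase d → ℝ} {h : Phase d → ℝ}
    (hG : Measurable (Function.uncurry G)) (hh : Integrable h volume)
    (hle : ∀ t p, |G t p| ≤ h p) : LocallyIntegrable (fun t => toL1 (G t)) volume := by
  rw [locallyIntegrable_iff]
  intro K hK
  have : IsFiniteMeasure (volume.restrict K) := isFiniteMeasure_restrict.2 hK.measure_lt_top.ne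
  exact (toL1_setIntegral hG hh hle K).2.1

theorem maxwellNorm_le {f : Phase d → ℝ} (hf : ∀ᵐ p, |f p| ≤ a * maxwellian α β p) :
    maxwellNorm α β f ≤ ENNReal.ofReal a := by
  rw [maxwellNorm, eLpNorm_exponent_top]
  refine eLpNormEssSup_le_of_ae_bound ?_
  filter_upwards [hf] with p hp
  have hM := maxwellian_pos α β p
  rw [norm_mul, norm_inv, Real.norm_of_nonneg hM.le, Real.norm_eq_abs]
  exact mul_inv_le_of_le_mul₀ hM.le
    (nonneg_of_mul_nonneg_left ((abs_nonneg _).trans hp) hM) hp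

theorem ae_abs_le_of_maxwellNorm_le {f : Phase d → ℝ} (ha : 0 ≤ a)
    (hf : maxwellNorm α β f ≤ ENNReal.ofReal a) : ∀ᵐ p, |f p| ≤ a * maxwellian α β p := by
  rw [maxwellNorm, eLpNorm_exponent_top] at hf
  filter_upwards [enorm_ae_le_eLpNormEssSup (fun p => f p * (maxwellian α β p)⁻¹) volume] with p hp
  have hM := maxwellian_pos α β p
  have h1 := hp.trans hf
  rw [← ofReal_norm, ENNReal.ofReal_le_ofReal_iff ha, norm_mul, norm_inv,
    Real.norm_of_nonneg hM.le, Real.norm_eq_abs, ← div_eq_mul_inv, div_le_iff₀ hM] at h1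
  exact h1

theorem tripleNorm_le {T : EReal} {F : ℝ → Phase d → ℝ} (hF : DominatedPath α β a F) :
    tripleNorm α β T F ≤ ENNReal.ofReal a :=
  iSup₂_le fun t _ => maxwellNorm_le (ae_of_all _ (hF.le t))

theorem signedCollisionSharp_of_nonneg {F : ℝ → Phase d → ℝ} {s : ℝ} (hF : ∀ p, 0 ≤ F s p)
    (p : Phase d) : signedCollisionSharp γ₂ γ₃ b₂ b₃ F s p =
      gainSharp γ₂ γ₃ b₂ b₃ (unsharp F) s p - lossSharp γ₂ γ₃ b₂ b₃ (unsharp F) s p := by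
  have : (fun q => |unsharp F s q|) = unsharp F s := funext fun q => abs_of_nonneg (hF _)
  simp only [signedCollisionSharp, signedCollision, gainSharp, lossSharp, sharp, this]

theorem collisionsConverge (hS : CollisionSetting d γ₂ γ₃ b₂ b₃ α β) {f : Phase d → ℝ}
    (hf : Dominated α β a s f) : CollisionsConverge γ₂ γ₃ b₂ b₃ f := by
  refine ae_of_all _ fun q => ?_
  -- The integrability statements live at `p.1 + s • p.2`, so the base point is transported back.
  have h1 := hS.integrable_gainIntegrand2 hf hf (q.1 - s • q.2, q.2)
  have h2 := hS.integrable_lossIntegrand2 hf hf (q.1 - s • q.2, q.2)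
  have h3 := hS.integrable_gainIntegrand3 hf hf hf (q.1 - s • q.2, q.2)
  have h4 := hS.integrable_lossIntegrand3 hf hf hf (q.1 - s • q.2, q.2)
  simp only [sub_add_cancel] at h1 h2 h3 h4
  exact ⟨h1, h2, h3, h4⟩

/-- A non-negative fixed point of the Picard map is a mild solution. -/
theorem isMildSolution_unsharp (hS : CollisionSetting d γ₂ γ₃ b₂ b₃ α β) (T : EReal)
    {f₀ g₀ : Phase d → ℝ} (hg₀ : Integrable g₀ volume) (h₀ : g₀ =ᵐ[volume] f₀)
    {F : ℝ → Phase d → ℝ} (hF : DominatedPath α β a F) (hF0 : ∀ t p, 0 ≤ F t p)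
    (heq : picard γ₂ γ₃ b₂ b₃ g₀ F = F) :
    IsMildSolution γ₂ γ₃ b₂ b₃ α β T f₀ (unsharp F) := by
  have hα := hS.α_pos
  have hβ := hS.β_pos
  have ha := hF.nonneg
  have hMi : Integrable (fun p : Phase d => a * maxwellian α β p) volume :=
    (integrable_maxwellian hα hβ).const_mul a
  obtain ⟨h, hh, hle⟩ := exists_gainSharp_lossSharp_le hS ha
  have hu := measurable_unsharp hF.measurable
  have hGm : Measurable (Function.uncurry (gainSharp γ₂ γ₃ b₂ b₃ (unsharp F))) :=
    measurable_gain_unsharp hS hu hu hu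
  have hLm : Measurable (Function.uncurry (lossSharp γ₂ γ₃ b₂ b₃ (unsharp F))) :=
    measurable_loss_unsharp hS hu hu hu
  have hGle : ∀ t p, |gainSharp γ₂ γ₃ b₂ b₃ (unsharp F) t p| ≤ h p := fun t p =>
    (hle t _ (hF.dominated t) p).1
  have hLle : ∀ t p, |lossSharp γ₂ γ₃ b₂ b₃ (unsharp F) t p| ≤ h p := fun t p =>
    (hle t _ (hF.dominated t) p).2
  have hu0 : ∀ t q, 0 ≤ unsharp F t q := fun t q => hF0 t _
  have hmem : MemFPos T F := fun t _ =>
    ⟨hF.measurable.of_uncurry_left.aemeasurable, ae_of_all _ (hF0 t)⟩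
  have hFi := integrable_slice_of_le hF.measurable hMi hF.le
  set W := signedCollisionSharp γ₂ γ₃ b₂ b₃ F with hWdef
  have hWeq : ∀ t, W t = fun p => gainSharp γ₂ γ₃ b₂ b₃ (unsharp F) t p -
      lossSharp γ₂ γ₃ b₂ b₃ (unsharp F) t p := fun t =>
    funext (signedCollisionSharp_of_nonneg (hF0 t))
  have hWm : Measurable (Function.uncurry W) := measurable_signedCollisionSharp hS hF.measurable
  have hh2 : Integrable (fun p => h p + h p) volume := hh.add hh
  have hWle : ∀ t p, |W t p| ≤ h p + h p := fun t p => by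
    rw [hWeq]
    exact (abs_sub _ _).trans (add_le_add (hGle t p) (hLle t p))
  have hw : ∀ t, toL1 (gainSharp γ₂ γ₃ b₂ b₃ (unsharp F) t) -
      toL1 (lossSharp γ₂ γ₃ b₂ b₃ (unsharp F) t) = toL1 (W t) := fun t => by
    rw [hWeq, toL1_sub (integrable_slice_of_le hGm hh hGle t)
      (integrable_slice_of_le hLm hh hLle t)]
  -- The pointwise fixed point identity becomes an identity of Bochner integrals in `L¹`, which
  -- yields both continuity and the weak derivative.
  have hprim : ∀ t, toL1 (F t) = toL1 g₀ + ∫ s in Ioc 0 t, toL1 (W s) := fun t => by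
    obtain ⟨i1, -, i3⟩ := toL1_setIntegral hWm hh2 hWle (Ioc 0 t)
    rw [← i3, ← toL1_add hg₀ i1]
    exact congrArg toL1 (congrFun heq t).symm
  have hWint : ∀ x y : ℝ, IntegrableOn (fun t => toL1 (W t)) (Ioc x y) volume := fun x y =>
    (toL1_setIntegral hWm hh2 hWle (Ioc x y)).2.1
  have hcont : ContinuousOn (fun t => toL1 (F t)) (timeInterval T) := by
    have h1 := intervalIntegral.continuous_primitive (μ := volume) (f := fun t => toL1 (W t))
      (fun x y => ⟨hWint x y, hWint y x⟩) 0
    refine (continuous_const.add h1).continuousOn.congr (f := fun t => toL1 g₀ + _)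
      fun t ht => ?_
    simp only [hprim, intervalIntegral.integral_of_le ht.1]
  refine ⟨fun t _ => ⟨hu.of_uncurry_left.aemeasurable, ae_of_all _ (hu0 t)⟩, ?_, ?_,
    fun t _ => collisionsConverge hS (hF.dominated t), ?_, ?_, ?_, ?_⟩
  · rw [sharp_unsharp]
    exact ⟨hmem, fun t _ => hFi t, hcont⟩
  · rw [sharp_unsharp]
    exact ⟨hmem, (tripleNorm_le hF).trans_lt ENNReal.ofReal_lt_top⟩
  · exact memLinfL1Pos_of_le hLm (fun t p => loss_nonneg hS (hu0 t) (hu0 t) (hu0 t) _) hh hLle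
  · exact memLinfL1Pos_of_le hGm (fun t p => gain_nonneg hS (hu0 t) (hu0 t) (hu0 t) _) hh hGle
  · simp_rw [sharp_unsharp, hw]
    exact ⟨(locallyIntegrable_toL1 hF.measurable hMi hF.le).locallyIntegrableOn _,
      (locallyIntegrable_toL1 hWm hh2 hWle).locallyIntegrableOn _, fun φ hφ hc hs =>
        integral_deriv_smul_primitive (fun t _ => hWint 0 t) (fun t _ => hprim t) hφ hc hs⟩
  · rw [sharp_unsharp]
    refine Filter.EventuallyEq.trans (ae_of_all _ fun p => ?_) h₀
    rw [← heq]
    simp [picard]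

end Existence

/-! ### Uniqueness of mild solutions -/

section Uniqueness

variable {d : ℕ} {γ₂ γ₃ : ℝ} {b₂ : ℝ → ℝ} {b₃ : ℝ → ℝ → ℝ} {α β : ℝ} {a δ s : ℝ}

/-- Two a.e. dominated functions at an a.e. controlled distance have representatives for which the
bounds hold everywhere. -/
theorem exists_dominated_ae_eq {f g : Phase d → ℝ} (ha : 0 ≤ a) (hδ : 0 ≤ δ)
    (hf : AEMeasurable f volume) (hg : AEMeasurable g volume) (hf0 : 0 ≤ᵐ[volume] f)
    (hg0 : 0 ≤ᵐ[volume] g) (hfa : ∀ᵐ q, |f q| ≤ a * movingMaxwellian α β s q)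
    (hga : ∀ᵐ q, |g q| ≤ a * movingMaxwellian α β s q)
    (hfg : ∀ᵐ q, |f q - g q| ≤ δ * movingMaxwellian α β s q) :
    ∃ f' g' : Phase d → ℝ, Dominated α β a s f' ∧ Dominated α β a s g' ∧ (∀ q, 0 ≤ f' q) ∧
      (∀ q, 0 ≤ g' q) ∧ f =ᵐ[volume] f' ∧ g =ᵐ[volume] g' ∧
      ∀ q, |f' q - g' q| ≤ δ * movingMaxwellian α β s q := by
  set M : Phase d → ℝ := movingMaxwellian α β s with hM
  have hMm : Measurable M := dominated_movingMaxwellian.measurable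
  have hM0 : ∀ q, 0 ≤ M q := fun q => (movingMaxwellian_pos _ _ _ _).le
  have haM : ∀ q, 0 ≤ a * M q := fun q => mul_nonneg ha (hM0 q)
  have hδM : ∀ q, 0 ≤ δ * M q := fun q => mul_nonneg hδ (hM0 q)
  -- Both functions are truncated to `[0, a M]`. The second representative is then also clamped to
  -- within `δ M` of the first, which changes neither on a set of positive measure.
  set k : Phase d → ℝ := fun q => max 0 (min (hf.mk f q) (a * M q)) with hk
  set l : Phase d → ℝ := fun q => max 0 (min (hg.mk g q) (a * M q)) with hl
  have hkm : Measurable k := measurable_const.max (hf.measurable_mk.min (hMm.const_mul a))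
  have hlm : Measurable l := measurable_const.max (hg.measurable_mk.min (hMm.const_mul a))
  have hk0 : ∀ q, 0 ≤ k q := fun q => le_max_left _ _
  have hl0 : ∀ q, 0 ≤ l q := fun q => le_max_left _ _
  have hka : ∀ q, k q ≤ a * M q := fun q => max_le (haM q) (min_le_right _ _)
  have hla : ∀ q, l q ≤ a * M q := fun q => max_le (haM q) (min_le_right _ _)
  have hfk : f =ᵐ[volume] k := by
    filter_upwards [hf.ae_eq_mk, hf0, hfa] with q h1 h2 h3
    simp only [hk, ← h1]
    rw [min_eq_left ((le_abs_self _).trans h3), max_eq_right (show (0 : ℝ) ≤ _ from h2)]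
  have hgl : g =ᵐ[volume] l := by
    filter_upwards [hg.ae_eq_mk, hg0, hga] with q h1 h2 h3
    simp only [hl, ← h1]
    rw [min_eq_left ((le_abs_self _).trans h3), max_eq_right (show (0 : ℝ) ≤ _ from h2)]
  have hl'0 : ∀ q, 0 ≤ max (k q - δ * M q) (min (k q + δ * M q) (l q)) := fun q =>
    le_max_of_le_right (le_min (add_nonneg (hk0 q) (hδM q)) (hl0 q))
  refine ⟨k, fun q => max (k q - δ * M q) (min (k q + δ * M q) (l q)), ⟨hkm, fun q => ?_⟩,
    ⟨(hkm.sub (hMm.const_mul δ)).max ((hkm.add (hMm.const_mul δ)).min hlm), fun q => ?_⟩, hk0,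
    hl'0, hfk, ?_, fun q => ?_⟩
  · rw [abs_of_nonneg (hk0 q)]
    exact hka q
  · rw [abs_of_nonneg (hl'0 q)]
    exact max_le ((sub_le_self _ (hδM q)).trans (hka q)) ((min_le_right _ _).trans (hla q))
  · filter_upwards [hfk, hgl, hfg] with q h1 h2 h3
    rw [h1, h2, abs_le] at h3
    rw [h2, min_eq_right (by linarith), max_eq_right (by linarith)]
  · rw [abs_le]
    constructor
    · have : max (k q - δ * M q) (min (k q + δ * M q) (l q)) ≤ k q + δ * M q :=
        max_le (by linarith [hδM q]) (min_le_left _ _)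
      linarith
    · have := le_max_left (k q - δ * M q) (min (k q + δ * M q) (l q))
      linarith

theorem ae_movingMaxwellian_of_sharp {P : ℝ → ℝ → Prop} {f : ℝ → Phase d → ℝ}
    (h : ∀ᵐ p, P (sharp f s p) (maxwellian α β p)) :
    ∀ᵐ q, P (f s q) (movingMaxwellian α β s q) := by
  have := (measurePreserving_transport (d := d) (-s)).quasiMeasurePreserving.ae h
  filter_upwards [this] with q hq
  simpa [sharp, movingMaxwellian, sub_eq_add_neg] using hq

/-- The right-hand side `G^# - L^#` of the equation as an element of `L¹`. -/
def collisionL1 (γ₂ γ₃ : ℝ) (b₂ : ℝ → ℝ) (b₃ : ℝ → ℝ → ℝ) (f : ℝ → Phase d → ℝ) (t : ℝ) :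
    Phase d →₁[volume] ℝ :=
  toL1 (gainSharp γ₂ γ₃ b₂ b₃ f t) - toL1 (lossSharp γ₂ γ₃ b₂ b₃ f t)

theorem integrable_signedCollision (hS : CollisionSetting d γ₂ γ₃ b₂ b₃ α β)
    {f : Phase d → ℝ} (hf : Dominated α β a s f) :
    Integrable (fun p : Phase d => signedCollision γ₂ γ₃ b₂ b₃ f (p.1 + s • p.2, p.2)) volume := by
  obtain ⟨C, -, hC⟩ := hS.exists_majorant_le hf.nonneg
  have ha := hf.nonneg
  refine ((((integrable_maxwellian hS.α_pos (half_pos hS.β_pos)).const_mul C).const_mul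
    (6 * a * a))).mono' ?_ (ae_of_all _ fun p => (abs_signedCollision_le hS hf p).trans
      (mul_le_mul_of_nonneg_left (hC s p) (by positivity)))
  -- An auxiliary path, constant in its time variable, whose `unsharp` at time `s` is `f`:
  -- measurability of the path estimate is thereby reused for a single slice.
  have hm : Measurable (Function.uncurry fun (_ : ℝ) (p : Phase d) => f (p.1 + s • p.2, p.2)) :=
    hf.measurable.comp (f := fun z : ℝ × Phase d => (z.2.1 + s • z.2.2, z.2.2)) (by fun_prop)
  have h1 := (measurable_signedCollisionSharp hS hm).of_uncurry_left (x := s)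
  have h2 : unsharp (fun (_ : ℝ) (p : Phase d) => f (p.1 + s • p.2, p.2)) s = f := by
    funext q
    simp [unsharp]
  have h3 : signedCollisionSharp γ₂ γ₃ b₂ b₃ (fun (_ : ℝ) (p : Phase d) => f (p.1 + s • p.2, p.2))
      s = fun p => signedCollision γ₂ γ₃ b₂ b₃ f (p.1 + s • p.2, p.2) := by
    funext p
    rw [signedCollisionSharp, h2]
  rw [h3] at h1
  exact h1.aestronglyMeasurable

/-- In `L¹` a slice may be exchanged for a non-negative representative bounded everywhere, for which
the modified operator coincides with the true one. -/
theorem collisionL1_eq (hS : CollisionSetting d γ₂ γ₃ b₂ b₃ α β) {f : ℝ → Phase d → ℝ}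
    {f' : Phase d → ℝ} (hf' : Dominated α β a s f') (h0 : ∀ q, 0 ≤ f' q)
    (hff : f s =ᵐ[volume] f') : collisionL1 γ₂ γ₃ b₂ b₃ f s =
      toL1 (fun p => signedCollision γ₂ γ₃ b₂ b₃ f' (p.1 + s • p.2, p.2)) := by
  have hq := (measurePreserving_transport (d := d) s).quasiMeasurePreserving
  have hm : Measurable (Function.uncurry fun (_ : ℝ) => f') :=
    hf'.measurable.comp measurable_snd
  obtain ⟨h, hh, hle⟩ := exists_gainSharp_lossSharp_le hS hf'.nonneg
  have hG : Integrable (fun p : Phase d => gain γ₂ γ₃ b₂ b₃ f' f' f' (p.1 + s • p.2, p.2))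
      volume :=
    hh.mono' ((measurable_gain_unsharp hS hm hm hm).comp
      (measurable_prodMk_left (x := s))).aestronglyMeasurable
      (ae_of_all _ fun p => (hle s f' hf' p).1)
  have hL : Integrable (fun p : Phase d => loss γ₂ γ₃ b₂ b₃ f' f' f' (p.1 + s • p.2, p.2))
      volume :=
    hh.mono' ((measurable_loss_unsharp hS hm hm hm).comp
      (measurable_prodMk_left (x := s))).aestronglyMeasurable
      (ae_of_all _ fun p => (hle s f' hf' p).2)
  have e1 : gainSharp γ₂ γ₃ b₂ b₃ f s =ᵐ[volume]
      fun p => gain γ₂ γ₃ b₂ b₃ f' f' f' (p.1 + s • p.2, p.2) :=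
    hq.ae_eq (gain_congr_ae hff)
  have e2 : lossSharp γ₂ γ₃ b₂ b₃ f s =ᵐ[volume]
      fun p => loss γ₂ γ₃ b₂ b₃ f' f' f' (p.1 + s • p.2, p.2) :=
    hq.ae_eq (loss_congr_ae hff)
  have habs : (fun q => |f' q|) = f' := funext fun q => abs_of_nonneg (h0 q)
  rw [collisionL1, toL1_congr e1, toL1_congr e2, ← toL1_sub hG hL]
  simp only [signedCollision, habs]

/-- The hypotheses on a mild solution used for uniqueness. -/
structure BoundedMildSolution (γ₂ γ₃ : ℝ) (b₂ : ℝ → ℝ) (b₃ : ℝ → ℝ → ℝ) (α β a : ℝ) (T : EReal)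
    (f₀ : Phase d → ℝ) (f : ℝ → Phase d → ℝ) : Prop where
  mild : IsMildSolution γ₂ γ₃ b₂ b₃ α β T f₀ f
  le : ∀ t ∈ timeInterval T, ∀ᵐ p, |sharp f t p| ≤ a * maxwellian α β p

theorem integrable_majorant_slice (hS : CollisionSetting d γ₂ γ₃ b₂ b₃ α β) (ha : 0 ≤ a)
    (c : ℝ) : ∃ h : Phase d → ℝ, Integrable h volume ∧
      ∀ s p, |c * majorant γ₂ γ₃ b₂ b₃ α β a s p| ≤ h p := by
  obtain ⟨C, -, hC⟩ := hS.exists_majorant_le ha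
  refine ⟨fun p => |c| * (C * maxwellian α (β / 2) p),
    ((integrable_maxwellian hS.α_pos (half_pos hS.β_pos)).const_mul C).const_mul _,
    fun s p => ?_⟩
  rw [abs_mul, abs_of_nonneg (hS.majorant_nonneg ha p)]
  exact mul_le_mul_of_nonneg_left (hC s p) (abs_nonneg c)

/-- A one-sided bound is enough, because the roles of `f` and `g` can be exchanged later. -/
theorem collisionL1_sub_le (hS : CollisionSetting d γ₂ γ₃ b₂ b₃ α β) (ha : 0 ≤ a) (hδ : 0 ≤ δ)
    {T : EReal} {f₀ : Phase d → ℝ} {f g : ℝ → Phase d → ℝ}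
    (hf : BoundedMildSolution γ₂ γ₃ b₂ b₃ α β a T f₀ f)
    (hg : BoundedMildSolution γ₂ γ₃ b₂ b₃ α β a T f₀ g) {t : ℝ} (ht : t ∈ timeInterval T)
    (hfg : ∀ᵐ p, |sharp f t p - sharp g t p| ≤ δ * maxwellian α β p) :
    collisionL1 γ₂ γ₃ b₂ b₃ f t - collisionL1 γ₂ γ₃ b₂ b₃ g t ≤
      toL1 (fun p => 6 * a * δ * majorant γ₂ γ₃ b₂ b₃ α β a t p) := by
  have h1 := ae_movingMaxwellian_of_sharp (P := fun x y => |x| ≤ a * y) (hf.le t ht)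
  have h2 := ae_movingMaxwellian_of_sharp (P := fun x y => |x| ≤ a * y) (hg.le t ht)
  have h3 := ae_movingMaxwellian_of_sharp (P := fun x y => |x| ≤ δ * y)
    (f := fun t p => f t p - g t p) hfg
  obtain ⟨f', g', hf', hg', hf0, hg0, hff, hgg, hd⟩ := exists_dominated_ae_eq ha hδ
    (hf.mild.memFPos t ht).1 (hg.mild.memFPos t ht).1 (hf.mild.memFPos t ht).2
    (hg.mild.memFPos t ht).2 h1 h2 h3
  have hi := integrable_signedCollision hS hf'
  have hi' := integrable_signedCollision hS hg'
  rw [collisionL1_eq hS hf' hf0 hff, collisionL1_eq hS hg' hg0 hgg, ← toL1_sub hi hi']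
  obtain ⟨h, hh, hle⟩ := integrable_majorant_slice hS ha (6 * a * δ)
  refine toL1_le_toL1 (hi.sub hi') (integrable_slice_of_le
    (W := fun s p => 6 * a * δ * majorant γ₂ γ₃ b₂ b₃ α β a s p)
    ((hS.measurable_majorant a).const_mul _) hh hle t) (ae_of_all _ fun p => ?_)
  exact (le_abs_self _).trans (abs_signedCollision_sub_le hS hf' hg' hδ hd p)

/-- Compatibility of the order of `L¹` with scalars lets Bochner integrals be compared monotonically
in `sharp_sub_sharp_le`. -/
instance isOrderedModule_L1 : IsOrderedModule ℝ (Phase d →₁[volume] ℝ) := by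
  have h : ∀ (c : ℝ), 0 ≤ c → ∀ u v : Phase d →₁[volume] ℝ, u ≤ v → c • u ≤ c • v := by
    intro c hc u v huv
    rw [← Lp.coeFn_le] at huv ⊢
    filter_upwards [Lp.coeFn_smul c u, Lp.coeFn_smul c v, huv] with p h1 h2 h3
    rw [h1, h2]
    exact mul_le_mul_of_nonneg_left h3 hc
  exact
    { smul_le_smul_of_nonneg_left := fun c hc u v huv => h c hc u v huv
      smul_le_smul_of_nonneg_right := fun u hu c c' hcc => by
        rw [← sub_nonneg, ← sub_smul]
        simpa using h (c' - c) (sub_nonneg.2 hcc) 0 u hu }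

/-- One contraction step for two arbitrary mild solutions. They need not be jointly measurable in
time and phase space, so time is integrated in `L¹` and compared in its order; pointwise bounds
return only after the explicit majorant has been integrated. -/
theorem sharp_sub_sharp_le (hS : CollisionSetting d γ₂ γ₃ b₂ b₃ α β) (ha : 0 ≤ a) (hδ : 0 ≤ δ)
    {T : EReal} (hT : 0 < T) {f₀ : Phase d → ℝ} {f g : ℝ → Phase d → ℝ}
    (hf : BoundedMildSolution γ₂ γ₃ b₂ b₃ α β a T f₀ f)
    (hg : BoundedMildSolution γ₂ γ₃ b₂ b₃ α β a T f₀ g)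
    (hfg : ∀ t ∈ timeInterval T, ∀ᵐ p, |sharp f t p - sharp g t p| ≤ δ * maxwellian α β p)
    {t : ℝ} (ht : t ∈ timeInterval T) : ∀ᵐ p, sharp f t p - sharp g t p ≤
      δ * picardRate d γ₂ γ₃ b₂ b₃ α β a * maxwellian α β p := by
  have hI : ∀ {k : ℝ → Phase d → ℝ}, BoundedMildSolution γ₂ γ₃ b₂ b₃ α β a T f₀ k →
      IntegrableOn (collisionL1 γ₂ γ₃ b₂ b₃ k) (Ioc 0 t) volume := fun hk =>
    (hk.mild.equation.2.1.integrableOn_compact_subset (t := Icc 0 t)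
      (fun s hs => timeInterval_mem_of_le hs.1 hs.2 ht) isCompact_Icc).mono_set Ioc_subset_Icc_self
  have hu : ∀ {k : ℝ → Phase d → ℝ}, BoundedMildSolution γ₂ γ₃ b₂ b₃ α β a T f₀ k →
      toL1 (sharp k t) = toL1 f₀ + ∫ s in Ioc 0 t, collisionL1 γ₂ γ₃ b₂ b₃ k s := fun hk => by
    rw [← toL1_congr hk.mild.initial]
    exact eq_add_integral_of_hasWeakTimeDeriv hT hk.mild.continuous.2.2 hk.mild.equation ht
  obtain ⟨h, hh, hle⟩ := integrable_majorant_slice hS ha (6 * a * δ)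
  obtain ⟨i1, i2, i3⟩ := toL1_setIntegral
    (W := fun s p => 6 * a * δ * majorant γ₂ γ₃ b₂ b₃ α β a s p)
    ((hS.measurable_majorant a).const_mul _) hh hle (Ioc 0 t)
  have hmono : ∫ s in Ioc 0 t,
      (collisionL1 γ₂ γ₃ b₂ b₃ f s - collisionL1 γ₂ γ₃ b₂ b₃ g s) ≤
      ∫ s in Ioc 0 t, toL1 (fun p => 6 * a * δ * majorant γ₂ γ₃ b₂ b₃ α β a s p) :=
    setIntegral_mono_on ((hI hf).sub (hI hg)) i2 measurableSet_Ioc fun s hs => by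
      have hs' := timeInterval_mem_of_le hs.1.le hs.2 ht
      exact collisionL1_sub_le hS ha hδ hf hg hs' (hfg s hs')
  have hfi := hf.mild.continuous.2.1 t ht
  have hgi := hg.mild.continuous.2.1 t ht
  have hle1 : toL1 (fun p => sharp f t p - sharp g t p) ≤
      toL1 (fun p => ∫ s in Ioc 0 t, 6 * a * δ * majorant γ₂ γ₃ b₂ b₃ α β a s p) := by
    rw [i3, toL1_sub hfi hgi, hu hf, hu hg, add_sub_add_left_eq_sub, ← integral_sub (hI hf) (hI hg)]
    exact hmono
  filter_upwards [ae_le_of_toL1_le (hfi.sub hgi) i1 hle1] with p hp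
  exact hp.trans (setIntegral_majorant_le hS ha hδ _ p)

/-- Mild solutions bounded by `a` Maxwellians are unique when the Picard map is a contraction. -/
theorem BoundedMildSolution.ae_eq (hS : CollisionSetting d γ₂ γ₃ b₂ b₃ α β) (ha : 0 ≤ a)
    (hlt : picardRate d γ₂ γ₃ b₂ b₃ α β a < 1)
    {T : EReal} (hT : 0 < T) {f₀ : Phase d → ℝ} {f g : ℝ → Phase d → ℝ}
    (hf : BoundedMildSolution γ₂ γ₃ b₂ b₃ α β a T f₀ f)
    (hg : BoundedMildSolution γ₂ γ₃ b₂ b₃ α β a T f₀ g) {t : ℝ} (ht : t ∈ timeInterval T) :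
    f t =ᵐ[volume] g t := by
  set θ := picardRate d γ₂ γ₃ b₂ b₃ α β a with hθ
  have hθ0 : 0 ≤ θ := by
    have := hS.constK_nonneg
    have := hS.α_pos
    rw [hθ, picardRate]; positivity
  -- The triangle inequality starts the induction with `2a`, and every contraction step, used in
  -- both directions, gains a factor `θ`.
  have key : ∀ n : ℕ, ∀ t ∈ timeInterval T,
      ∀ᵐ p, |sharp f t p - sharp g t p| ≤ 2 * a * θ ^ n * maxwellian α β p := by
    intro n
    induction n with
    | zero =>
      intro t ht
      filter_upwards [hf.le t ht, hg.le t ht] with p h1 h2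
      have := (abs_sub (sharp f t p) (sharp g t p)).trans (add_le_add h1 h2)
      linarith
    | succ n ih =>
      intro t ht
      have ih' : ∀ t ∈ timeInterval T,
          ∀ᵐ p, |sharp g t p - sharp f t p| ≤ 2 * a * θ ^ n * maxwellian α β p := fun t ht => by
        simpa only [abs_sub_comm] using ih t ht
      filter_upwards [sharp_sub_sharp_le hS ha (by positivity) hT hf hg ih ht,
        sharp_sub_sharp_le hS ha (by positivity) hT hg hf ih' ht] with p h1 h2
      rw [← hθ] at h1 h2
      rw [pow_succ, ← mul_assoc, abs_le]
      constructor <;> linarith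
  refine ae_eq_of_sharp_ae_eq ?_
  filter_upwards [ae_all_iff.2 fun n => key n t ht] with p hp
  have hlim : Filter.Tendsto (fun n : ℕ => 2 * a * θ ^ n * maxwellian α β p) Filter.atTop
      (nhds 0) := by
    simpa using ((tendsto_pow_atTop_nhds_zero_of_lt_one hθ0 hlt).const_mul (2 * a)).mul_const
      (maxwellian α β p)
  have := ge_of_tendsto' hlim hp
  exact sub_eq_zero.1 (abs_nonpos_iff.1 this)

end Uniqueness

/-! ### The constants -/

/-- Below the threshold, the Picard map is a contraction of the functions bounded by
`constOut` Maxwellians. -/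
theorem constOut_bounds {K α m : ℝ} (hK : 0 < K) (hα : 0 < α) (hm : 0 ≤ m)
    (hlt : m < threshold K α) : 0 ≤ constOut K α m ∧
      6 * constOut K α m * (K * α ^ (-(1 / 2) : ℝ) * (1 + constOut K α m)) < 1 ∧
      m + constOut K α m * (6 * constOut K α m *
        (K * α ^ (-(1 / 2) : ℝ) * (1 + constOut K α m))) ≤ constOut K α m := by
  set A : ℝ := α ^ (-(1 / 2) : ℝ) with hA
  have hA0 : 0 < A := by positivity
  set σ : ℝ := α ^ (1 / 4 : ℝ) / (2 * Real.sqrt (6 * K)) with hσ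
  have hσ0 : 0 < σ := by positivity
  have hinv : α ^ (1 / 2 : ℝ) = A⁻¹ := by rw [hA, Real.rpow_neg hα.le, inv_inv]
  -- This relation is the reason for the particular `σ`: it will give `C_out ≤ σ`, so that `1 + a`
  -- may be replaced by the constant `1 + σ`.
  have hσ2 : σ ^ 2 * (24 * K * A) = 1 := by
    have h1 : (α ^ (1 / 4 : ℝ)) ^ 2 = A⁻¹ := by
      rw [← hinv, ← Real.rpow_natCast, ← Real.rpow_mul hα.le]
      norm_num
    rw [hσ, div_pow, mul_pow, Real.sq_sqrt (by positivity), h1]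
    field_simp
    norm_num
  set κ : ℝ := K * A * (1 + σ) with hκ
  have hκ0 : 0 < κ := by positivity
  have hthr : threshold K α = 1 / (48 * κ) := by
    rw [threshold, constFactor, ← hσ, hinv, hκ]
    field_simp
  rw [hthr, lt_div_iff₀ (by positivity)] at hlt
  set r : ℝ := Real.sqrt (1 - 48 * κ * m) with hr
  have hr2 : r ^ 2 = 1 - 48 * κ * m := Real.sq_sqrt (by linarith)
  have hr0 : 0 < r := Real.sqrt_pos.2 (by linarith)
  have hr1 : r ≤ 1 := Real.sqrt_le_one.2 (by nlinarith [mul_nonneg hκ0.le hm])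
  have hout : constOut K α m = (1 - r) / (24 * κ) := by
    rw [constOut, constFactor, ← hσ, ← hA, hr, hκ]
    ring_nf
  rw [hout]
  set a : ℝ := (1 - r) / (24 * κ) with ha
  have ha0 : 0 ≤ a := div_nonneg (by linarith) (by positivity)
  have haκ : 24 * κ * a = 1 - r := by rw [ha]; field_simp
  -- Indeed `24 κ a = 1 - r ≤ 1`, while `24 κ σ` contains the summand `24 K A σ² = 1`.
  have haσ : a ≤ σ := by
    have h1 : 24 * κ * a ≤ 24 * κ * σ := by
      have : 24 * κ * σ = 24 * K * A * σ + σ ^ 2 * (24 * K * A) := by rw [hκ]; ring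
      rw [haκ, this, hσ2]
      have : 0 < 24 * K * A * σ := by positivity
      linarith
    exact le_of_mul_le_mul_left h1 (by positivity)
  have hrate : 6 * a * (K * A * (1 + a)) ≤ 6 * a * κ := by
    rw [hκ]
    gcongr
  -- `a` is the smaller root of `12 κ a² - a + m = 0`. Invariance needs only `6 κ a²`, half of the
  -- available room.
  have hquad : a - 12 * κ * a ^ 2 = m := by
    have : 48 * κ * (a - 12 * κ * a ^ 2) = 48 * κ * m := by
      have : 48 * κ * (a - 12 * κ * a ^ 2) = 2 * (24 * κ * a) - (24 * κ * a) ^ 2 := by ring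
      rw [this, haκ]
      linarith [hr2]
    exact mul_left_cancel₀ (by positivity) this
  refine ⟨ha0, by linarith, ?_⟩
  have h1 : a * (6 * a * (K * A * (1 + a))) ≤ a * (6 * a * κ) :=
    mul_le_mul_of_nonneg_left hrate ha0
  have h2 : 0 ≤ κ * a ^ 2 := by positivity
  linarith

theorem CollisionSetting.constK_pos {d : ℕ} {γ₂ γ₃ : ℝ} {b₂ : ℝ → ℝ} {b₃ : ℝ → ℝ → ℝ} {α β : ℝ}
    (hS : CollisionSetting d γ₂ γ₃ b₂ b₃ α β)
    (hb : 0 < angularNorm2 d b₂ ∨ 0 < angularNorm3 d b₃) :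
    0 < constK d (collisionConst d) γ₂ γ₃ b₂ b₃ β := by
  have hC := collisionConst_pos d
  have hβ := hS.β_pos
  have hr₂ : 0 < (d : ℝ) + γ₂ - 1 := by linarith [hS.mem₂.1]
  have hr₃ : 0 < 2 * (d : ℝ) + γ₃ - 1 := by linarith [hS.mem₃.1]
  unfold constK
  rcases hb with hb | hb
  · have := ENNReal.toReal_pos hb.ne' hS.ang₂.integrable.ne
    positivity
  · have := ENNReal.toReal_pos hb.ne' hS.ang₃.integrable.ne
    positivity

/-- Non-negative functions bounded by a Maxwellian have representatives for which this holds
everywhere. -/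
theorem MemMaxwellPos.exists_ae_eq {d : ℕ} {α β : ℝ} {f : Phase d → ℝ}
    (hf : MemMaxwellPos α β f) : ∃ g : Phase d → ℝ, Measurable g ∧ (∀ p, 0 ≤ g p) ∧
      (∀ p, |g p| ≤ (maxwellNorm α β f).toReal * maxwellian α β p) ∧ f =ᵐ[volume] g := by
  have hm : 0 ≤ (maxwellNorm α β f).toReal := ENNReal.toReal_nonneg
  have hle : ∀ᵐ q, |f q| ≤ (maxwellNorm α β f).toReal * movingMaxwellian α β 0 q := by
    have := ae_abs_le_of_maxwellNorm_le hm (ENNReal.ofReal_toReal hf.2.2.ne).ge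
    simpa [movingMaxwellian] using this
  -- The lemma on pairs, applied to `f` and itself at distance `δ = 0` and time `0`.
  obtain ⟨g, -, hg, -, h0, -, hfg, -, -⟩ := exists_dominated_ae_eq hm le_rfl hf.1 hf.1 hf.2.1
    hf.2.1 hle hle (ae_of_all _ fun q => by simp)
  refine ⟨g, hg.measurable, h0, fun p => ?_, hfg⟩
  simpa [movingMaxwellian] using hg.le p

theorem IsMildSolution.boundedMildSolution {d : ℕ} {γ₂ γ₃ : ℝ} {b₂ : ℝ → ℝ} {b₃ : ℝ → ℝ → ℝ}
    {α β a : ℝ} {T : EReal} {f₀ : Phase d → ℝ} {f : ℝ → Phase d → ℝ} (ha : 0 ≤ a)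
    (hf : IsMildSolution γ₂ γ₃ b₂ b₃ α β T f₀ f)
    (hle : tripleNorm α β T (sharp f) ≤ ENNReal.ofReal a) :
    BoundedMildSolution γ₂ γ₃ b₂ b₃ α β a T f₀ f :=
  ⟨hf, fun t ht => ae_abs_le_of_maxwellNorm_le ha
    ((le_iSup₂ (f := fun t (_ : t ∈ timeInterval T) => maxwellNorm α β (sharp f t)) t ht).trans
      hle)⟩

end BinaryTernaryBoltzmann

end

/-! ### The main theorem -/

theorem theorem2p1 (d : ℕ) (hd : 2 ≤ d) :
    ∃ C : ℝ, 0 < C ∧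
      ∀ (γ₂ γ₃ : ℝ), γ₂ ∈ Set.Ioc (-(d : ℝ) + 1) 1 → γ₃ ∈ Set.Ioc (-(2 * (d : ℝ)) + 1) 1 →
      ∀ (b₂ : ℝ → ℝ) (b₃ : ℝ → ℝ → ℝ), IsBinaryAngular d b₂ → IsTernaryAngular d b₃ →
        (0 < angularNorm2 d b₂ ∨ 0 < angularNorm3 d b₃) →
      ∀ (T : EReal) (α β : ℝ), 0 < T → 0 < α → 0 < β →
        0 < constK d C γ₂ γ₃ b₂ b₃ β ∧
        ∀ f₀ : Phase d → ℝ, MemMaxwellPos α β f₀ →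
          maxwellNorm α β f₀ < ENNReal.ofReal (threshold (constK d C γ₂ γ₃ b₂ b₃ β) α) →
          ∃ f : ℝ → Phase d → ℝ,
            (IsMildSolution γ₂ γ₃ b₂ b₃ α β T f₀ f ∧
              tripleNorm α β T (sharp f) ≤ ENNReal.ofReal
                (constOut (constK d C γ₂ γ₃ b₂ b₃ β) α (maxwellNorm α β f₀).toReal)) ∧
            ∀ g : ℝ → Phase d → ℝ,
              IsMildSolution γ₂ γ₃ b₂ b₃ α β T f₀ g →
              tripleNorm α β T (sharp g) ≤ ENNReal.ofReal
                (constOut (constK d C γ₂ γ₃ b₂ b₃ β) α (maxwellNorm α β f₀).toReal) →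
              ∀ t ∈ timeInterval T, g t =ᵐ[MeasureTheory.volume] f t := by
  refine ⟨collisionConst d, collisionConst_pos d,
    fun γ₂ γ₃ hγ₂ hγ₃ b₂ b₃ hb₂ hb₃ hb T α β hT hα hβ => ?_⟩
  have hS : CollisionSetting d γ₂ γ₃ b₂ b₃ α β := ⟨hd, hγ₂, hγ₃, hb₂, hb₃, hα, hβ⟩
  have hK := hS.constK_pos hb
  refine ⟨hK, fun f₀ hf₀ hlt => ?_⟩
  obtain ⟨ha, hrate, hle⟩ := constOut_bounds hK hα ENNReal.toReal_nonneg
    (ENNReal.toReal_lt_of_lt_ofReal hlt)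
  obtain ⟨g₀, hgm, hg0, hgle, hfg⟩ := hf₀.exists_ae_eq
  obtain ⟨F, hF, heq⟩ := exists_picard_eq hS hgm hgle ha hle hrate
  have hgi : Integrable g₀ volume := ((integrable_maxwellian hα hβ).const_mul _).mono'
    hgm.aestronglyMeasurable (ae_of_all _ hgle)
  have hsol := isMildSolution_unsharp hS T hgi hfg.symm hF (nonneg_of_picard_eq hS hg0 hF heq) heq
  have hbd := tripleNorm_le (T := T) hF
  rw [← sharp_unsharp F] at hbd
  refine ⟨unsharp F, ⟨hsol, hbd⟩, fun g hg hgbd t ht => ?_⟩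
  exact (hg.boundedMildSolution ha hgbd).ae_eq hS ha hrate hT (hsol.boundedMildSolution ha hbd) ht
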